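/- Let $n\ge 1$, let $\mathbb B$ be the open unit ball of $\mathbb C^n$ and let $dV$ be Lebesgue measure on $\mathbb B$ normalized so that $V(\mathbb B)=1$. Let $\omega$ be a radial weight, i.e. $\omega:[0,1)\to(0,\infty)$ is Lebesgue integrable, and $\omega(z):=\omega(|z|)$ for $z\in\mathbb B$. Put $\hat\omega(r)=\int_r^1\omega(t)\,dt$. The weight is *doubling*, $\omega\in\hat{\mathcal D}$, if there is $C>0$ with $\hat\omega(r)<C\,\hat\omega\big(\tfrac{1+r}{2}\big)$ for all $r\in[0,1)$; it is *reverse doubling* if there are $K>1$ and $C>1$ with $\hat\omega(t)\ge C\,\hat\omega\big(1-\tfrac{1-t}{K}\big)$ for all $t\in(0,1)$; and $\mathcal D$ is the class of radial weights that are both doubling and reverse doubling. Let $A^2_\omega$ be the space of holomorphic functions on $\mathbb B$ that lie in $L^2(\mathbb B,\omega\,dV)$. For $z\in\mathbb B$ let $B_z^\omega\in A^2_\omega$ be the reproducing kernel at $z$, i.e. $f(z)=\int_{\mathbb B}f(w)\overline{B_z^\omega(w)}\,\omega(w)\,dV(w)$ for all $f\in A^2_\omega$, and let $$P_\omega\varphi(z)=\int_{\mathbb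 B}\varphi(\xi)\,\overline{B_z^\omega(\xi)}\,\omega(\xi)\,dV(\xi),\qquad z\in\mathbb B .$$ Let $L^\infty=L^\infty(\mathbb B,dV)$. The Bloch space $\mathcal B$ consists of the holomorphic functions $f$ on $\mathbb B$ with $$\|f\|_{\mathcal B}=|f(0)|+\sup_{z\in\mathbb B}(1-|z|^2)\,|\Re f(z)|<\infty,\qquad \Re f(z)=\sum_{k=1}^n z_k\frac{\partial f}{\partial z_k}(z).$$ **Theorem.** Let $\omega\in\hat{\mathcal D}$. Then, for every $z\in\mathbb B$, the kernel $B_z^\omega$ exists and is unique, and the integral defining $P_\omega\varphi(z)$ converges absolutely for every $\varphi\in L^\infty$. Moreover: 1. $P_\omega:L^\infty\to\mathcal B$ is bounded: there is a constant $C=C(n,\omega)$ such that $P_\omega\varphi\in\mathcal B$ and $\|P_\omega\varphi\|_{\mathcal B}\le C\,\|\varphi\|_{L^\infty}$ for all $\varphi\in L^\infty$. 2. If in addition $\omega$ is reverse doubling, i.e. $\omega\in\mathcal D$, then $P_\omega:L^\infty\to\mathcal B$ is also onto: for every $g\in\mathcal B$ there is $\varphi\in L^\infty$ with $P_\omega\varphi=g$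 on $\mathbb B$. -/

import Mathlib

open MeasureTheory Metric Set
open scoped ENNReal NNReal ComplexConjugate

/-- A radial weight: a positive integrable function on `[0,1)`; it is read as the function
`z ↦ ω ‖z‖` on the unit ball. Integrability includes Lebesgue measurability. Values of `ω` outside
`[0,1)` are never used. -/
structure IsRadialWeight (ω : ℝ → ℝ) : Prop where
  pos : ∀ r ∈ Ico (0 : ℝ) 1, 0 < ω r
  integrableOn : IntegrableOn ω (Ico (0 : ℝ) 1) volume

/-- The tail integral `r ↦ ∫_r^1 ω(t) dt`. -/
noncomputable def weightTail (ω : ℝ → ℝ) (r : ℝ) : ℝ :=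
  ∫ t in Ioo r 1, ω t

/-- The doubling condition on a radial weight. -/
def IsDoubling (ω : ℝ → ℝ) : Prop :=
  ∃ C : ℝ, 0 < C ∧ ∀ r ∈ Ico (0 : ℝ) 1, weightTail ω r < C * weightTail ω ((1 + r) / 2)

/-- The reverse doubling condition on a radial weight. -/
def IsReverseDoubling (ω : ℝ → ℝ) : Prop :=
  ∃ K : ℝ, 1 < K ∧ ∃ C : ℝ, 1 < C ∧
    ∀ t ∈ Ioo (0 : ℝ) 1, C * weightTail ω (1 - (1 - t) / K) ≤ weightTail ω t

/-- The open unit ball of `ℂⁿ`. -/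
abbrev unitBall (n : ℕ) : Set (EuclideanSpace ℂ (Fin n)) :=
  ball 0 1

/-- The normalized Lebesgue measure `dV` on the unit ball of `ℂⁿ` (total mass one), seen as a
measure on `ℂⁿ` that is carried by the ball. -/
noncomputable def ballVolume (n : ℕ) : Measure (EuclideanSpace ℂ (Fin n)) :=
  (volume (unitBall n))⁻¹ • volume.restrict (unitBall n)

/-- The measure `ω dV` on the unit ball of `ℂⁿ`. -/
noncomputable def weightedVolume (n : ℕ) (ω : ℝ → ℝ) : Measure (EuclideanSpace ℂ (Fin n)) :=
  (ballVolume n).withDensity fun z => ENNReal.ofReal (ω ‖z‖)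

/-- Membership in the weighted Bergman space `A^p_ω`: holomorphic on the ball and in
`L^p(ω dV)`. Only the values of `f` on the ball matter. -/
structure MemBergman (n : ℕ) (ω : ℝ → ℝ) (p : ℝ≥0∞) (f : EuclideanSpace ℂ (Fin n) → ℂ) :
    Prop where
  differentiableOn : DifferentiableOn ℂ f (unitBall n)
  memLp : MemLp f p (weightedVolume n ω)

/-- `B` is the reproducing kernel of `A²_ω` at the point `z`: it belongs to `A²_ω`, and
`f(z) = ⟨f, B⟩` for all `f` in `A²_ω`. -/
structure IsBergmanKernel (n : ℕ) (ω : ℝ → ℝ) (z : EuclideanSpace ℂ (Fin n))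
    (B : EuclideanSpace ℂ (Fin n) → ℂ) : Prop where
  memBergman : MemBergman n ω 2 B
  reproducing : ∀ f : EuclideanSpace ℂ (Fin n) → ℂ, MemBergman n ω 2 f →
    f z = ∫ w, f w * conj (B w) ∂(weightedVolume n ω)

/-- The Bergman kernel `B_z^ω`: a function with the reproducing property at `z`. -/
noncomputable def bergmanKernel (n : ℕ) (ω : ℝ → ℝ) (z : EuclideanSpace ℂ (Fin n)) :
    EuclideanSpace ℂ (Fin n) → ℂ :=
  Classical.epsilon (IsBergmanKernel n ω z)

/-- The Bergman projection `P_ω f (z) = ∫ f(ξ) conj(B_z^ω(ξ)) ω(ξ) dV(ξ)`. -/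
noncomputable def bergmanProjection (n : ℕ) (ω : ℝ → ℝ) (f : EuclideanSpace ℂ (Fin n) → ℂ)
    (z : EuclideanSpace ℂ (Fin n)) : ℂ :=
  ∫ ξ, f ξ * conj (bergmanKernel n ω z ξ) ∂(weightedVolume n ω)

/-- The radial derivative `∑ₖ zₖ ∂f/∂zₖ`. -/
noncomputable def radialDeriv (n : ℕ) (f : EuclideanSpace ℂ (Fin n) → ℂ)
    (z : EuclideanSpace ℂ (Fin n)) : ℂ :=
  ∑ k : Fin n, z k * fderiv ℂ f z (EuclideanSpace.single k 1)

/-- The Bloch norm `|f(0)| + sup_{|z|<1} (1 - |z|²) |ℜf(z)|`, with values in `[0,∞]`. -/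
noncomputable def blochNorm (n : ℕ) (f : EuclideanSpace ℂ (Fin n) → ℂ) : ℝ≥0∞ :=
  ‖f 0‖ₑ + ⨆ z ∈ unitBall n, ENNReal.ofReal (1 - ‖z‖ ^ 2) * ‖radialDeriv n f z‖ₑ

/-- Membership in the Bloch space: holomorphic on the ball, with finite Bloch norm. -/
structure MemBloch (n : ℕ) (f : EuclideanSpace ℂ (Fin n) → ℂ) : Prop where
  differentiableOn : DifferentiableOn ℂ f (unitBall n)
  blochNorm_lt_top : blochNorm n f < ∞

/-! Write n = m + 1, let u_k be the moment of ω of order 2k + 2m + 1, and let ⟨w, z⟩ be linear in z.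
Homogeneous components of different degrees are orthogonal for every radial weight, and in degree k
integration against ⟨w, z⟩^k is evaluation at z times the scalar `sphereConst m k` · u_k. This
scalar comes from one Gaussian integral, the Fock space reproducing formula, read in polar
coordinates (`integral_sphere_inner_pow`); `hasSum_integral_mul_tsum` is the resulting pairing
formula for series. So the conjugate of B_z(w) is Σ b_k ⟨w, z⟩^k with b_k = `kernelCoeff`, of size
(k+1)^m / u_k.

Both halves of the theorem rest on one L¹ estimate, `lintegral_norm_tsum_le`: if the coefficients
a_k behave like a symbol of size W_k = (k+1)^n / u_k, that is, each difference gains a factor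
1/(k+1), then Σ a_k ⟨w, z⟩^k has L¹(ω dV) norm O(1/(1-|z|)). Summing by parts 2n times bounds the
series at l = ⟨w, z⟩ by Σ W_k |l|^k / (1 + (k+1)|1-l|)^{2n}. The k-th term is dominated by the
kernel |1 - ρ_k l|^{-2n} with ρ_k = k/(k+1), whose integral is O((k+1)^n) times a moment by
orthogonality again; what remains is O(|z|^k), a geometric series. The symbol estimates hold because
doubling of the tail passes to the moments, and because differences of moments are, up to sign,
moments of (1-r²)^i ω, where every factor 1-r² costs 1/(k+1).

Boundedness: the radial derivative of Pφ is the integral of φ against the series with coefficients k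
b_k, which is of the required type.

Surjectivity: put t_k = u_k / (u_k - u_{k+1}) and φ(w) = (1-|w|²) Σ t_k g_k(w), where g = Σ g_k is
the homogeneous expansion. The factor 1-|w|² replaces u_k by u_k - u_{k+1}, so Pφ = g. For φ to be
bounded, Σ t_k g_k has to be O(1/(1-|z|)). Up to the constant term, it is the integral of
(1-|w|²)ℜg(w), bounded by the Bloch norm, against a series with coefficients comparable to t_k² b_k
/ k. Reverse doubling gives u_k - u_{k+1} ≥ c u_k / (k+1) (`exists_le_mom_sub`), so t_k is a symbol
of size k+1 and the L¹ estimate applies once more. -/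

namespace RadialBergman

/-! ### Symbol calculus for sequences and summation by parts -/

section

/-- The forward difference of a sequence. -/
def diffSeq (a : ℕ → ℝ) (k : ℕ) : ℝ := a (k + 1) - a k

/-- Symbol estimates up to order `J`: `|Δʲ a k| ≲ W k / (k + 1) ^ j` for `j ≤ J`. -/
def IsSymbol : ℕ → (ℕ → ℝ) → (ℕ → ℝ) → Prop
  | 0, W, a => ∃ C, 0 ≤ C ∧ ∀ k, |a k| ≤ C * W k
  | J + 1, W, a => (∃ C, 0 ≤ C ∧ ∀ k, |a k| ≤ C * W k) ∧
      IsSymbol J (fun k => W k / (k + 1)) (diffSeq a)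

namespace IsSymbol

variable {J : ℕ} {W V a b : ℕ → ℝ}

lemma exists_bound (h : IsSymbol J W a) : ∃ C, 0 ≤ C ∧ ∀ k, |a k| ≤ C * W k := by
  cases J with
  | zero => exact h
  | succ J => exact h.1

lemma of_succ (h : IsSymbol (J + 1) W a) : IsSymbol J W a := by
  induction J generalizing W a with
  | zero => exact h.1
  | succ J ih => exact ⟨h.1, ih h.2⟩

lemma mono (h : IsSymbol J W a) {C : ℝ} (hC : 0 ≤ C) (hWV : ∀ k, W k ≤ C * V k) :
    IsSymbol J V a := by
  have key : ∀ {W V a : ℕ → ℝ}, (∀ k, W k ≤ C * V k) → (∃ C, 0 ≤ C ∧ ∀ k, |a k| ≤ C * W k) →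
      ∃ C, 0 ≤ C ∧ ∀ k, |a k| ≤ C * V k := by
    rintro W V a hWV ⟨D, hD, h⟩
    refine ⟨D * C, by positivity, fun k => (h k).trans ?_⟩
    rw [mul_assoc]
    exact mul_le_mul_of_nonneg_left (hWV k) hD
  induction J generalizing W V a with
  | zero => exact key hWV h
  | succ J ih =>
    refine ⟨key hWV h.1, ih h.2 fun k => ?_⟩
    rw [← mul_div_assoc]
    gcongr
    exact hWV k

lemma add (ha : IsSymbol J W a) (hb : IsSymbol J W b) : IsSymbol J W (fun k => a k + b k) := by
  have key : ∀ {W a b : ℕ → ℝ}, (∃ C, 0 ≤ C ∧ ∀ k, |a k| ≤ C * W k) →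
      (∃ C, 0 ≤ C ∧ ∀ k, |b k| ≤ C * W k) → ∃ C, 0 ≤ C ∧ ∀ k, |a k + b k| ≤ C * W k := by
    rintro W a b ⟨C, hC, h⟩ ⟨D, hD, h'⟩
    refine ⟨C + D, by positivity, fun k => (abs_add_le _ _).trans ?_⟩
    rw [add_mul]
    exact add_le_add (h k) (h' k)
  induction J generalizing W a b with
  | zero => exact key ha hb
  | succ J ih =>
    refine ⟨key ha.1 hb.1, ?_⟩
    have : diffSeq (fun k => a k + b k) = fun k => diffSeq a k + diffSeq b k := by
      funext k; simp only [diffSeq]; ring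
    rw [this]
    exact ih ha.2 hb.2

/-- Discrete Leibniz rule: Δ(ab) = Δa·b + a·Δb + Δa·Δb. The last term gains (k+1)^{-2}, which is
better than needed. -/
lemma mul (hW : ∀ k, 0 ≤ W k) (hV : ∀ k, 0 ≤ V k) (ha : IsSymbol J W a) (hb : IsSymbol J V b) :
    IsSymbol J (fun k => W k * V k) (fun k => a k * b k) := by
  have key : ∀ {W V a b : ℕ → ℝ}, (∀ k, 0 ≤ W k) → (∃ C, 0 ≤ C ∧ ∀ k, |a k| ≤ C * W k) →
      (∃ C, 0 ≤ C ∧ ∀ k, |b k| ≤ C * V k) → ∃ C, 0 ≤ C ∧ ∀ k, |a k * b k| ≤ C * (W k * V k) := by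
    rintro W V a b hW ⟨C, hC, h⟩ ⟨D, hD, h'⟩
    refine ⟨C * D, by positivity, fun k => ?_⟩
    rw [abs_mul, mul_mul_mul_comm]
    exact mul_le_mul (h k) (h' k) (abs_nonneg _) (mul_nonneg hC (hW k))
  induction J generalizing W V a b with
  | zero => exact key hW ha hb
  | succ J ih =>
    refine ⟨key hW ha.1 hb.1, ?_⟩
    have hW' : ∀ k : ℕ, 0 ≤ W k / ((k : ℝ) + 1) := fun k => div_nonneg (hW k) (by positivity)
    have hV' : ∀ k : ℕ, 0 ≤ V k / ((k : ℝ) + 1) := fun k => div_nonneg (hV k) (by positivity)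
    have : diffSeq (fun k => a k * b k) =
        fun k => (diffSeq a k * b k + a k * diffSeq b k) + diffSeq a k * diffSeq b k := by
      funext k; simp only [diffSeq]; ring
    rw [this]
    refine ((ih hW' hV ha.2 hb.of_succ).mono zero_le_one fun k => ?_).add
      ((ih hW hV' ha.of_succ hb.2).mono zero_le_one fun k => ?_) |>.add
      ((ih hW' hV' ha.2 hb.2).mono zero_le_one fun k => ?_)
    · exact le_of_eq (by ring)
    · exact le_of_eq (by ring)
    · rw [one_mul, div_mul_div_comm]
      have := mul_nonneg (hW k) (hV k)
      gcongr
      nlinarith [(k.cast_nonneg : (0 : ℝ) ≤ k)]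

lemma neg (h : IsSymbol J W a) : IsSymbol J W (fun k => -a k) := by
  induction J generalizing W a with
  | zero => simpa [IsSymbol] using h
  | succ J ih =>
    refine ⟨by simpa using h.1, ?_⟩
    have : diffSeq (fun k => -a k) = fun k => -diffSeq a k := by
      funext k; simp only [diffSeq]; ring
    rw [this]
    exact ih h.2

lemma shift (hW : ∀ k, 0 ≤ W k) {C : ℝ} (hC : 0 ≤ C) (hWs : ∀ k, W (k + 1) ≤ C * W k)
    (h : IsSymbol J W a) : IsSymbol J W (fun k => a (k + 1)) := by
  have key : ∀ {W a : ℕ → ℝ}, (∀ k, W (k + 1) ≤ C * W k) → (∃ C, 0 ≤ C ∧ ∀ k, |a k| ≤ C * W k) →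
      ∃ C, 0 ≤ C ∧ ∀ k, |a (k + 1)| ≤ C * W k := by
    rintro W a hWs ⟨D, hD, h⟩
    refine ⟨D * C, by positivity, fun k => (h (k + 1)).trans ?_⟩
    rw [mul_assoc]
    exact mul_le_mul_of_nonneg_left (hWs k) hD
  induction J generalizing W a with
  | zero => exact key hWs h
  | succ J ih =>
    refine ⟨key hWs h.1, ih (fun k => div_nonneg (hW k) (by positivity)) (fun k => ?_) h.2⟩
    rw [← mul_div_assoc]
    have := mul_nonneg hC (hW k)
    refine div_le_div₀ this (hWs k) (by positivity) ?_
    push_cast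
    linarith

/-- Quotient rule: Δ(1/a)(k) = -Δa(k) / (a(k) a(k+1)). The shifted factor is why W must not drop too
fast from k to k+1. The induction is on the order J, since the right side involves 1/a to lower
order only. -/
lemma inv {c C : ℝ} (hc : 0 < c) (hC : 0 ≤ C) (hW : ∀ k, 0 < W k)
    (hWs : ∀ k, W k ≤ C * W (k + 1)) (ha : ∀ k, c * W k ≤ a k) (h : IsSymbol J W a) :
    IsSymbol J (fun k => (W k)⁻¹) (fun k => (a k)⁻¹) := by
  have hpos : ∀ k, 0 < a k := fun k => (mul_pos hc (hW k)).trans_le (ha k)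
  have key : ∃ C, 0 ≤ C ∧ ∀ k, |(a k)⁻¹| ≤ C * (W k)⁻¹ := by
    refine ⟨c⁻¹, by positivity, fun k => ?_⟩
    rw [abs_of_pos (inv_pos.2 (hpos k)), ← mul_inv]
    exact inv_anti₀ (mul_pos hc (hW k)) (ha k)
  have hWi : ∀ k, 0 ≤ (W k)⁻¹ := fun k => (inv_pos.2 (hW k)).le
  induction J with
  | zero => exact key
  | succ J ih =>
    refine ⟨key, ?_⟩
    have h1 := ih h.of_succ
    have h2 : IsSymbol J (fun k => (W k)⁻¹) (fun k => (a (k + 1))⁻¹) := by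
      refine h1.shift hWi hC fun k => ?_
      rw [inv_le_iff_one_le_mul₀ (hW _)]
      have := mul_le_mul_of_nonneg_left (hWs k) (hWi k)
      rw [inv_mul_cancel₀ (hW k).ne'] at this
      linarith
    have h3 := (mul (fun k => div_nonneg (hW k).le (by positivity)) (fun k => by
      have := hWi k; positivity) h.2 (mul hWi hWi h1 h2)).neg
    have : diffSeq (fun k => (a k)⁻¹) =
        fun k => -(diffSeq a k * ((a k)⁻¹ * (a (k + 1))⁻¹)) := by
      funext k
      have := (hpos k).ne'
      have := (hpos (k + 1)).ne'
      simp only [diffSeq]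
      field_simp
      ring
    rw [this]
    refine h3.mono zero_le_one fun k => le_of_eq ?_
    have := (hW k).ne'
    field_simp

lemma zero (hW : ∀ k, 0 ≤ W k) : IsSymbol J W (fun _ => 0) := by
  induction J generalizing W with
  | zero => exact ⟨0, le_rfl, by simp⟩
  | succ J ih =>
    refine ⟨⟨0, le_rfl, by simp⟩, ?_⟩
    have : diffSeq (fun _ => 0) = fun _ => 0 := by funext k; simp [diffSeq]
    rw [this]
    exact ih fun k => div_nonneg (hW k) (by positivity)

lemma const (c : ℝ) : IsSymbol J (fun _ => 1) (fun _ => c) := by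
  cases J with
  | zero => exact ⟨|c|, abs_nonneg c, by simp⟩
  | succ J =>
    refine ⟨⟨|c|, abs_nonneg c, by simp⟩, ?_⟩
    have : diffSeq (fun _ => c) = fun _ => 0 := by funext k; simp [diffSeq]
    rw [this]
    exact zero fun k => by positivity

lemma natCast_add (c : ℝ) : IsSymbol J (fun k => (k : ℝ) + 1) (fun k => (k : ℝ) + c) := by
  have key : ∃ C, 0 ≤ C ∧ ∀ k : ℕ, |(k : ℝ) + c| ≤ C * ((k : ℝ) + 1) := by
    refine ⟨1 + |c|, by positivity, fun k => (abs_add_le _ _).trans ?_⟩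
    rw [abs_of_nonneg (k.cast_nonneg : (0 : ℝ) ≤ k)]
    nlinarith [abs_nonneg c, (k.cast_nonneg : (0 : ℝ) ≤ k)]
  cases J with
  | zero => exact key
  | succ J =>
    refine ⟨key, ?_⟩
    have : diffSeq (fun k => (k : ℝ) + c) = fun _ => 1 := by
      funext k; simp only [diffSeq]; push_cast; ring
    rw [this]
    refine (const 1).mono zero_le_one fun k => ?_
    rw [one_mul, div_self (by positivity)]

lemma choose_add (m : ℕ) :
    IsSymbol J (fun k => ((k : ℝ) + 1) ^ m) (fun k => ((k + m).choose m : ℝ)) := by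
  induction m with
  | zero => simpa using const (J := J) 1
  | succ m ih =>
    have h := mul (fun k => by positivity) (fun k => by positivity) ih
      (mul (fun k => by positivity) (fun k => by positivity) (natCast_add (J := J) (m + 1))
        (const (J := J) ((m : ℝ) + 1)⁻¹))
    have e : (fun k : ℕ => ((k + (m + 1)).choose (m + 1) : ℝ)) =
        fun k : ℕ => ((k + m).choose m : ℝ) * (((k : ℝ) + (m + 1)) * ((m : ℝ) + 1)⁻¹) := by
      funext k
      have := Nat.add_one_mul_choose_eq (k + m) m
      have h' : ((k : ℝ) + m + 1) * ((k + m).choose m : ℝ) =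
          ((k + (m + 1)).choose (m + 1) : ℝ) * ((m : ℝ) + 1) := by
        exact_mod_cast this
      rw [← div_eq_mul_inv, ← mul_div_assoc, eq_div_iff (by positivity), ← h']
      ring
    rw [e]
    exact h.mono zero_le_one fun k => le_of_eq (by ring)

end IsSymbol

/-- Repeated summation by parts for the tail of a power series. -/
lemma norm_tail_le (J : ℕ) {W a : ℕ → ℝ} (hW : ∀ k, 0 ≤ W k) (ha : IsSymbol J W a) :
    ∃ C, 0 ≤ C ∧ ∀ l : ℂ, ‖l‖ ≤ 1 → l ≠ 1 → Summable (fun k => W k * ‖l‖ ^ k) →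
      ∀ K : ℕ, 1 ≤ ((K : ℝ) + 1) * ‖1 - l‖ →
      ‖∑' i : ℕ, (a (K + i) : ℂ) * l ^ (K + i)‖ ≤
        C * (‖1 - l‖⁻¹ * (W K * ‖l‖ ^ K) +
          ‖1 - l‖⁻¹ ^ J * ∑' i : ℕ, W (K + i) / (((K + i : ℕ) : ℝ) + 1) ^ J * ‖l‖ ^ (K + i)) := by
  induction J generalizing W a with
  | zero =>
    obtain ⟨C, hC, h⟩ := ha
    refine ⟨C, hC, fun l _ _ hs K _ => ?_⟩
    have hs' : Summable fun i => W (K + i) * ‖l‖ ^ (K + i) :=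
      hs.comp_injective (add_right_injective K)
    have h1 : ‖∑' i : ℕ, (a (K + i) : ℂ) * l ^ (K + i)‖ ≤
        ∑' i : ℕ, C * (W (K + i) * ‖l‖ ^ (K + i)) := by
      refine tsum_of_norm_bounded (hs'.mul_left C).hasSum fun i => ?_
      rw [norm_mul, norm_pow, Complex.norm_real, Real.norm_eq_abs, ← mul_assoc]
      exact mul_le_mul_of_nonneg_right (h _) (by positivity)
    rw [tsum_mul_left] at h1
    refine h1.trans ?_
    simp only [pow_zero, div_one, one_mul]
    have : 0 ≤ ‖1 - l‖⁻¹ * (W K * ‖l‖ ^ K) := by have := hW K; positivity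
    gcongr
    linarith
  | succ J ih =>
    obtain ⟨⟨C, hC, h⟩, hd⟩ := ha
    obtain ⟨D, hD, h'⟩ := ih (fun k => div_nonneg (hW k) (by positivity)) hd
    refine ⟨C + D, by positivity, fun l hl hl1 hs K hK => ?_⟩
    have hpos : 0 < ‖1 - l‖ := norm_pos_iff.2 (sub_ne_zero.2 (Ne.symm hl1))
    have hsd : Summable (fun k => W k / ((k : ℝ) + 1) * ‖l‖ ^ k) := by
      refine hs.of_nonneg_of_le (fun k => ?_) fun k => ?_
      · have := hW k; positivity
      · gcongr
        exact div_le_self (hW k) (by linarith [(k.cast_nonneg : (0 : ℝ) ≤ k)])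
    have hsa : Summable fun k => (a k : ℂ) * l ^ k := by
      refine Summable.of_norm_bounded (hs.mul_left C) fun k => ?_
      rw [norm_mul, norm_pow, Complex.norm_real, Real.norm_eq_abs, ← mul_assoc]
      exact mul_le_mul_of_nonneg_right (h _) (by positivity)
    have hsK : Summable fun i => (a (K + i) : ℂ) * l ^ (K + i) :=
      hsa.comp_injective (add_right_injective K)
    have hsK1 : Summable fun i => (a (K + (i + 1)) : ℂ) * l ^ (K + (i + 1)) :=
      (summable_nat_add_iff 1).2 hsK
    -- Summation by parts: multiplication by 1 - l trades the coefficients for their differences, at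
    -- the price of one boundary term at K.
    have hid : (1 - l) * ∑' i : ℕ, (a (K + i) : ℂ) * l ^ (K + i) =
        a K * l ^ K + l * ∑' i : ℕ, (diffSeq a (K + i) : ℂ) * l ^ (K + i) := by
      have e1 : ∑' i : ℕ, (a (K + i) : ℂ) * l ^ (K + i) =
          a K * l ^ K + ∑' i : ℕ, (a (K + (i + 1)) : ℂ) * l ^ (K + (i + 1)) := by
        rw [hsK.tsum_eq_zero_add]; simp
      have e2 : l * ∑' i : ℕ, (diffSeq a (K + i) : ℂ) * l ^ (K + i) =
          ∑' i : ℕ, (a (K + (i + 1)) : ℂ) * l ^ (K + (i + 1)) -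
            l * ∑' i : ℕ, (a (K + i) : ℂ) * l ^ (K + i) := by
        rw [← tsum_mul_left, ← tsum_mul_left, ← hsK1.tsum_sub (hsK.mul_left l)]
        refine tsum_congr fun i => ?_
        simp only [diffSeq]
        push_cast
        ring_nf
      rw [e2, sub_mul, one_mul]
      nth_rewrite 1 [e1]
      ring
    have h2 : ‖∑' i : ℕ, (a (K + i) : ℂ) * l ^ (K + i)‖ ≤ ‖1 - l‖⁻¹ *
        (C * (W K * ‖l‖ ^ K) + ‖∑' i : ℕ, (diffSeq a (K + i) : ℂ) * l ^ (K + i)‖) := by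
      rw [inv_mul_eq_div, le_div_iff₀' hpos, ← norm_mul, hid]
      refine (norm_add_le _ _).trans (add_le_add ?_ ?_)
      · rw [norm_mul, norm_pow, Complex.norm_real, Real.norm_eq_abs, ← mul_assoc]
        exact mul_le_mul_of_nonneg_right (h _) (by positivity)
      · rw [norm_mul]
        exact mul_le_of_le_one_left (norm_nonneg _) hl
    refine h2.trans ((mul_le_mul_of_nonneg_left
      (add_le_add_right (h' l hl hl1 hsd K hK) _) (by positivity)).trans ?_)
    have e3 : ∀ i : ℕ, W (K + i) / (((K + i : ℕ) : ℝ) + 1) / (((K + i : ℕ) : ℝ) + 1) ^ J *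
        ‖l‖ ^ (K + i) = W (K + i) / (((K + i : ℕ) : ℝ) + 1) ^ (J + 1) * ‖l‖ ^ (K + i) := by
      intro i
      rw [div_div, ← pow_succ']
    simp only [e3]
    set S := ∑' i : ℕ, W (K + i) / (((K + i : ℕ) : ℝ) + 1) ^ (J + 1) * ‖l‖ ^ (K + i) with hS
    have hS0 : 0 ≤ S := tsum_nonneg fun i => by have := hW (K + i); positivity
    set x := ‖1 - l‖⁻¹ with hx
    have hx0 : 0 < x := inv_pos.2 hpos
    -- Each further summation by parts creates a boundary term with an extra factor x/(K+1). The
    -- hypothesis on K makes this factor at most 1, so all boundary terms merge into the first.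
    have hxK : x / ((K : ℝ) + 1) ≤ 1 := by
      rw [div_le_one (by positivity), hx, inv_le_iff_one_le_mul₀ hpos]
      exact hK
    have hWK : 0 ≤ W K * ‖l‖ ^ K := by have := hW K; positivity
    have e4 : x * (W K / ((K : ℝ) + 1) * ‖l‖ ^ K) = x / ((K : ℝ) + 1) * (W K * ‖l‖ ^ K) := by ring
    rw [e4]
    have h5 : x / ((K : ℝ) + 1) * (W K * ‖l‖ ^ K) ≤ W K * ‖l‖ ^ K :=
      mul_le_of_le_one_left hWK hxK
    have h6 : 0 ≤ C * (x * (x ^ J * S)) := by positivity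
    calc x * (C * (W K * ‖l‖ ^ K) + D * (x / ((K : ℝ) + 1) * (W K * ‖l‖ ^ K) + x ^ J * S))
        ≤ x * (C * (W K * ‖l‖ ^ K) + D * (W K * ‖l‖ ^ K + x ^ J * S)) := by gcongr
      _ ≤ (C + D) * (x * (W K * ‖l‖ ^ K) + x ^ (J + 1) * S) := by
          rw [pow_succ]; nlinarith

/-- Pointwise bound for a power series whose coefficients form a symbol. -/
lemma norm_tsum_le_of_isSymbol (J : ℕ) {W a : ℕ → ℝ} (hW : ∀ k, 0 ≤ W k) (ha : IsSymbol J W a)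
    {A : ℝ} (hA : 0 ≤ A) (hWA : ∀ k K : ℕ, k ≤ K → K ≤ 2 * k → W K ≤ A * W k) :
    ∃ C, 0 ≤ C ∧ ∀ l : ℂ, ‖l‖ < 1 → Summable (fun k => W k * ‖l‖ ^ k) →
      ‖∑' k : ℕ, (a k : ℂ) * l ^ k‖ ≤
        C * ∑' k : ℕ, W k * ‖l‖ ^ k / (1 + ((k : ℝ) + 1) * ‖1 - l‖) ^ J := by
  obtain ⟨C₁, hC₁, h₁⟩ := ha.exists_bound
  obtain ⟨C₂, hC₂, h₂⟩ := norm_tail_le J hW ha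
  refine ⟨C₁ * 4 ^ J + C₂ * (2 * A * 4 ^ J + 2 ^ J), by positivity, fun l hl hs => ?_⟩
  have hl1 : l ≠ 1 := by rintro rfl; simp at hl
  set D := ‖1 - l‖ with hD
  have hpos : 0 < D := norm_pos_iff.2 (sub_ne_zero.2 (Ne.symm hl1))
  have hD2 : D ≤ 2 := (norm_sub_le _ _).trans (by rw [norm_one]; linarith)
  set G : ℕ → ℝ := fun k => W k * ‖l‖ ^ k / (1 + ((k : ℝ) + 1) * D) ^ J with hG
  have hG0 : ∀ k, 0 ≤ G k := fun k => by have := hW k; simp only [hG]; positivity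
  have hGs : Summable G := by
    refine hs.of_nonneg_of_le hG0 fun k => ?_
    refine div_le_self (by have := hW k; positivity) (one_le_pow₀ ?_)
    have : 0 ≤ ((k : ℝ) + 1) * D := by positivity
    linarith
  -- The series is cut where (k+1)|1-l| passes 1. Below the cut the denominator in `G` is bounded
  -- (by 4^J, as D ≤ 2) and no cancellation is needed; beyond it summation by parts pays off.
  set K := ⌊D⁻¹⌋₊ with hK
  have hK1 : (K : ℝ) * D ≤ 1 := by
    have := Nat.floor_le (inv_pos.2 hpos).le
    have := mul_le_mul_of_nonneg_right this hpos.le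
    rwa [inv_mul_cancel₀ hpos.ne'] at this
  have hK2 : 1 ≤ ((K : ℝ) + 1) * D := by
    have := (Nat.lt_floor_add_one D⁻¹).le
    have := mul_le_mul_of_nonneg_right this hpos.le
    rwa [inv_mul_cancel₀ hpos.ne'] at this
  have hlow : ∀ k ≤ K, W k * ‖l‖ ^ k ≤ 4 ^ J * G k := by
    intro k hk
    have hkK : (k : ℝ) ≤ K := by exact_mod_cast hk
    have hk4 : 1 + ((k : ℝ) + 1) * D ≤ 4 := by nlinarith
    have h0 : 0 < 1 + ((k : ℝ) + 1) * D := by positivity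
    simp only [hG]
    rw [← mul_div_assoc, le_div_iff₀ (pow_pos h0 J), mul_comm]
    have := hW k
    gcongr
  have hhigh : ∀ k, K ≤ k → D⁻¹ ^ J * (W k / ((k : ℝ) + 1) ^ J * ‖l‖ ^ k) ≤ 2 ^ J * G k := by
    intro k hk
    have hkK : (K : ℝ) ≤ k := by exact_mod_cast hk
    have hy : 1 ≤ ((k : ℝ) + 1) * D := by nlinarith
    have h0 : 0 < 1 + ((k : ℝ) + 1) * D := by positivity
    have e : D⁻¹ ^ J * (W k / ((k : ℝ) + 1) ^ J * ‖l‖ ^ k) =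
        W k * ‖l‖ ^ k / (((k : ℝ) + 1) * D) ^ J := by
      rw [mul_pow, inv_pow]; field_simp
    rw [e]
    simp only [hG]
    have := hW k
    rw [← mul_div_assoc, div_le_div_iff₀ (by positivity) (by positivity), mul_comm (2 ^ J),
      mul_assoc _ ((2 : ℝ) ^ J), ← mul_pow]
    gcongr
    linarith
  have hsa : Summable fun k => (a k : ℂ) * l ^ k := by
    refine Summable.of_norm_bounded (hs.mul_left C₁) fun k => ?_
    rw [norm_mul, norm_pow, Complex.norm_real, Real.norm_eq_abs, ← mul_assoc]
    exact mul_le_mul_of_nonneg_right (h₁ _) (by positivity)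
  have hsplit := hsa.sum_add_tsum_nat_add K
  have hS0 : 0 ≤ ∑' k, G k := tsum_nonneg hG0
  have hhead : ‖∑ k ∈ Finset.range K, (a k : ℂ) * l ^ k‖ ≤ C₁ * 4 ^ J * ∑' k, G k := by
    refine (norm_sum_le _ _).trans ?_
    refine le_trans ?_ (mul_le_mul_of_nonneg_left
      (hGs.sum_le_tsum (Finset.range K) fun k _ => hG0 k) (by positivity))
    rw [Finset.mul_sum]
    refine Finset.sum_le_sum fun k hk => ?_
    rw [norm_mul, norm_pow, Complex.norm_real, Real.norm_eq_abs]
    refine (mul_le_mul_of_nonneg_right (h₁ k) (by positivity)).trans ?_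
    rw [mul_assoc, mul_assoc]
    exact mul_le_mul_of_nonneg_left (hlow k (Finset.mem_range.1 hk).le) hC₁
  -- The boundary term is spread over the indices between K/2 and K: there are at least (K+1)/2 of
  -- them, and on each the weight is at least W K / A while the power of |l| only grows.
  have hmid : D⁻¹ * (W K * ‖l‖ ^ K) ≤ 2 * A * 4 ^ J * ∑' k, G k := by
    have hWK : 0 ≤ W K * ‖l‖ ^ K := by have := hW K; positivity
    have hx : D⁻¹ ≤ (K : ℝ) + 1 := (Nat.lt_floor_add_one D⁻¹).le
    have hcard : ((K : ℝ) + 1) ≤ 2 * ((Finset.Icc (K - K / 2) K).card : ℝ) := by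
      rw [Nat.card_Icc]
      have : K + 1 ≤ 2 * (K + 1 - (K - K / 2)) := by omega
      exact_mod_cast this
    have hsum : ((Finset.Icc (K - K / 2) K).card : ℝ) * (W K * ‖l‖ ^ K) ≤
        A * 4 ^ J * ∑' k, G k := by
      rw [← nsmul_eq_mul, ← Finset.sum_const]
      refine le_trans ?_ (mul_le_mul_of_nonneg_left
        (hGs.sum_le_tsum (Finset.Icc (K - K / 2) K) fun k _ => hG0 k) (by positivity))
      rw [Finset.mul_sum]
      refine Finset.sum_le_sum fun k hk => ?_
      obtain ⟨hk1, hk2⟩ := Finset.mem_Icc.1 hk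
      calc W K * ‖l‖ ^ K ≤ A * W k * ‖l‖ ^ k := by
            refine mul_le_mul (hWA k K hk2 (by omega)) ?_ (by positivity)
              (mul_nonneg hA (hW k))
            exact pow_le_pow_of_le_one (norm_nonneg _) hl.le hk2
        _ ≤ A * 4 ^ J * G k := by
            rw [mul_assoc, mul_assoc]
            exact mul_le_mul_of_nonneg_left (hlow k hk2) hA
    calc D⁻¹ * (W K * ‖l‖ ^ K) ≤ ((K : ℝ) + 1) * (W K * ‖l‖ ^ K) := by gcongr
      _ ≤ 2 * ((Finset.Icc (K - K / 2) K).card : ℝ) * (W K * ‖l‖ ^ K) := by gcongr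
      _ ≤ _ := by linarith
  have htail : D⁻¹ ^ J * ∑' i : ℕ, W (K + i) / (((K + i : ℕ) : ℝ) + 1) ^ J * ‖l‖ ^ (K + i) ≤
      2 ^ J * ∑' k, G k := by
    have hGK : Summable fun i => G (K + i) := hGs.comp_injective (add_right_injective K)
    calc D⁻¹ ^ J * ∑' i : ℕ, W (K + i) / (((K + i : ℕ) : ℝ) + 1) ^ J * ‖l‖ ^ (K + i)
        = ∑' i : ℕ, D⁻¹ ^ J * (W (K + i) / (((K + i : ℕ) : ℝ) + 1) ^ J * ‖l‖ ^ (K + i)) :=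
          tsum_mul_left.symm
      _ ≤ ∑' i : ℕ, 2 ^ J * G (K + i) := by
          have hle := fun i : ℕ => hhigh (K + i) (by omega)
          refine Summable.tsum_le_tsum hle ?_ (hGK.mul_left _)
          exact (hGK.mul_left _).of_nonneg_of_le
            (fun i => by have := hW (K + i); positivity) hle
      _ = 2 ^ J * ∑' i : ℕ, G (K + i) := tsum_mul_left
      _ ≤ 2 ^ J * ∑' k, G k := by
          refine mul_le_mul_of_nonneg_left ?_ (by positivity)
          exact hGK.tsum_le_tsum_of_inj (K + ·) (add_right_injective K)
            (fun c _ => hG0 c) (fun i => le_rfl) hGs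
  have h3 := h₂ l hl.le hl1 hs K hK2
  rw [← hsplit]
  refine (norm_add_le _ _).trans ?_
  have e : ∑' i : ℕ, (a (i + K) : ℂ) * l ^ (i + K) = ∑' i : ℕ, (a (K + i) : ℂ) * l ^ (K + i) :=
    tsum_congr fun i => by rw [add_comm]
  rw [e]
  have h4 := h3.trans (mul_le_mul_of_nonneg_left (add_le_add hmid htail) hC₂)
  calc _ ≤ C₁ * 4 ^ J * ∑' k, G k + _ := add_le_add hhead h4
    _ = _ := by ring

end

/-! ### Fourier coefficients on the circle and homogeneous holomorphic functions -/

section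

/-- The complex space `ℂ^(m+1)`. -/
abbrev Cn (m : ℕ) := EuclideanSpace ℂ (Fin (m + 1))

/-- The point `e^{iθ}` of the unit circle. -/
noncomputable def ex (θ : ℝ) : ℂ := Complex.exp (θ * Complex.I)

@[simp] lemma norm_ex (θ : ℝ) : ‖ex θ‖ = 1 := Complex.norm_exp_ofReal_mul_I θ

lemma ex_ne_zero (θ : ℝ) : ex θ ≠ 0 := Complex.exp_ne_zero _

@[fun_prop] lemma continuous_ex : Continuous ex := by unfold ex; fun_prop

@[fun_prop] lemma continuous_ex_inv : Continuous fun θ => (ex θ)⁻¹ :=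
  continuous_ex.inv₀ ex_ne_zero

lemma conj_ex (θ : ℝ) : conj (ex θ) = (ex θ)⁻¹ := by
  rw [Complex.inv_def, Complex.normSq_eq_norm_sq, norm_ex]; simp

lemma integral_ex_pow_mul_inv_pow (j k : ℕ) :
    ∫ θ in (0 : ℝ)..2 * Real.pi, ex θ ^ j * (ex θ)⁻¹ ^ k =
      if j = k then ((2 * Real.pi : ℝ) : ℂ) else 0 := by
  have e : ∀ θ : ℝ, ex θ ^ j * (ex θ)⁻¹ ^ k = Complex.exp (((j : ℂ) - k) * Complex.I * θ) := by
    intro θ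
    rw [ex, ← Complex.exp_neg, ← Complex.exp_nat_mul, ← Complex.exp_nat_mul, ← Complex.exp_add]
    congr 1
    ring
  simp only [e]
  split_ifs with hjk
  · subst hjk
    simp
  · have hc : ((j : ℂ) - k) * Complex.I ≠ 0 :=
      mul_ne_zero (sub_ne_zero.2 (by exact_mod_cast hjk)) Complex.I_ne_zero
    rw [integral_exp_mul_complex hc]
    have : ((j : ℂ) - k) * Complex.I * ((2 * Real.pi : ℝ) : ℂ) =
        (((j : ℤ) - (k : ℤ) : ℤ) : ℂ) * (2 * Real.pi * Complex.I) := by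
      push_cast; ring
    rw [this, Complex.exp_int_mul_two_pi_mul_I]
    simp

lemma integral_tsum_orthogonal {a : ℕ → ℂ} (ha : Summable a) {p : ℕ → ℝ → ℂ}
    (hp : ∀ j, Continuous (p j)) (hn : ∀ j θ, ‖p j θ‖ = 1) (k : ℕ)
    (ho : ∀ j, ∫ θ in (0 : ℝ)..2 * Real.pi, p j θ =
      if j = k then ((2 * Real.pi : ℝ) : ℂ) else 0) :
    ∫ θ in (0 : ℝ)..2 * Real.pi, ∑' j, a j * p j θ = ((2 * Real.pi : ℝ) : ℂ) * a k := by
  have hb : ∀ j θ, ‖a j * p j θ‖ ≤ ‖a j‖ := fun j θ => by rw [norm_mul, hn, mul_one]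
  have h := intervalIntegral.hasSum_integral_of_dominated_convergence
    (a := 0) (b := 2 * Real.pi) (μ := volume) (F := fun j θ => a j * p j θ)
    (f := fun θ => ∑' j, a j * p j θ) (fun j _ => ‖a j‖)
    (fun j => (continuous_const.mul (hp j)).aestronglyMeasurable)
    (fun j => Filter.Eventually.of_forall fun θ _ => hb j θ)
    (Filter.Eventually.of_forall fun θ _ => ha.norm)
    (by simp)
    (Filter.Eventually.of_forall fun θ _ =>
      (Summable.of_norm_bounded ha.norm fun j => hb j θ).hasSum)
  refine h.unique ?_
  have e : ∀ j, ∫ θ in (0 : ℝ)..2 * Real.pi, a j * p j θ =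
      if j = k then ((2 * Real.pi : ℝ) : ℂ) * a k else 0 := by
    intro j
    rw [intervalIntegral.integral_const_mul, ho j]
    split_ifs with hjk
    · rw [hjk, mul_comm]
    · rw [mul_zero]
  simp only [e]
  exact hasSum_ite_eq k _

/-- Extraction of a coefficient of an absolutely convergent power series on the circle. -/
lemma integral_tsum_mul_inv_pow {a : ℕ → ℂ} (ha : Summable a) (k : ℕ) :
    ∫ θ in (0 : ℝ)..2 * Real.pi, (∑' j, a j * ex θ ^ j) * (ex θ)⁻¹ ^ k =
      ((2 * Real.pi : ℝ) : ℂ) * a k := by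
  rw [← integral_tsum_orthogonal ha (p := fun j θ => ex θ ^ j * (ex θ)⁻¹ ^ k)
    (fun j => by fun_prop) (fun j θ => by simp) k fun j => integral_ex_pow_mul_inv_pow j k]
  refine intervalIntegral.integral_congr fun θ _ => ?_
  simp only [← tsum_mul_right, mul_assoc]

lemma integral_tsum_inv_mul_pow {a : ℕ → ℂ} (ha : Summable a) (k : ℕ) :
    ∫ θ in (0 : ℝ)..2 * Real.pi, ex θ ^ k * (∑' j, a j * (ex θ)⁻¹ ^ j) =
      ((2 * Real.pi : ℝ) : ℂ) * a k := by
  rw [← integral_tsum_orthogonal ha (p := fun j θ => ex θ ^ k * (ex θ)⁻¹ ^ j)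
    (fun j => by fun_prop) (fun j θ => by simp) k fun j => ?_]
  · refine intervalIntegral.integral_congr fun θ _ => ?_
    simp only [← tsum_mul_left]
    exact tsum_congr fun j => by ring
  · rw [integral_ex_pow_mul_inv_pow]
    simp only [eq_comm]

variable {m : ℕ}

/-- Holomorphic homogeneous functions of degree `k` on `ℂ^(m+1)`; holomorphy enters through a mean
value property. -/
structure IsHolHomog (k : ℕ) (h : Cn m → ℂ) : Prop where
  continuous : Continuous h
  map_smul : ∀ (c : ℂ) (w : Cn m), h (c • w) = c ^ k * h w
  meanValue : ∀ z u : Cn m, ∫ θ in (0 : ℝ)..2 * Real.pi,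
    h (z + ex θ • u) * Complex.exp (-(ex θ * inner ℂ z u)) = ((2 * Real.pi : ℝ) : ℂ) * h z

lemma two_pi_ne_zero' : ((2 * Real.pi : ℝ) : ℂ) ≠ 0 := by
  exact_mod_cast Real.two_pi_pos.ne'

lemma integral_ex_eq_of_differentiableOn {f : ℂ → ℂ} (hf : DifferentiableOn ℂ f (closedBall 0 1)) :
    ∫ θ in (0 : ℝ)..2 * Real.pi, f (ex θ) = ((2 * Real.pi : ℝ) : ℂ) * f 0 := by
  have h : DiffContOnCl ℂ f (ball 0 |(1 : ℝ)|) := by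
    refine DifferentiableOn.diffContOnCl (hf.mono ?_)
    rw [abs_one]
    exact closure_ball_subset_closedBall
  have h1 := h.circleAverage
  rw [Real.circleAverage, inv_smul_eq_iff₀ Real.two_pi_pos.ne'] at h1
  simp only [circleMap, zero_add, Complex.ofReal_one, one_mul] at h1
  rw [Complex.real_smul] at h1
  exact h1

lemma isHolHomog_inner_pow (a : Cn m) (k : ℕ) : IsHolHomog k (fun w => (inner ℂ a w : ℂ) ^ k) where
  continuous := by fun_prop
  map_smul c w := by rw [inner_smul_right, mul_pow]
  meanValue z u := by
    have := integral_ex_eq_of_differentiableOn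
      (f := fun l => (inner ℂ a z + l * inner ℂ a u) ^ k * Complex.exp (-(l * inner ℂ z u)))
      (by fun_prop)
    simpa [inner_add_right, inner_smul_right] using this

lemma IsHolHomog.const_mul {k : ℕ} {h : Cn m → ℂ} (hh : IsHolHomog k h) (c : ℂ) :
    IsHolHomog k (fun w => c * h w) where
  continuous := continuous_const.mul hh.continuous
  map_smul d w := by rw [hh.map_smul]; ring
  meanValue z u := by
    simp only [mul_assoc, intervalIntegral.integral_const_mul, hh.meanValue]
    ring

lemma IsHolHomog.exists_bound {k : ℕ} {h : Cn m → ℂ} (hh : IsHolHomog k h) :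
    ∃ C, 0 ≤ C ∧ ∀ w, ‖h w‖ ≤ C * ‖w‖ ^ k := by
  obtain ⟨C, hC⟩ := (isCompact_closedBall (0 : Cn m) 1).exists_bound_of_continuousOn
    hh.continuous.continuousOn
  have hC0 : 0 ≤ C := (norm_nonneg _).trans (hC 0 (by simp))
  refine ⟨C, hC0, fun w => ?_⟩
  rcases eq_or_ne w 0 with rfl | hw
  · have := hh.map_smul 0 0
    rcases eq_or_ne k 0 with rfl | hk
    · simpa using hC 0 (by simp)
    · rw [smul_zero, zero_pow hk, zero_mul] at this
      rw [this]; simp [hk]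
  · have hw' : ‖w‖ ≠ 0 := norm_ne_zero_iff.2 hw
    have e : w = (‖w‖ : ℂ) • ((‖w‖ : ℂ)⁻¹ • w) := by
      rw [smul_inv_smul₀ (by exact_mod_cast hw')]
    rw [e, hh.map_smul, ← e, norm_mul, norm_pow, Complex.norm_real, norm_norm, mul_comm]
    refine mul_le_mul_of_nonneg_right (hC _ ?_) (by positivity)
    rw [mem_closedBall_zero_iff, norm_smul, norm_inv, Complex.norm_real, norm_norm,
      inv_mul_cancel₀ hw']

/-- The homogeneous component of degree `k` of a function holomorphic near the origin. -/
noncomputable def homComp (g : Cn m → ℂ) (k : ℕ) (w : Cn m) : ℂ :=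
  (k.factorial : ℂ)⁻¹ * iteratedDeriv k (fun l : ℂ => g (l • w)) 0

/-! ### Homogeneous components of a holomorphic function on the ball -/

section homComp

variable {g : Cn m → ℂ}

lemma differentiableOn_slice (hg : DifferentiableOn ℂ g (unitBall (m + 1))) (w : Cn m) {R : ℝ}
    (hR : R * ‖w‖ ≤ 1) : DifferentiableOn ℂ (fun l : ℂ => g (l • w)) (ball 0 R) := by
  refine hg.comp (by fun_prop) fun l hl => ?_
  rw [mem_ball_zero_iff] at hl ⊢
  rw [norm_smul]
  rcases eq_or_ne w 0 with rfl | hw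
  · simp
  · exact (mul_lt_mul_of_pos_right hl (norm_pos_iff.2 hw)).trans_le hR

lemma exists_radius (w : Cn m) {l : ℂ} (hl : ‖l‖ * ‖w‖ < 1) : ∃ R, ‖l‖ < R ∧ R * ‖w‖ ≤ 1 := by
  rcases eq_or_ne w 0 with rfl | hw
  · exact ⟨‖l‖ + 1, by linarith, by simp⟩
  · have := norm_pos_iff.2 hw
    exact ⟨1 / ‖w‖, (lt_div_iff₀ this).2 hl, by rw [one_div, inv_mul_cancel₀ this.ne']⟩

lemma hasSum_homComp (hg : DifferentiableOn ℂ g (unitBall (m + 1))) (w : Cn m) {l : ℂ}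
    (hl : ‖l‖ * ‖w‖ < 1) : HasSum (fun k => homComp g k w * l ^ k) (g (l • w)) := by
  obtain ⟨R, hR, hRw⟩ := exists_radius w hl
  have := Complex.hasSum_taylorSeries_on_ball (differentiableOn_slice hg w hRw)
    (z := l) (by simpa using hR)
  have e : (fun k => homComp g k w * l ^ k) = fun k => (k.factorial : ℂ)⁻¹ •
      (l - 0) ^ k • iteratedDeriv k (fun l : ℂ => g (l • w)) 0 := by
    funext k
    simp only [homComp, sub_zero, smul_eq_mul]
    ring
  rw [e]
  exact this

lemma hasSum_homComp_one (hg : DifferentiableOn ℂ g (unitBall (m + 1))) {w : Cn m}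
    (hw : w ∈ unitBall (m + 1)) : HasSum (fun k => homComp g k w) (g w) := by
  have := hasSum_homComp hg w (l := 1) (by simpa using hw)
  simpa using this

/-- Cauchy's formula on a circle of the slice through w. The radius r may be complex, so that a
scalar multiple of w can be absorbed into it. -/
lemma integral_slice (hg : DifferentiableOn ℂ g (unitBall (m + 1))) (w : Cn m) {r : ℂ}
    (hr : ‖r‖ * ‖w‖ < 1) (k : ℕ) :
    ∫ θ in (0 : ℝ)..2 * Real.pi, g ((r * ex θ) • w) * (ex θ)⁻¹ ^ k =
      ((2 * Real.pi : ℝ) : ℂ) * (homComp g k w * r ^ k) := by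
  rw [← integral_tsum_mul_inv_pow (hasSum_homComp hg w hr).summable]
  refine intervalIntegral.integral_congr fun θ _ => ?_
  have := (hasSum_homComp hg w (l := r * ex θ) (by simpa using hr)).tsum_eq
  simp only [← this, mul_pow, mul_assoc]

lemma homComp_smul (hg : DifferentiableOn ℂ g (unitBall (m + 1))) (k : ℕ) (c : ℂ) (w : Cn m) :
    homComp g k (c • w) = c ^ k * homComp g k w := by
  have hpos : 0 < 1 + ‖c‖ * ‖w‖ := by positivity
  set r : ℂ := ((1 + ‖c‖ * ‖w‖ : ℝ) : ℂ)⁻¹ with hr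
  have hr0 : r ≠ 0 := inv_ne_zero (by exact_mod_cast hpos.ne')
  have hrn : ‖r‖ * (‖c‖ * ‖w‖) < 1 := by
    rw [hr, norm_inv, Complex.norm_real, Real.norm_of_nonneg hpos.le, inv_mul_lt_one₀ hpos]
    linarith
  have h1 := integral_slice hg (c • w) (r := r) (by rwa [norm_smul]) k
  have h2 := integral_slice hg w (r := r * c) (by rwa [norm_mul, mul_assoc]) k
  have e : ∀ θ : ℝ, (r * ex θ) • c • w = (r * c * ex θ) • w := fun θ => by
    rw [smul_smul]; congr 1; ring
  simp only [e] at h1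
  rw [h1] at h2
  have h3 := mul_left_cancel₀ two_pi_ne_zero' h2
  rw [mul_pow, mul_left_comm, mul_comm (homComp g k (c • w))] at h3
  have h4 := mul_left_cancel₀ (pow_ne_zero k hr0) h3
  rw [h4, mul_comm]

/-- Cauchy's formula on the circle of radius 1/(1+|w|), which depends continuously on w and keeps
the contour inside the ball, represents the component as a continuous parametric integral. -/
lemma continuous_homComp (hg : DifferentiableOn ℂ g (unitBall (m + 1))) (k : ℕ) :
    Continuous (homComp g k) := by
  have key : ∀ w : Cn m, homComp g k w = ((1 + ‖w‖ : ℝ) : ℂ) ^ k * ((2 * Real.pi : ℝ) : ℂ)⁻¹ *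
      ∫ θ in (0 : ℝ)..2 * Real.pi, g ((((1 + ‖w‖)⁻¹ : ℝ) * ex θ) • w) * (ex θ)⁻¹ ^ k := by
    intro w
    have hpos : 0 < 1 + ‖w‖ := by positivity
    rw [integral_slice hg w (by
      rw [Complex.norm_real, norm_inv, Real.norm_of_nonneg hpos.le, inv_mul_lt_one₀ hpos]
      linarith)]
    have h2 : ((1 + ‖w‖ : ℝ) : ℂ) ^ k * (((1 + ‖w‖)⁻¹ : ℝ) : ℂ) ^ k = 1 := by
      rw [← mul_pow, ← Complex.ofReal_mul, mul_inv_cancel₀ hpos.ne']; simp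
    rw [mul_assoc, inv_mul_cancel_left₀ two_pi_ne_zero', mul_left_comm, h2, mul_one]
  rw [funext key]
  have hc : Continuous (Function.uncurry fun (w : Cn m) (θ : ℝ) =>
      g ((((1 + ‖w‖)⁻¹ : ℝ) * ex θ) • w) * (ex θ)⁻¹ ^ k) := by
    simp only [Function.uncurry_def]
    refine Continuous.mul ?_ ((continuous_ex_inv.comp continuous_snd).pow k)
    refine hg.continuousOn.comp_continuous ?_ fun p => ?_
    · have : Continuous fun p : Cn m × ℝ => (1 + ‖p.1‖)⁻¹ :=
        Continuous.inv₀ (by fun_prop) fun p => by positivity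
      fun_prop
    · have hpos : 0 < 1 + ‖p.1‖ := by positivity
      rw [mem_ball_zero_iff, norm_smul, norm_mul, norm_ex, Complex.norm_real, norm_inv,
        Real.norm_of_nonneg hpos.le, mul_one, inv_mul_lt_one₀ hpos]
      linarith
  refine Continuous.mul (by fun_prop) ?_
  exact intervalIntegral.continuous_parametric_intervalIntegral_of_continuous' hc _ _

/-- A component is an average over φ of rotated copies of g, so by Fubini it inherits the mean value
property in θ from g. The exponential factor in that property is holomorphic in the variable and
equals 1 at 0; it is the one produced by translating a Gaussian. With this form of the property, the
components need not be shown to be polynomials. -/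
lemma isHolHomog_homComp (hg : DifferentiableOn ℂ g (unitBall (m + 1))) (k : ℕ) :
    IsHolHomog k (homComp g k) where
  continuous := continuous_homComp hg k
  map_smul := homComp_smul hg k
  meanValue z u := by
    have hpos : 0 < 1 + ‖z‖ + ‖u‖ := by positivity
    -- The scaling brings every point z + l u with |l| ≤ 1 into the ball; by homogeneity it cancels
    -- at the end.
    set s : ℂ := ((1 + ‖z‖ + ‖u‖ : ℝ) : ℂ)⁻¹ with hs
    have hs0 : s ≠ 0 := inv_ne_zero (by exact_mod_cast hpos.ne')
    have hsn : ∀ l : ℂ, ‖l‖ ≤ 1 → ‖s‖ * ‖z + l • u‖ < 1 := by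
      intro l hl
      rw [hs, norm_inv, Complex.norm_real, Real.norm_of_nonneg hpos.le, inv_mul_lt_one₀ hpos]
      have h1 := norm_add_le z (l • u)
      rw [norm_smul] at h1
      nlinarith [norm_nonneg u]
    have hmem : ∀ (φ : ℝ) (l : ℂ), ‖l‖ ≤ 1 →
        (s * ex φ) • (z + l • u) ∈ unitBall (m + 1) := by
      intro φ l hl
      rw [mem_ball_zero_iff, norm_smul, norm_mul, norm_ex, mul_one]
      exact hsn l hl
    set F : ℝ → ℝ → ℂ := fun θ φ => g ((s * ex φ) • (z + ex θ • u)) * (ex φ)⁻¹ ^ k *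
      Complex.exp (-(ex θ * inner ℂ z u)) with hF
    have hFc : Continuous (Function.uncurry F) := by
      simp only [hF, Function.uncurry_def]
      refine Continuous.mul (Continuous.mul ?_ ((continuous_ex_inv.comp continuous_snd).pow k))
        (by fun_prop)
      exact hg.continuousOn.comp_continuous (by fun_prop) fun p => hmem _ _ (by simp)
    have hFi : Integrable (Function.uncurry F)
        ((volume.restrict (uIoc 0 (2 * Real.pi))).prod
          (volume.restrict (Ioc 0 (2 * Real.pi)))) := by
      rw [uIoc_of_le Real.two_pi_pos.le, Measure.prod_restrict]
      exact (hFc.continuousOn.integrableOn_compact (isCompact_Icc.prod isCompact_Icc)).mono_set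
        (prod_mono Ioc_subset_Icc_self Ioc_subset_Icc_self)
    have hswap := intervalIntegral_integral_swap hFi
    have h1 : ∀ θ, ∫ φ in Ioc 0 (2 * Real.pi), F θ φ = ((2 * Real.pi : ℝ) : ℂ) * s ^ k *
        (homComp g k (z + ex θ • u) * Complex.exp (-(ex θ * inner ℂ z u))) := by
      intro θ
      rw [← intervalIntegral.integral_of_le Real.two_pi_pos.le]
      simp only [hF]
      rw [intervalIntegral.integral_mul_const, integral_slice hg _ (hsn _ (by simp))]
      ring
    have h2 : ∀ φ, ∫ θ in 0..2 * Real.pi, F θ φ = ((2 * Real.pi : ℝ) : ℂ) *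
        (g ((s * ex φ) • z) * (ex φ)⁻¹ ^ k) := by
      intro φ
      have := integral_ex_eq_of_differentiableOn
        (f := fun l => g ((s * ex φ) • (z + l • u)) * (ex φ)⁻¹ ^ k *
          Complex.exp (-(l * inner ℂ z u))) (by
          refine DifferentiableOn.mul (DifferentiableOn.mul (hg.comp (by fun_prop) fun l hl => ?_)
            (by fun_prop)) (by fun_prop)
          exact hmem φ l (by simpa using hl))
      simpa [hF] using this
    simp only [h1, h2] at hswap
    rw [intervalIntegral.integral_const_mul, integral_const_mul,
      ← intervalIntegral.integral_of_le Real.two_pi_pos.le,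
      integral_slice hg z (by simpa using hsn 0 (by simp))] at hswap
    refine mul_left_cancel₀ (mul_ne_zero two_pi_ne_zero' (pow_ne_zero k hs0)) (hswap.trans ?_)
    ring

end homComp

end

/-! ### Radial integrals over ℂⁿ: Gaussian, sphere, general weight -/

section

variable {m : ℕ}

lemma finrank_real_Cn (m : ℕ) : Module.finrank ℝ (Cn m) = 2 * m + 1 + 1 := by
  rw [← Module.finrank_mul_finrank ℝ ℂ]
  simp
  ring

/-- Multiplication by a number of modulus one, as a real isometry. -/
noncomputable def rotation (m : ℕ) (c : ℂ) (hc : ‖c‖ = 1) : Cn m ≃ₗᵢ[ℝ] Cn m where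
  toLinearEquiv := (LinearEquiv.smulOfNeZero ℂ (Cn m) c (by
    rintro rfl; simp at hc)).restrictScalars ℝ
  norm_map' w := by
    change ‖c • w‖ = ‖w‖
    rw [norm_smul, hc, one_mul]

lemma measurePreserving_smul (c : ℂ) (hc : ‖c‖ = 1) :
    MeasurePreserving (fun w : Cn m => c • w) volume volume :=
  (rotation m c hc).measurePreserving

/-- Averaging over the rotations `w ↦ e^{iθ} w` does not change the integral. -/
lemma integral_eq_integral_rotation {ψ : Cn m → ℂ} (hψ : Integrable ψ) :
    ((2 * Real.pi : ℝ) : ℂ) * ∫ w, ψ w = ∫ w, ∫ θ in (0 : ℝ)..2 * Real.pi, ψ (ex θ • w) := by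
  set ρ : Measure ℝ := volume.restrict (uIoc 0 (2 * Real.pi)) with hρ
  have : IsFiniteMeasure ρ := ⟨by
    rw [hρ, Measure.restrict_apply_univ, uIoc_of_le Real.two_pi_pos.le]
    exact measure_Ioc_lt_top⟩
  have hmp : MeasurePreserving (fun p : ℝ × Cn m => (p.1, ex p.1 • p.2)) (ρ.prod volume)
      (ρ.prod volume) := by
    refine MeasurePreserving.skew_product (g := fun (θ : ℝ) (w : Cn m) => ex θ • w)
      (MeasurePreserving.id ρ) ?_ (Filter.Eventually.of_forall fun θ => ?_)
    · exact Continuous.measurable (by simp only [Function.uncurry_def]; fun_prop)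
    · exact (measurePreserving_smul (ex θ) (norm_ex θ)).map_eq
  have hi : Integrable (Function.uncurry fun (θ : ℝ) (w : Cn m) => ψ (ex θ • w))
      (ρ.prod volume) :=
    hmp.integrable_comp_of_integrable (hψ.comp_snd ρ)
  rw [← intervalIntegral_integral_swap hi]
  have e : ∀ θ : ℝ, ∫ w, ψ (ex θ • w) = ∫ w, ψ w := fun θ =>
    (rotation m (ex θ) (norm_ex θ)).measurePreserving.integral_comp
      (rotation m (ex θ) (norm_ex θ)).toMeasurableEquiv.measurableEmbedding ψ
  simp [e]

/-- The radial moments of a weight. -/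
noncomputable def mom (η : ℝ → ℝ) (j : ℕ) : ℝ := ∫ r in Ioi (0 : ℝ), r ^ j * η r

/-- The surface measure of the unit sphere of `ℂ^(m+1)`. -/
noncomputable def sphereMass (m : ℕ) : ℝ := (volume : Measure (Cn m)).toSphere.real univ

lemma sphereMass_eq (m : ℕ) :
    sphereMass m = (2 * m + 2) * (volume : Measure (Cn m)).real (ball 0 1) := by
  rw [sphereMass, Measure.toSphere_real_apply_univ, finrank_real_Cn]
  push_cast; ring

lemma volume_real_ball_pos (m : ℕ) : 0 < (volume : Measure (Cn m)).real (ball 0 1) :=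
  ENNReal.toReal_pos (measure_ball_pos _ _ one_pos).ne' measure_ball_lt_top.ne

lemma sphereMass_pos (m : ℕ) : 0 < sphereMass m := by
  rw [sphereMass_eq]
  have := volume_real_ball_pos m
  positivity

/-- Polar coordinates for the product of a positively homogeneous and a radial function. -/
lemma integral_homogeneous_mul_radial {H : Cn m → ℂ} {d : ℕ}
    (hH : ∀ (r : ℝ) (w : Cn m), 0 < r → H (r • w) = (r : ℂ) ^ d * H w) (η : ℝ → ℝ) :
    ∫ w, H w * (η ‖w‖ : ℂ) =
      (∫ ξ, H ξ ∂(volume : Measure (Cn m)).toSphere) * (mom η (d + (2 * m + 1)) : ℂ) := by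
  set μ : Measure (Cn m) := volume with hμ
  have hdim : Module.finrank ℝ (Cn m) - 1 = 2 * m + 1 := by rw [finrank_real_Cn]; simp
  calc ∫ w, H w * (η ‖w‖ : ℂ) ∂μ
      = ∫ x : ({(0)}ᶜ : Set (Cn m)), H x * (η ‖x.1‖ : ℂ) ∂(μ.comap (↑)) := by
        rw [integral_subtype_comap (measurableSet_singleton _).compl
          fun x => H x * (η (‖x‖) : ℂ), restrict_compl_singleton]
    _ = ∫ p : sphere (0 : Cn m) 1 × Ioi (0 : ℝ), H p.1 * ((p.2 : ℂ) ^ d * (η p.2 : ℂ))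
          ∂μ.toSphere.prod (.volumeIoiPow (Module.finrank ℝ (Cn m) - 1)) := by
        rw [← μ.measurePreserving_homeomorphUnitSphereProd.integral_comp
          (Homeomorph.measurableEmbedding _)]
        refine integral_congr_ae (Filter.Eventually.of_forall fun x => ?_)
        have hx : 0 < ‖x.1‖ := norm_pos_iff.2 x.2
        have h1 : (((homeomorphUnitSphereProd (Cn m)) x).2 : ℝ) = ‖x.1‖ :=
          homeomorphUnitSphereProd_apply_snd_coe (Cn m) x
        have h2 : (((homeomorphUnitSphereProd (Cn m)) x).1 : Cn m) = ‖x.1‖⁻¹ • x.1 :=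
          homeomorphUnitSphereProd_apply_fst_coe (Cn m) x
        change H x * (η ‖x.1‖ : ℂ) = H ((homeomorphUnitSphereProd (Cn m)) x).1 *
          (((((homeomorphUnitSphereProd (Cn m)) x).2 : ℝ) : ℂ) ^ d *
            (η ((homeomorphUnitSphereProd (Cn m)) x).2 : ℂ))
        rw [h1, h2]
        rw [← mul_assoc, mul_comm (H (_ • _)), ← hH _ _ hx, smul_inv_smul₀ hx.ne']
    _ = (∫ ξ, H ξ ∂μ.toSphere) *
          ∫ r : Ioi (0 : ℝ), (r : ℂ) ^ d * (η r : ℂ) ∂.volumeIoiPow (2 * m + 1) := by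
        rw [hdim]
        exact integral_prod_mul (fun ξ : sphere (0 : Cn m) 1 => H ξ)
          fun r : Ioi (0 : ℝ) => (r : ℂ) ^ d * (η r : ℂ)
    _ = _ := by
        congr 1
        simp only [Measure.volumeIoiPow, ENNReal.ofReal]
        rw [integral_withDensity_eq_integral_smul,
          integral_subtype_comap measurableSet_Ioi fun a : ℝ =>
            Real.toNNReal (a ^ (2 * m + 1)) • ((a : ℂ) ^ d * (η a : ℂ)), mom,
          ← integral_complex_ofReal]
        · refine setIntegral_congr_fun measurableSet_Ioi fun r hr => ?_
          rw [NNReal.smul_def, Real.coe_toNNReal _ (pow_nonneg (le_of_lt hr) _), Complex.real_smul]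
          push_cast
          ring
        · exact (measurable_subtype_coe.pow_const _).real_toNNReal

lemma mom_gaussian (j : ℕ) :
    mom (fun r => Real.exp (-r ^ 2)) (2 * j + 1) = (j.factorial : ℝ) / 2 := by
  have h := integral_rpow_mul_exp_neg_rpow (p := 2) (q := ((2 * j + 1 : ℕ) : ℝ)) two_pos
    (by linarith [((2 * j + 1 : ℕ).cast_nonneg : (0 : ℝ) ≤ (2 * j + 1 : ℕ))])
  have e : (((2 * j + 1 : ℕ) : ℝ) + 1) / 2 = j + 1 := by push_cast; ring
  rw [e, Real.Gamma_nat_eq_factorial] at h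
  simp only [Real.rpow_natCast, Real.rpow_ofNat] at h
  rw [mom, h]
  ring

lemma integrable_gaussian {k : ℕ} {h : Cn m → ℂ} (hh : IsHolHomog k h) (z : Cn m) :
    Integrable fun w : Cn m => h w * Complex.exp (inner ℂ w z) * (Real.exp (-‖w‖ ^ 2) : ℂ) := by
  obtain ⟨C, hC, hb⟩ := hh.exists_bound
  have hr : Integrable (fun w : Cn m => C * (Real.exp (‖z‖ ^ 2 / 2) *
      (‖w‖ ^ k * Real.exp (-(1 / 2) * ‖w‖ ^ 2)))) := by
    refine Integrable.const_mul (Integrable.const_mul ?_ _) _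
    rw [integrable_fun_norm_addHaar (volume : Measure (Cn m))
      (f := fun r => r ^ k * Real.exp (-(1 / 2) * r ^ 2)), finrank_real_Cn]
    refine (integrableOn_rpow_mul_exp_neg_mul_sq (b := 1 / 2) (by norm_num)
      (s := ((2 * m + 1 + k : ℕ) : ℝ))
      (by linarith [((2 * m + 1 + k : ℕ).cast_nonneg : (0 : ℝ) ≤ (2 * m + 1 + k : ℕ))])).congr_fun
      (fun r _ => ?_) measurableSet_Ioi
    simp only [smul_eq_mul, Real.rpow_natCast]
    rw [Nat.add_sub_cancel, pow_add, mul_assoc]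
  refine hr.mono' ?_ (Filter.Eventually.of_forall fun w => ?_)
  · have := hh.continuous
    exact Continuous.aestronglyMeasurable (by fun_prop)
  · rw [norm_mul, norm_mul, Complex.norm_real, Real.norm_of_nonneg (Real.exp_pos _).le,
      Complex.norm_exp]
    have h1 : (inner ℂ w z : ℂ).re ≤ ‖w‖ * ‖z‖ :=
      (Complex.re_le_norm _).trans (norm_inner_le_norm w z)
    have h2 : Real.exp (inner ℂ w z : ℂ).re * Real.exp (-‖w‖ ^ 2) ≤
        Real.exp (‖z‖ ^ 2 / 2) * Real.exp (-(1 / 2) * ‖w‖ ^ 2) := by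
      rw [← Real.exp_add, ← Real.exp_add]
      refine Real.exp_le_exp.2 ?_
      nlinarith [sq_nonneg (‖w‖ - ‖z‖)]
    calc ‖h w‖ * Real.exp (inner ℂ w z : ℂ).re * Real.exp (-‖w‖ ^ 2)
        = ‖h w‖ * (Real.exp (inner ℂ w z : ℂ).re * Real.exp (-‖w‖ ^ 2)) := by ring
      _ ≤ (C * ‖w‖ ^ k) * (Real.exp (‖z‖ ^ 2 / 2) * Real.exp (-(1 / 2) * ‖w‖ ^ 2)) :=
          mul_le_mul (hb w) h2 (by positivity) (by positivity)
      _ = _ := by ring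

/-- The reproducing formula of the Fock space. -/
lemma integral_gaussian_exp {k : ℕ} {h : Cn m → ℂ} (hh : IsHolHomog k h) (z : Cn m) :
    ∫ w, h w * Complex.exp (inner ℂ w z) * (Real.exp (-‖w‖ ^ 2) : ℂ) =
      h z * ∫ w : Cn m, (Real.exp (-‖w‖ ^ 2) : ℂ) := by
  set f : Cn m → ℂ := fun w => h w * Complex.exp (inner ℂ w z) * (Real.exp (-‖w‖ ^ 2) : ℂ) with hf
  have hfi : Integrable f := integrable_gaussian hh z
  -- Completing the square: ⟨z+u, z⟩ - |z+u|² = -⟨z, u⟩ - |u|². Averaging over rotations of u then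
  -- triggers the mean value property.
  have e : ∀ u, f (z + u) = h (z + u) * Complex.exp (-(inner ℂ z u)) *
      (Real.exp (-‖u‖ ^ 2) : ℂ) := by
    intro u
    simp only [hf, mul_assoc]
    congr 1
    rw [Complex.ofReal_exp, Complex.ofReal_exp, ← Complex.exp_add, ← Complex.exp_add]
    congr 1
    have h1 : ∀ x : Cn m, ((-‖x‖ ^ 2 : ℝ) : ℂ) = -inner ℂ x x := fun x => by
      rw [inner_self_eq_norm_sq_to_K]; push_cast; rfl
    rw [h1, h1, inner_add_left, inner_add_left, inner_add_right, inner_add_right]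
    ring
  have h2 := integral_eq_integral_rotation (hfi.comp_add_left z)
  rw [integral_add_left_eq_self f z] at h2
  have h3 : ∀ u : Cn m, ∫ θ in (0 : ℝ)..2 * Real.pi, f (z + ex θ • u) =
      ((2 * Real.pi : ℝ) : ℂ) * (h z * (Real.exp (-‖u‖ ^ 2) : ℂ)) := by
    intro u
    simp only [e, norm_smul, norm_ex, one_mul, inner_smul_right]
    rw [intervalIntegral.integral_mul_const, hh.meanValue, mul_assoc]
  simp only [h3] at h2
  rw [integral_const_mul, integral_const_mul] at h2
  exact mul_left_cancel₀ two_pi_ne_zero' h2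

/-- Rotating w by e^{iθ} multiplies h by e^{ikθ} and the j-th term of exp⟨w, z⟩ by e^{-ijθ}, so only
the term of degree k survives. -/
lemma integral_gaussian_inner_pow {k : ℕ} {h : Cn m → ℂ} (hh : IsHolHomog k h) (z : Cn m) :
    ∫ w, h w * (inner ℂ w z : ℂ) ^ k * (Real.exp (-‖w‖ ^ 2) : ℂ) =
      k.factorial * (h z * ∫ w : Cn m, (Real.exp (-‖w‖ ^ 2) : ℂ)) := by
  rw [← integral_gaussian_exp hh z]
  have h2 := integral_eq_integral_rotation (integrable_gaussian hh z)
  have h3 : ∀ w : Cn m, ∫ θ in (0 : ℝ)..2 * Real.pi, h (ex θ • w) *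
      Complex.exp (inner ℂ (ex θ • w) z) * (Real.exp (-‖ex θ • w‖ ^ 2) : ℂ) =
      ((2 * Real.pi : ℝ) : ℂ) * ((k.factorial : ℂ)⁻¹ *
        (h w * (inner ℂ w z : ℂ) ^ k * (Real.exp (-‖w‖ ^ 2) : ℂ))) := by
    intro w
    have h4 := integral_tsum_inv_mul_pow
      (NormedSpace.expSeries_div_summable (𝔸 := ℂ) (inner ℂ w z : ℂ)) k
    have e : ∀ θ, ∑' j : ℕ, (inner ℂ w z : ℂ) ^ j / (j.factorial : ℂ) * (ex θ)⁻¹ ^ j =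
        Complex.exp ((ex θ)⁻¹ * inner ℂ w z) := by
      intro θ
      rw [Complex.exp_eq_exp_ℂ, NormedSpace.exp_eq_tsum_div]
      refine tsum_congr fun j => ?_
      rw [mul_pow]; ring
    simp only [e] at h4
    simp only [hh.map_smul, inner_smul_left, conj_ex, norm_smul, norm_ex, one_mul]
    have e2 : ∀ θ, ex θ ^ k * h w * Complex.exp ((ex θ)⁻¹ * inner ℂ w z) *
        (Real.exp (-‖w‖ ^ 2) : ℂ) = h w * (Real.exp (-‖w‖ ^ 2) : ℂ) *
        (ex θ ^ k * Complex.exp ((ex θ)⁻¹ * inner ℂ w z)) := fun θ => by ring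
    simp only [e2]
    rw [intervalIntegral.integral_const_mul, h4]
    ring
  simp only [h3] at h2
  rw [integral_const_mul, integral_const_mul] at h2
  rw [mul_left_cancel₀ two_pi_ne_zero' h2, mul_inv_cancel_left₀]
  exact_mod_cast k.factorial_ne_zero

/-- The scalar `∫ |⟨ξ, ζ⟩|^{2k} dσ(ξ)` for unit vectors `ζ`. -/
noncomputable def sphereConst (m k : ℕ) : ℝ := sphereMass m / ((k + m).choose m : ℝ)

lemma sphereConst_pos (m k : ℕ) : 0 < sphereConst m k :=
  div_pos (sphereMass_pos m) (by exact_mod_cast Nat.choose_pos (by omega))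

/-- In polar coordinates the Gaussian integral is the spherical one times (k+m)!/2, while the total
Gaussian mass is `sphereMass m` times m!/2. The binomial coefficient is the ratio (k+m)!/(k! m!). -/
lemma integral_sphere_inner_pow {k : ℕ} {h : Cn m → ℂ} (hh : IsHolHomog k h) (z : Cn m) :
    ∫ ξ : sphere (0 : Cn m) 1, h ξ * (inner ℂ (ξ : Cn m) z : ℂ) ^ k ∂volume.toSphere =
      (sphereConst m k : ℂ) * h z := by
  have h1 := integral_gaussian_inner_pow hh z
  have h0 := integral_homogeneous_mul_radial (m := m) (H := fun _ => 1) (d := 0) (by simp)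
    (fun r => Real.exp (-r ^ 2))
  rw [zero_add, mom_gaussian] at h0
  have h2 := integral_homogeneous_mul_radial (m := m)
    (H := fun w => h w * (inner ℂ w z : ℂ) ^ k) (d := 2 * k) (fun r w _ => by
      have e : r • w = (r : ℂ) • w := rfl
      rw [e, hh.map_smul, inner_smul_left, Complex.conj_ofReal]
      ring) (fun r => Real.exp (-r ^ 2))
  have e2 : 2 * k + (2 * m + 1) = 2 * (k + m) + 1 := by ring
  rw [e2, mom_gaussian] at h2
  simp only [one_mul] at h0
  rw [h1, h0] at h2
  have e3 : ∫ _ : sphere (0 : Cn m) 1, (1 : ℂ) ∂volume.toSphere = (sphereMass m : ℂ) := by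
    rw [integral_const, sphereMass, Complex.real_smul, mul_one]
  rw [e3] at h2
  have hf : ((k + m).factorial : ℂ) ≠ 0 := by exact_mod_cast (k + m).factorial_ne_zero
  have hch : ((k + m).choose m : ℂ) * (m.factorial * k.factorial) = ((k + m).factorial : ℂ) := by
    have := Nat.add_choose_mul_factorial_mul_factorial k m
    have h' : (((k + m).choose m * k.factorial * m.factorial : ℕ) : ℂ) = (k + m).factorial := by
      rw [this]
    rw [← h']; push_cast; ring
  have hch0 : ((k + m).choose m : ℂ) ≠ 0 := by
    exact_mod_cast (Nat.choose_pos (by omega)).ne'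
  rw [sphereConst]
  push_cast at h2 ⊢
  rw [div_mul_eq_mul_div, eq_div_iff hch0]
  refine mul_right_cancel₀ hf (b := _) ?_
  linear_combination (-2 * ((k + m).choose m : ℂ)) * h2 + sphereMass m * h z * hch

lemma integral_inner_pow_mul_radial {k : ℕ} {h : Cn m → ℂ} (hh : IsHolHomog k h) (z : Cn m)
    (η : ℝ → ℝ) :
    ∫ w, h w * (inner ℂ w z : ℂ) ^ k * (η ‖w‖ : ℂ) =
      (sphereConst m k * mom η (2 * k + (2 * m + 1)) : ℝ) * h z := by
  rw [integral_homogeneous_mul_radial (m := m)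
    (H := fun w => h w * (inner ℂ w z : ℂ) ^ k) (d := 2 * k) (fun r w _ => by
      have e : r • w = (r : ℂ) • w := rfl
      rw [e, hh.map_smul, inner_smul_left, Complex.conj_ofReal]
      ring) η, integral_sphere_inner_pow hh]
  push_cast
  ring

/-- Pairing of a sum of homogeneous functions with a power series in `⟨z, w⟩`, against a radial
weight on the ball. -/
lemma hasSum_integral_mul_tsum {h : ℕ → Cn m → ℂ} (hh : ∀ k, IsHolHomog k (h k)) {f : Cn m → ℂ}
    (hf : ∀ w ∈ unitBall (m + 1), HasSum (fun k => h k w) (f w)) {η : ℝ → ℝ}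
    (hη : ∀ r, 1 ≤ r → η r = 0) (hi : Integrable fun w => f w * (η ‖w‖ : ℂ)) {b : ℕ → ℂ}
    {z : Cn m} (hb : Summable fun k => ‖b k‖ * ‖z‖ ^ k) :
    HasSum (fun k => b k * ((sphereConst m k * mom η (2 * k + (2 * m + 1)) : ℝ) * h k z))
      (∫ w, f w * (∑' k, b k * (inner ℂ w z : ℂ) ^ k) * (η ‖w‖ : ℂ)) := by
  set F : ℕ → Cn m → ℂ := fun k w => f w * (η ‖w‖ : ℂ) * (b k * (inner ℂ w z : ℂ) ^ k) with hF
  have hη' : ∀ w : Cn m, w ∉ unitBall (m + 1) → (η ‖w‖ : ℂ) = 0 := fun w hw => by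
    rw [hη _ (by simpa using hw), Complex.ofReal_zero]
  have hFb : ∀ k w, ‖F k w‖ ≤ ‖b k‖ * ‖z‖ ^ k * ‖f w * (η ‖w‖ : ℂ)‖ := by
    intro k w
    by_cases hw : w ∈ unitBall (m + 1)
    · rw [hF, norm_mul _ (b k * _), mul_comm, norm_mul (b k), norm_pow]
      rw [mem_ball_zero_iff] at hw
      gcongr
      refine (norm_inner_le_norm w z).trans ?_
      exact mul_le_of_le_one_left (norm_nonneg _) hw.le
    · simp [hF, hη' w hw]
  have hFi : ∀ k, Integrable (F k) := fun k => by
    refine (hi.norm.const_mul (‖b k‖ * ‖z‖ ^ k)).mono'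
      (hi.aestronglyMeasurable.mul (Continuous.aestronglyMeasurable (by fun_prop)))
      (Filter.Eventually.of_forall (hFb k))
  have hFs : Summable fun k => ∫ w, ‖F k w‖ := by
    refine (hb.mul_right (∫ w, ‖f w * (η ‖w‖ : ℂ)‖)).of_nonneg_of_le
      (fun k => integral_nonneg fun w => norm_nonneg _) fun k => ?_
    rw [← integral_const_mul]
    exact integral_mono (hFi k).norm (hi.norm.const_mul _) (hFb k)
  have hmain := hasSum_integral_of_summable_integral_norm hFi hFs
  have e1 : ∀ w, ∑' k, F k w = f w * (∑' k, b k * (inner ℂ w z : ℂ) ^ k) * (η ‖w‖ : ℂ) := by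
    intro w
    simp only [hF]
    rw [tsum_mul_left]
    ring
  simp only [e1] at hmain
  refine (funext fun k => ?_ : (fun k => b k * ((sphereConst m k *
    mom η (2 * k + (2 * m + 1)) : ℝ) * h k z)) = fun k => ∫ w, F k w) ▸ hmain
  -- Rotation averages pick the degree k component of f; the kernel term is already homogeneous.
  have h2 := integral_eq_integral_rotation (hFi k)
  have h3 : ∀ w : Cn m, ∫ θ in (0 : ℝ)..2 * Real.pi, F k (ex θ • w) =
      ((2 * Real.pi : ℝ) : ℂ) * (b k * (h k w * (inner ℂ w z : ℂ) ^ k * (η ‖w‖ : ℂ))) := by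
    intro w
    by_cases hw : w ∈ unitBall (m + 1)
    · have hs := (hf w hw).summable
      have h4 := integral_tsum_mul_inv_pow hs k
      have e2 : ∀ θ, ∑' j, h j w * ex θ ^ j = f (ex θ • w) := by
        intro θ
        rw [← (hf (ex θ • w) (by simpa [norm_smul] using hw)).tsum_eq]
        exact tsum_congr fun j => by rw [(hh j).map_smul, mul_comm]
      simp only [e2] at h4
      have e3 : ∀ θ, F k (ex θ • w) = b k * (inner ℂ w z : ℂ) ^ k * (η ‖w‖ : ℂ) *
          (f (ex θ • w) * (ex θ)⁻¹ ^ k) := by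
        intro θ
        simp only [hF, norm_smul, norm_ex, one_mul, inner_smul_left, conj_ex, mul_pow]
        ring
      simp only [e3]
      rw [intervalIntegral.integral_const_mul, h4]
      ring
    · have hw' := hη' w hw
      simp [hF, norm_smul, hw']
  simp only [h3] at h2
  rw [integral_const_mul, integral_const_mul, integral_inner_pow_mul_radial (hh k)] at h2
  exact (mul_left_cancel₀ two_pi_ne_zero' h2).symm

end

/-! ### Moments of weights -/

section

/-- Nonnegative integrable functions that vanish outside `[0, 1)`. -/
structure IsWeight (η : ℝ → ℝ) : Prop where
  nonneg : ∀ r, 0 ≤ η r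
  eq_zero : ∀ r, r ∉ Ico (0 : ℝ) 1 → η r = 0
  integrable : Integrable η

namespace IsWeight

variable {η : ℝ → ℝ}

lemma eq_zero_of_one_le (h : IsWeight η) (r : ℝ) (hr : 1 ≤ r) : η r = 0 :=
  h.eq_zero r fun h' => absurd h'.2 (not_lt.2 hr)

lemma mul (h : IsWeight η) {p : ℝ → ℝ} (hp : Continuous p)
    (hp' : ∀ r ∈ Ico (0 : ℝ) 1, 0 ≤ p r ∧ p r ≤ 1) : IsWeight (fun r => p r * η r) where
  nonneg r := by
    by_cases hr : r ∈ Ico (0 : ℝ) 1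
    · exact mul_nonneg (hp' r hr).1 (h.nonneg r)
    · rw [h.eq_zero r hr, mul_zero]
  eq_zero r hr := by rw [h.eq_zero r hr, mul_zero]
  integrable := by
    refine h.integrable.mono' (hp.aestronglyMeasurable.mul h.integrable.aestronglyMeasurable)
      (Filter.Eventually.of_forall fun r => ?_)
    by_cases hr : r ∈ Ico (0 : ℝ) 1
    · rw [Real.norm_of_nonneg (mul_nonneg (hp' r hr).1 (h.nonneg r))]
      exact mul_le_of_le_one_left (h.nonneg r) (hp' r hr).2
    · simp [h.eq_zero r hr]

lemma pow_mul (h : IsWeight η) (j : ℕ) : IsWeight (fun r => r ^ j * η r) :=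
  h.mul (by fun_prop) fun _ hr => ⟨pow_nonneg hr.1 j, pow_le_one₀ hr.1 hr.2.le⟩

lemma one_sub_sq_pow_mul (h : IsWeight η) (i : ℕ) : IsWeight (fun r => (1 - r ^ 2) ^ i * η r) :=
  h.mul (by fun_prop) fun r hr => by
    have h1 : 0 ≤ 1 - r ^ 2 := by nlinarith [hr.1, hr.2]
    exact ⟨pow_nonneg h1 i, pow_le_one₀ h1 (by nlinarith)⟩

lemma integrableOn_pow (h : IsWeight η) (j : ℕ) (s : Set ℝ) :
    IntegrableOn (fun r => r ^ j * η r) s :=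
  (h.pow_mul j).integrable.integrableOn

lemma mom_nonneg (h : IsWeight η) (j : ℕ) : 0 ≤ mom η j :=
  integral_nonneg fun r => (h.pow_mul j).nonneg r

lemma mom_anti (h : IsWeight η) {i j : ℕ} (hij : i ≤ j) : mom η j ≤ mom η i := by
  refine integral_mono (h.integrableOn_pow j _) (h.integrableOn_pow i _) fun r => ?_
  by_cases hr : r ∈ Ico (0 : ℝ) 1
  · exact mul_le_mul_of_nonneg_right (pow_le_pow_of_le_one hr.1 hr.2.le hij) (h.nonneg r)
  · simp [h.eq_zero r hr]

end IsWeight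

lemma mom_pow_mul (η : ℝ → ℝ) (i j : ℕ) : mom (fun r => r ^ i * η r) j = mom η (i + j) := by
  simp only [mom]
  congr 1
  funext r
  rw [pow_add]; ring

/-- Weights whose odd moments of index at least `2 m + 1` are positive and doubling. -/
structure IsRegularWeight (m : ℕ) (η : ℝ → ℝ) : Prop extends IsWeight η where
  pos : ∀ k, 0 < mom η (2 * k + (2 * m + 1))
  doubling : ∃ A, 0 ≤ A ∧ ∀ j k, k ≤ 2 * j + 1 →
    mom η (2 * j + (2 * m + 1)) ≤ A * mom η (2 * k + (2 * m + 1))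

/-- Half of the exponent is spent on the gain: with l = k - k/2, (l+1) s^l (1-s) ≤ (1-s)(1 + s + ⋯ +
s^l) ≤ 1. -/
lemma pow_mul_one_sub_le {s : ℝ} (h0 : 0 ≤ s) (h1 : s ≤ 1) (k : ℕ) :
    s ^ k * (1 - s) ≤ 2 / ((k : ℝ) + 1) * s ^ (k / 2) := by
  set l := k - k / 2 with hl
  have hk : k = k / 2 + l := by omega
  have h2 : ((l : ℝ) + 1) * s ^ l * (1 - s) ≤ 1 := by
    have h3 : ((l : ℝ) + 1) * s ^ l ≤ ∑ i ∈ Finset.range (l + 1), s ^ i := by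
      have : ((l : ℝ) + 1) * s ^ l = ∑ _i ∈ Finset.range (l + 1), s ^ l := by simp
      rw [this]
      exact Finset.sum_le_sum fun i hi =>
        pow_le_pow_of_le_one h0 h1 (Nat.lt_succ_iff.1 (Finset.mem_range.1 hi))
    have h4 := geom_sum_mul_neg s (l + 1)
    have h5 := mul_le_mul_of_nonneg_right h3 (sub_nonneg.2 h1)
    have h6 : 0 ≤ s ^ (l + 1) := by positivity
    linarith
  have h3 : s ^ l * (1 - s) ≤ 2 / ((k : ℝ) + 1) := by
    rw [le_div_iff₀ (by positivity)]
    have hkl : (k : ℝ) + 1 ≤ 2 * ((l : ℝ) + 1) := by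
      have : k + 1 ≤ 2 * (l + 1) := by omega
      exact_mod_cast this
    have h7 : 0 ≤ s ^ l * (1 - s) := mul_nonneg (by positivity) (sub_nonneg.2 h1)
    nlinarith
  calc s ^ k * (1 - s) = s ^ l * (1 - s) * s ^ (k / 2) := by
        conv_lhs => rw [hk, pow_add]
        ring
    _ ≤ _ := by gcongr

namespace IsRegularWeight

variable {m : ℕ} {η : ℝ → ℝ}

/-- Each factor 1-r² is exchanged for 2/(k+1) by halving the exponent k, and doubling of the moments
restores the exponent. -/
lemma exists_mom_le (h : IsRegularWeight m η) (i : ℕ) : ∃ C, 0 ≤ C ∧ ∀ k : ℕ,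
    mom (fun r => (1 - r ^ 2) ^ i * η r) (2 * k + (2 * m + 1)) ≤
      C * (mom η (2 * k + (2 * m + 1)) / ((k : ℝ) + 1) ^ i) := by
  induction i with
  | zero => exact ⟨1, zero_le_one, by simp⟩
  | succ i ih =>
    obtain ⟨C, hC, hi⟩ := ih
    obtain ⟨A, hA, hd⟩ := h.doubling
    refine ⟨2 * C * 2 ^ i * A, by positivity, fun k => ?_⟩
    have h1 : mom (fun r => (1 - r ^ 2) ^ (i + 1) * η r) (2 * k + (2 * m + 1)) ≤
        2 / ((k : ℝ) + 1) * mom (fun r => (1 - r ^ 2) ^ i * η r) (2 * (k / 2) + (2 * m + 1)) := by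
      rw [mom, mom, ← integral_const_mul]
      refine integral_mono ((h.one_sub_sq_pow_mul _).integrableOn_pow _ _)
        (((h.one_sub_sq_pow_mul _).integrableOn_pow _ _).const_mul _) fun r => ?_
      by_cases hr : r ∈ Ico (0 : ℝ) 1
      · have hs : r ^ 2 ≤ 1 := by nlinarith [hr.1, hr.2]
        have h2 := pow_mul_one_sub_le (sq_nonneg r) hs k
        have h3 : 0 ≤ r ^ (2 * m + 1) * ((1 - r ^ 2) ^ i * η r) :=
          mul_nonneg (pow_nonneg hr.1 _) (mul_nonneg (pow_nonneg (sub_nonneg.2 hs) _) (h.nonneg r))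
        have h4 := mul_le_mul_of_nonneg_right h2 h3
        calc r ^ (2 * k + (2 * m + 1)) * ((1 - r ^ 2) ^ (i + 1) * η r)
            = (r ^ 2) ^ k * (1 - r ^ 2) * (r ^ (2 * m + 1) * ((1 - r ^ 2) ^ i * η r)) := by
              rw [pow_add, pow_mul, pow_succ (1 - r ^ 2)]; ring
          _ ≤ _ := h4
          _ = _ := by rw [pow_add, ← pow_mul]; ring
      · simp [h.eq_zero r hr]
    have hk2 : ((k : ℝ) + 1) / 2 ≤ ((k / 2 : ℕ) : ℝ) + 1 := by
      have : k + 1 ≤ 2 * (k / 2 + 1) := by omega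
      have : (k : ℝ) + 1 ≤ 2 * (((k / 2 : ℕ) : ℝ) + 1) := by exact_mod_cast this
      linarith
    have hm0 := (h.pos k).le
    calc _ ≤ _ := h1
      _ ≤ 2 / ((k : ℝ) + 1) * (C * (A * mom η (2 * k + (2 * m + 1)) / (((k : ℝ) + 1) / 2) ^ i)) := by
          refine mul_le_mul_of_nonneg_left ((hi (k / 2)).trans ?_) (by positivity)
          refine mul_le_mul_of_nonneg_left ?_ hC
          refine div_le_div₀ (by positivity) (hd (k / 2) k (by omega)) (by positivity) ?_
          exact pow_le_pow_left₀ (by positivity) hk2 i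
      _ = _ := by rw [div_pow]; field_simp; ring

lemma diffSeq_mom (h : IsRegularWeight m η) (i : ℕ) :
    diffSeq (fun k => mom (fun r => (1 - r ^ 2) ^ i * η r) (2 * k + (2 * m + 1))) =
      fun k => -mom (fun r => (1 - r ^ 2) ^ (i + 1) * η r) (2 * k + (2 * m + 1)) := by
  funext k
  simp only [diffSeq, mom]
  rw [← integral_sub ((h.one_sub_sq_pow_mul _).integrableOn_pow _ _)
    ((h.one_sub_sq_pow_mul _).integrableOn_pow _ _), ← integral_neg]
  congr 1
  funext r
  ring

/-- The odd moments of a regular weight are a symbol. -/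
lemma isSymbol_mom (h : IsRegularWeight m η) (J : ℕ) :
    IsSymbol J (fun k => mom η (2 * k + (2 * m + 1))) (fun k => mom η (2 * k + (2 * m + 1))) := by
  have key : ∀ i, IsSymbol J (fun k : ℕ => mom η (2 * k + (2 * m + 1)) / ((k : ℝ) + 1) ^ i)
      (fun k => mom (fun r => (1 - r ^ 2) ^ i * η r) (2 * k + (2 * m + 1))) := by
    have hb : ∀ i, ∃ C, 0 ≤ C ∧ ∀ k : ℕ,
        |mom (fun r => (1 - r ^ 2) ^ i * η r) (2 * k + (2 * m + 1))| ≤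
          C * (mom η (2 * k + (2 * m + 1)) / ((k : ℝ) + 1) ^ i) := fun i => by
      obtain ⟨C, hC, hi⟩ := h.exists_mom_le i
      exact ⟨C, hC, fun k => by
        rw [abs_of_nonneg ((h.one_sub_sq_pow_mul i).mom_nonneg _)]; exact hi k⟩
    induction J with
    | zero => exact hb
    | succ J ih =>
      intro i
      refine ⟨hb i, ?_⟩
      rw [h.diffSeq_mom]
      have := (ih (i + 1)).neg
      simpa only [div_div, pow_succ] using this
  simpa using key 0

lemma isSymbol_mom_inv (h : IsRegularWeight m η) (J : ℕ) :
    IsSymbol J (fun k => (mom η (2 * k + (2 * m + 1)))⁻¹)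
      (fun k => (mom η (2 * k + (2 * m + 1)))⁻¹) := by
  obtain ⟨A, hA, hd⟩ := h.doubling
  exact (h.isSymbol_mom J).inv one_pos hA h.pos (fun k => hd k (k + 1) (by omega)) (by simp)

end IsRegularWeight

/-! ### From doubling of the tail to estimates for moments -/

/-- The tail of a weight. -/
noncomputable def tail (η : ℝ → ℝ) (r : ℝ) : ℝ := ∫ t in Ioi r, η t

/-- Prepares the layer cake formula. The truncation `max r 0` makes the integrand nonnegative on the
whole line. -/
lemma lintegral_pow_eq_mom {η : ℝ → ℝ} (h : IsWeight η) (j : ℕ) :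
    ∫⁻ r, ENNReal.ofReal (max r 0 ^ j) ∂(volume.withDensity fun r => ENNReal.ofReal (η r)) =
      ENNReal.ofReal (mom η j) := by
  have hi := (h.pow_mul j).integrable
  rw [lintegral_withDensity_eq_lintegral_mul₀ h.integrable.aemeasurable.ennreal_ofReal
    (by fun_prop)]
  have e : mom η j = ∫ r, r ^ j * η r := by
    rw [mom, ← integral_Ici_eq_integral_Ioi, setIntegral_eq_integral_of_forall_compl_eq_zero]
    intro r hr
    rw [h.eq_zero r fun h' => hr h'.1, mul_zero]
  rw [e, ofReal_integral_eq_lintegral_ofReal hi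
    (Filter.Eventually.of_forall (h.pow_mul j).nonneg)]
  refine lintegral_congr fun r => ?_
  by_cases hr : r ∈ Ico (0 : ℝ) 1
  · rw [Pi.mul_apply, ← ENNReal.ofReal_mul (h.nonneg r), max_eq_left hr.1, mul_comm]
  · simp [h.eq_zero r hr]

lemma withDensity_Ioi {η : ℝ → ℝ} (h : IsWeight η) (r : ℝ) :
    (volume.withDensity fun r => ENNReal.ofReal (η r)) (Ioi r) = ENNReal.ofReal (tail η r) := by
  rw [withDensity_apply _ measurableSet_Ioi, tail, ofReal_integral_eq_lintegral_ofReal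
    h.integrable.integrableOn (Filter.Eventually.of_forall h.nonneg)]

/-- Doubling of the tail implies doubling of the moments. -/
lemma mom_le_of_tail_le {η : ℝ → ℝ} (h : IsWeight η) {C : ℝ} (hC : 0 ≤ C)
    (hd : ∀ r ∈ Ico (0 : ℝ) 1, tail η r ≤ C * tail η ((1 + r) / 2)) {j : ℕ} (hj : j ≠ 0) :
    mom η j ≤ C * mom η (2 * j) := by
  set ν := volume.withDensity fun r => ENNReal.ofReal (η r) with hν
  have hlayer : ∀ j : ℕ, ENNReal.ofReal (mom η j) = ∫⁻ t in Ioi 0, ν {a | t < max a 0 ^ j} := by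
    intro j
    rw [← lintegral_pow_eq_mom h, lintegral_eq_lintegral_meas_lt]
    · exact Filter.Eventually.of_forall fun r => by positivity
    · exact Continuous.aemeasurable (by fun_prop)
  have hle : ENNReal.ofReal (mom η j) ≤ ENNReal.ofReal C * ENNReal.ofReal (mom η (2 * j)) := by
    rw [hlayer, hlayer, ← lintegral_const_mul' _ _ ENNReal.ofReal_ne_top]
    refine setLIntegral_mono' measurableSet_Ioi fun t ht => ?_
    have ht0 : 0 < t := ht
    set ρ := t ^ ((j : ℝ)⁻¹) with hρ
    have hρ0 : 0 < ρ := Real.rpow_pos_of_pos ht0 _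
    have hρj : ρ ^ j = t := Real.rpow_inv_natCast_pow ht0.le hj
    have hsub : {a : ℝ | t < max a 0 ^ j} ⊆ Ioi ρ := by
      intro a ha
      rw [mem_ofPred_eq, ← hρj] at ha
      have := lt_of_pow_lt_pow_left₀ j (by positivity) ha
      rcases lt_max_iff.1 this with h1 | h1
      · exact h1
      · exact absurd h1 (not_lt.2 hρ0.le)
    refine (measure_mono hsub).trans ?_
    rw [hν, withDensity_Ioi h, ← hν]
    rcases lt_or_ge ρ 1 with h1 | h1
    -- With t = ρ^j, the level set of r^j is at most (ρ, ∞), and that of r^{2j} contains ((1+ρ)/2,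
    -- ∞) because ((1+ρ)/2)² ≥ ρ. Doubling of the tail compares the two.
    · have hsub' : Ioi ((1 + ρ) / 2) ⊆ {a : ℝ | t < max a 0 ^ (2 * j)} := by
        intro a ha
        have ha' : (1 + ρ) / 2 < a := ha
        rw [mem_ofPred_eq, ← hρj, max_eq_left (by linarith), pow_mul]
        exact pow_lt_pow_left₀ (by nlinarith) hρ0.le hj
      refine le_trans ?_ (mul_le_mul_right (measure_mono hsub') _)
      rw [hν, withDensity_Ioi h, ← ENNReal.ofReal_mul hC]
      exact ENNReal.ofReal_le_ofReal (hd ρ ⟨hρ0.le, h1⟩)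
    · have : tail η ρ = 0 := setIntegral_eq_zero_of_forall_eq_zero fun r hr =>
        h.eq_zero_of_one_le r (h1.trans (le_of_lt hr))
      rw [this, ENNReal.ofReal_zero]
      exact zero_le
  rw [← ENNReal.ofReal_mul hC] at hle
  exact (ENNReal.ofReal_le_ofReal_iff (mul_nonneg hC (h.mom_nonneg _))).1 hle

lemma isRegularWeight_of_tail_le (m : ℕ) {η : ℝ → ℝ} (h : IsWeight η)
    (hpos : ∀ r ∈ Ioo (0 : ℝ) 1, 0 < η r) {C : ℝ} (hC : 0 ≤ C)
    (hd : ∀ r ∈ Ico (0 : ℝ) 1, tail η r ≤ C * tail η ((1 + r) / 2)) :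
    IsRegularWeight m η := by
  refine { toIsWeight := h, pos := fun k => ?_, doubling := ⟨C * C, by positivity, ?_⟩ }
  · rw [mom, setIntegral_pos_iff_support_of_nonneg_ae
      (Filter.Eventually.of_forall (h.pow_mul _).nonneg) (h.integrableOn_pow _ _)]
    have hsub : Ioo (0 : ℝ) 1 ⊆
        (Function.support fun r => r ^ (2 * k + (2 * m + 1)) * η r) ∩ Ioi 0 := fun r hr =>
      ⟨(mul_pos (pow_pos hr.1 _) (hpos r hr)).ne', hr.1⟩
    refine lt_of_lt_of_le ?_ (measure_mono hsub)
    simp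
  -- Doubling is applied twice: one application reaches the exponent 4j + 4m + 2, which for m = 0
  -- just misses 4j + 3, the case k = 2j + 1.
  · intro j k hjk
    have h1 := mom_le_of_tail_le h hC hd (j := 2 * j + (2 * m + 1)) (by omega)
    have h2 := mom_le_of_tail_le h hC hd (j := 2 * (2 * j + (2 * m + 1))) (by omega)
    have h3 := h.mom_anti (i := 2 * k + (2 * m + 1))
      (j := 2 * (2 * (2 * j + (2 * m + 1)))) (by omega)
    rw [mul_assoc]
    exact h1.trans (mul_le_mul_of_nonneg_left (h2.trans (mul_le_mul_of_nonneg_left h3 hC)) hC)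

/-- With N = 2^i and C < 2^p one has C^i ≤ N^p, and a power of N loses against (2/3)^N. -/
lemma exists_pow_mul_pow_le (C : ℝ) (hC : 0 ≤ C) :
    ∃ i : ℕ, C ^ i * (2 / 3 : ℝ) ^ (2 ^ i - 1) ≤ 1 / 2 := by
  obtain ⟨p, hp⟩ := pow_unbounded_of_one_lt C (one_lt_two)
  have h1 := tendsto_pow_const_mul_const_pow_of_abs_lt_one p
    (r := (2 / 3 : ℝ)) (by rw [abs_of_pos] <;> norm_num)
  have h2 : Filter.Tendsto (fun i : ℕ => 2 ^ i) Filter.atTop Filter.atTop :=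
    tendsto_pow_atTop_atTop_of_one_lt one_lt_two
  obtain ⟨i, hi⟩ := ((h1.comp h2).eventually (gt_mem_nhds (by norm_num : (0 : ℝ) < 1 / 3))).exists
  refine ⟨i, ?_⟩
  simp only [Function.comp] at hi
  push_cast at hi
  have e : (2 / 3 : ℝ) ^ (2 ^ i) = 2 / 3 * (2 / 3 : ℝ) ^ (2 ^ i - 1) := by
    rw [← pow_succ', Nat.sub_add_cancel Nat.one_le_two_pow]
  have h3 : C ^ i ≤ ((2 : ℝ) ^ i) ^ p := by
    rw [← pow_mul, mul_comm, pow_mul]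
    exact pow_le_pow_left₀ hC hp.le i
  have h4 := mul_le_mul_of_nonneg_right h3 (by positivity : (0 : ℝ) ≤ (2 / 3 : ℝ) ^ (2 ^ i - 1))
  rw [e] at hi
  linarith

/-- Moments of a doubling weight are controlled by its tail. -/
lemma exists_mom_le_tail (m : ℕ) {η : ℝ → ℝ} (h : IsWeight η) {C : ℝ} (hC : 0 ≤ C)
    (hd : ∀ r ∈ Ico (0 : ℝ) 1, tail η r ≤ C * tail η ((1 + r) / 2)) :
    ∃ D, 0 < D ∧ ∀ k : ℕ,
      mom η (2 * k + (2 * m + 1)) ≤ D * tail η (1 - 1 / (2 * ((k : ℝ) + 1))) := by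
  obtain ⟨i, hi⟩ := exists_pow_mul_pow_le C hC
  refine ⟨2 * C ^ i + 1, by positivity, fun k => ?_⟩
  set x := 2 * k + (2 * m + 1) with hx
  have hiter : ∀ i : ℕ, mom η x ≤ C ^ i * mom η (2 ^ i * x) := by
    intro i
    induction i with
    | zero => simp
    | succ i ih =>
      have := mom_le_of_tail_le h hC hd (j := 2 ^ i * x) (by positivity)
      refine ih.trans ?_
      rw [pow_succ, mul_assoc, pow_succ', mul_assoc]
      gcongr
  have hk : (1 : ℝ) / (2 * ((k : ℝ) + 1)) ≤ 1 / 2 := by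
    rw [div_le_div_iff₀ (by positivity) (by norm_num)]
    linarith [(k.cast_nonneg : (0 : ℝ) ≤ k)]
  have hk0 : (0 : ℝ) < 1 / (2 * ((k : ℝ) + 1)) := by positivity
  set t : ℝ := 1 - 1 / (2 * ((k : ℝ) + 1)) with ht
  have ht0 : 0 ≤ t := by linarith
  have ht1 : t ≤ 1 := by linarith
  have htx : t ^ x ≤ 2 / 3 := by
    have h1 : t ^ x ≤ t ^ (k + 1) := pow_le_pow_of_le_one ht0 ht1 (by omega)
    refine h1.trans ?_
    -- With ε = 1/(2(k+1)), Bernoulli gives (1+ε)^{k+1} ≥ 3/2, and (1-ε)(1+ε) ≤ 1 turns this into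
    -- t^{k+1} ≤ 2/3.
    have h2 := one_add_mul_le_pow (a := 1 / (2 * ((k : ℝ) + 1))) (by linarith) (k + 1)
    have h3 : 1 + ((k + 1 : ℕ) : ℝ) * (1 / (2 * ((k : ℝ) + 1))) = 3 / 2 := by
      push_cast; field_simp; norm_num
    rw [h3] at h2
    have h4 : t ^ (k + 1) * (1 + 1 / (2 * ((k : ℝ) + 1))) ^ (k + 1) ≤ 1 := by
      rw [← mul_pow]
      refine pow_le_one₀ (by positivity) ?_
      rw [ht]; nlinarith
    have h5 : 0 ≤ t ^ (k + 1) := by positivity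
    nlinarith
  -- Below t the large power gains (2/3)^{2^i - 1} over r^x; above t it is at most 1 and leaves the
  -- tail. By the choice of i, the first part is absorbed into half of the moment.
  have hsplit : mom η (2 ^ i * x) ≤ (2 / 3 : ℝ) ^ (2 ^ i - 1) * mom η x + tail η t := by
    have e : 2 ^ i * x = x * (2 ^ i - 1) + x := by
      have : 2 ^ i = 2 ^ i - 1 + 1 := (Nat.sub_add_cancel Nat.one_le_two_pow).symm
      conv_lhs => rw [this]
      ring
    have htail : tail η t = ∫ r in Ioi (0 : ℝ), (Ioi t).indicator η r := by
      rw [setIntegral_indicator measurableSet_Ioi, inter_eq_right.2 (Ioi_subset_Ioi ht0), tail]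
    rw [htail, mom, mom, ← integral_const_mul, ← integral_add
      ((h.integrableOn_pow _ _).const_mul _)
      (h.integrable.indicator measurableSet_Ioi).integrableOn]
    refine integral_mono (h.integrableOn_pow _ _) (((h.integrableOn_pow _ _).const_mul _).add
      (h.integrable.indicator measurableSet_Ioi).integrableOn) fun r => ?_
    by_cases hr : r ∈ Ico (0 : ℝ) 1
    · have hη := h.nonneg r
      by_cases hrt : t < r
      · simp only [indicator_of_mem (mem_Ioi.2 hrt)]
        have h1 : r ^ (2 ^ i * x) * η r ≤ η r :=
          mul_le_of_le_one_left hη (pow_le_one₀ hr.1 hr.2.le)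
        have h2 : 0 ≤ (2 / 3 : ℝ) ^ (2 ^ i - 1) * (r ^ x * η r) := by
          have := hr.1; positivity
        linarith
      · simp only [indicator_of_notMem (fun h' => hrt (mem_Ioi.1 h')), add_zero]
        rw [← mul_assoc]
        refine mul_le_mul_of_nonneg_right ?_ hη
        rw [e, pow_add, pow_mul]
        refine mul_le_mul_of_nonneg_right ?_ (pow_nonneg hr.1 _)
        exact pow_le_pow_left₀ (pow_nonneg hr.1 _)
          ((pow_le_pow_left₀ hr.1 (not_lt.1 hrt) x).trans htx) _
    · have : (Ioi t).indicator η r = 0 := by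
        by_cases hrt : r ∈ Ioi t <;> simp [hrt, h.eq_zero r hr]
      simp [h.eq_zero r hr, this]
  have h1 := (hiter i).trans (mul_le_mul_of_nonneg_left hsplit (by positivity))
  have h2 := h.mom_nonneg x
  have h3 : 0 ≤ tail η t := integral_nonneg h.nonneg
  have h4 := mul_le_mul_of_nonneg_right hi h2
  rw [mul_assoc] at h4
  nlinarith

/-- For reverse doubling weights, consecutive moments differ substantially. -/
lemma exists_le_mom_sub (m : ℕ) {η : ℝ → ℝ} (h : IsWeight η) {C : ℝ} (hC : 0 ≤ C)
    (hd : ∀ r ∈ Ico (0 : ℝ) 1, tail η r ≤ C * tail η ((1 + r) / 2)) {K L : ℝ} (hK : 1 < K)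
    (hL : 1 < L) (hr : ∀ t ∈ Ioo (0 : ℝ) 1, L * tail η (1 - (1 - t) / K) ≤ tail η t) :
    ∃ c, 0 < c ∧ ∀ k : ℕ, c * (mom η (2 * k + (2 * m + 1)) / ((k : ℝ) + 1)) ≤
      mom η (2 * k + (2 * m + 1)) - mom η (2 * (k + 1) + (2 * m + 1)) := by
  obtain ⟨D, hD, hmom⟩ := exists_mom_le_tail m h hC hd
  have hL' : 0 < 1 - L⁻¹ := sub_pos.2 (inv_lt_one_of_one_lt₀ hL)
  refine ⟨(1 / 2) ^ (2 * m + 2) * (1 / (2 * K)) * (1 - L⁻¹) * D⁻¹, by positivity, fun k => ?_⟩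
  have hk : (1 : ℝ) / (2 * ((k : ℝ) + 1)) ≤ 1 / 2 := by
    rw [div_le_div_iff₀ (by positivity) (by norm_num)]
    linarith [(k.cast_nonneg : (0 : ℝ) ≤ k)]
  have hk0 : (0 : ℝ) < 1 / (2 * ((k : ℝ) + 1)) := by positivity
  have hmk := hmom k
  -- Only the shell t < r ≤ t' is used. There r^{2k+2m+1} is bounded below, 1-r² is at least 1-t' =
  -- 1/(2K(k+1)), and reverse doubling leaves the shell a fixed fraction of the tail at t, which
  -- controls the moment.
  set t : ℝ := 1 - 1 / (2 * ((k : ℝ) + 1)) with ht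
  have ht0 : 0 < t := by linarith
  have ht1 : t < 1 := by linarith
  set t' : ℝ := 1 - (1 - t) / K with ht'
  have htt' : t ≤ t' := by
    have : (1 - t) / K ≤ 1 - t := div_le_self (by linarith) hK.le
    linarith
  have hrev := hr t ⟨ht0, ht1⟩
  have hmass : (1 - L⁻¹) * tail η t ≤ ∫ r in Ioc t t', η r := by
    have h1 : tail η t = (∫ r in Ioc t t', η r) + tail η t' := by
      rw [tail, ← Ioc_union_Ioi_eq_Ioi htt', setIntegral_union Ioc_disjoint_Ioi_same
        measurableSet_Ioi h.integrable.integrableOn h.integrable.integrableOn, tail]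
    have h2 : tail η t' ≤ L⁻¹ * tail η t := by
      rw [inv_mul_eq_div, le_div_iff₀' (by linarith)]
      exact hrev
    linarith
  have htx : (1 / 2 : ℝ) ^ (2 * m + 2) ≤ t ^ (2 * k + (2 * m + 1)) := by
    have h1 : (1 / 2 : ℝ) ≤ t ^ (k + 1) := by
      have h2 := one_add_mul_le_pow (a := -(1 / (2 * ((k : ℝ) + 1)))) (by linarith) (k + 1)
      have h3 : 1 + ((k + 1 : ℕ) : ℝ) * -(1 / (2 * ((k : ℝ) + 1))) = 1 / 2 := by
        push_cast; field_simp; norm_num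
      rw [h3, ← sub_eq_add_neg] at h2
      exact h2
    refine (pow_le_pow_left₀ (by norm_num) h1 _).trans ?_
    rw [← pow_mul]
    refine pow_le_pow_of_le_one ht0.le ht1.le ?_
    nlinarith
  have hdiff : mom η (2 * k + (2 * m + 1)) - mom η (2 * (k + 1) + (2 * m + 1)) =
      ∫ r in Ioi (0 : ℝ), r ^ (2 * k + (2 * m + 1)) * ((1 - r ^ 2) * η r) := by
    simp only [mom]
    rw [← integral_sub (h.integrableOn_pow _ _) (h.integrableOn_pow _ _)]
    congr 1
    funext r
    ring
  have hw : IsWeight (fun r => (1 - r ^ 2) * η r) := by simpa using h.one_sub_sq_pow_mul 1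
  have hlow : (1 / 2 : ℝ) ^ (2 * m + 2) * (1 - t') * ∫ r in Ioc t t', η r ≤
      ∫ r in Ioi (0 : ℝ), r ^ (2 * k + (2 * m + 1)) * ((1 - r ^ 2) * η r) := by
    refine le_trans ?_ (setIntegral_mono_set (hw.integrableOn_pow _ _)
      (Filter.Eventually.of_forall (hw.pow_mul _).nonneg)
      (Filter.Eventually.of_forall fun r (hr : r ∈ Ioc t t') =>
        (ht0.trans hr.1 : r ∈ Ioi (0 : ℝ))))
    rw [← integral_const_mul]
    refine setIntegral_mono_on (h.integrable.integrableOn.const_mul _) (hw.integrableOn_pow _ _)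
      measurableSet_Ioc fun r hr => ?_
    rw [← mul_assoc (r ^ _)]
    have hr0 : 0 < r := ht0.trans hr.1
    have ht'1 : t' ≤ 1 := by
      have : 0 ≤ (1 - t) / K := div_nonneg (by linarith) (by linarith)
      linarith
    have hr1 : r ≤ 1 := hr.2.trans ht'1
    refine mul_le_mul_of_nonneg_right ?_ (h.nonneg r)
    refine mul_le_mul (htx.trans (pow_le_pow_left₀ ht0.le hr.1.le _)) ?_ (by linarith)
      (by positivity)
    nlinarith [hr.2]
  rw [hdiff]
  refine le_trans ?_ hlow
  have h1t : 1 - t' = 1 / (2 * K) * (1 / ((k : ℝ) + 1)) := by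
    rw [ht', ht]; field_simp; ring
  rw [h1t]
  have h6 : D⁻¹ * mom η (2 * k + (2 * m + 1)) ≤ tail η t := by
    rw [inv_mul_eq_div, div_le_iff₀' hD]; exact hmk
  have h7 := (mul_le_mul_of_nonneg_left h6 hL'.le).trans hmass
  have h8 : 0 ≤ (1 / 2 : ℝ) ^ (2 * m + 2) * (1 / (2 * K) * (1 / ((k : ℝ) + 1))) := by positivity
  calc _ = (1 / 2 : ℝ) ^ (2 * m + 2) * (1 / (2 * K) * (1 / ((k : ℝ) + 1))) *
        ((1 - L⁻¹) * (D⁻¹ * mom η (2 * k + (2 * m + 1)))) := by ring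
    _ ≤ _ := mul_le_mul_of_nonneg_left h7 h8

end

/-! ### The L¹ estimate for kernels with symbol coefficients -/

section

variable {m : ℕ} {η : ℝ → ℝ}

lemma summable_add_one_pow_mul_geometric (p : ℕ) {ρ : ℝ} (h0 : 0 ≤ ρ) (h1 : ρ < 1) :
    Summable fun k : ℕ => ((k : ℝ) + 1) ^ p * ρ ^ k := by
  have hρ : ‖ρ‖ < 1 := by rwa [Real.norm_of_nonneg h0]
  refine (((summable_pow_mul_geometric_of_norm_lt_one p hρ).add
    (summable_geometric_of_lt_one h0 h1)).mul_left (2 ^ p)).of_nonneg_of_le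
    (fun k => by positivity) fun k => ?_
  rcases Nat.eq_zero_or_pos k with rfl | hk
  · have h2 : (1 : ℝ) ≤ 2 ^ p := one_le_pow₀ one_le_two
    rcases Nat.eq_zero_or_pos p with rfl | hp
    · norm_num
    · simpa [hp.ne'] using h2
  · have hk1 : (1 : ℝ) ≤ k := by exact_mod_cast hk
    have h2 : ((k : ℝ) + 1) ^ p ≤ 2 ^ p * (k : ℝ) ^ p := by
      rw [← mul_pow]
      exact pow_le_pow_left₀ (by positivity) (by linarith) p
    have h3 : 0 ≤ ρ ^ k := by positivity
    have h4 : 0 ≤ (2 : ℝ) ^ p * ρ ^ k := by positivity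
    nlinarith [mul_le_mul_of_nonneg_right h2 h3]

/-- Halving k costs a factor A < 2^q, hence growth of order q. The constant covers k = 0 and k = 1,
where halving stops. This makes all the kernel series converge on the open disc. -/
lemma IsRegularWeight.exists_inv_mom_le (h : IsRegularWeight m η) : ∃ (B : ℝ) (q : ℕ), 0 ≤ B ∧
    ∀ k : ℕ, (mom η (2 * k + (2 * m + 1)))⁻¹ ≤ B * ((k : ℝ) + 1) ^ q := by
  obtain ⟨A, hA, hd⟩ := h.doubling
  obtain ⟨q, hq⟩ := pow_unbounded_of_one_lt A one_lt_two
  set B := (mom η (2 * 0 + (2 * m + 1)))⁻¹ + (mom η (2 * 1 + (2 * m + 1)))⁻¹ with hB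
  have hi : ∀ k, 0 < (mom η (2 * k + (2 * m + 1)))⁻¹ := fun k => inv_pos.2 (h.pos k)
  have hB0 : 0 ≤ B := (add_pos (hi 0) (hi 1)).le
  have key : ∀ k : ℕ, 1 ≤ k → (mom η (2 * k + (2 * m + 1)))⁻¹ ≤ B * (k : ℝ) ^ q := by
    intro k
    induction k using Nat.strong_induction_on with
    | _ k ih =>
      intro hk
      rcases eq_or_lt_of_le hk with rfl | hk2
      · simpa [hB] using (hi 0).le
      · have h1 := ih (k / 2) (by omega) (by omega)
        have h2 : (mom η (2 * k + (2 * m + 1)))⁻¹ ≤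
            A * (mom η (2 * (k / 2) + (2 * m + 1)))⁻¹ := by
          have h3 := hd (k / 2) k (by omega)
          rw [inv_le_iff_one_le_mul₀ (h.pos k)]
          have h4 := mul_le_mul_of_nonneg_right h3 (hi (k / 2)).le
          rw [mul_inv_cancel₀ (h.pos _).ne'] at h4
          linarith
        have h5 : ((k / 2 : ℕ) : ℝ) ≤ (k : ℝ) / 2 := Nat.cast_div_le
        calc _ ≤ _ := h2
          _ ≤ 2 ^ q * (B * ((k : ℝ) / 2) ^ q) := by
            refine mul_le_mul hq.le (h1.trans ?_) (hi _).le (by positivity)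
            gcongr
          _ = B * (k : ℝ) ^ q := by rw [div_pow]; field_simp
  refine ⟨B, q, hB0, fun k => ?_⟩
  rcases Nat.eq_zero_or_pos k with rfl | hk
  · simpa [hB] using (hi 1).le
  · refine (key k hk).trans ?_
    gcongr
    linarith

lemma IsRegularWeight.summable (h : IsRegularWeight m η) (p : ℕ) {ρ : ℝ} (h0 : 0 ≤ ρ)
    (h1 : ρ < 1) :
    Summable fun k : ℕ => ((k : ℝ) + 1) ^ p / mom η (2 * k + (2 * m + 1)) * ρ ^ k := by
  obtain ⟨B, q, hB, hb⟩ := h.exists_inv_mom_le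
  refine ((summable_add_one_pow_mul_geometric (p + q) h0 h1).mul_left B).of_nonneg_of_le
    (fun k => by have := h.pos k; positivity) fun k => ?_
  rw [div_eq_mul_inv, pow_add]
  calc _ ≤ ((k : ℝ) + 1) ^ p * (B * ((k : ℝ) + 1) ^ q) * ρ ^ k := by
        gcongr
        exact hb k
    _ = _ := by ring

lemma IsWeight.integrable_norm (h : IsWeight η) : Integrable fun w : Cn m => η ‖w‖ := by
  rw [integrable_fun_norm_addHaar (volume : Measure (Cn m)) (f := η), finrank_real_Cn]
  exact h.integrableOn_pow _ _

lemma IsWeight.integrable_ofReal (h : IsWeight η) : Integrable fun w : Cn m => (η ‖w‖ : ℂ) :=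
  h.integrable_norm.ofReal

/-- A function bounded on the ball is integrable against a radial weight. -/
lemma IsWeight.integrable_mul (h : IsWeight η) {f : Cn m → ℂ}
    (hf : AEStronglyMeasurable f (volume.restrict (unitBall (m + 1)))) {C : ℝ}
    (hC : ∀ᵐ w, w ∈ unitBall (m + 1) → ‖f w‖ ≤ C) : Integrable fun w => f w * (η ‖w‖ : ℂ) := by
  have e : (fun w => f w * (η ‖w‖ : ℂ)) =
      fun w => (unitBall (m + 1)).indicator f w * (η ‖w‖ : ℂ) := by
    funext w
    by_cases hw : w ∈ unitBall (m + 1)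
    · rw [indicator_of_mem hw]
    · rw [h.eq_zero_of_one_le _ (by simpa using hw)]; simp
  rw [e]
  refine (h.integrable_norm.const_mul |C|).mono'
    (((aestronglyMeasurable_indicator_iff measurableSet_ball).2 hf).mul
      h.integrable_ofReal.aestronglyMeasurable) ?_
  filter_upwards [hC] with w hw
  rw [norm_mul, Complex.norm_real, Real.norm_of_nonneg (h.nonneg _)]
  refine mul_le_mul_of_nonneg_right ?_ (h.nonneg _)
  by_cases hw' : w ∈ unitBall (m + 1)
  · rw [indicator_of_mem hw']; exact (hw hw').trans (le_abs_self C)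
  · rw [indicator_of_notMem hw']; simp

lemma norm_inner_lt_one {w z : Cn m} (hw : w ∈ unitBall (m + 1)) (hz : ‖z‖ ≤ 1) :
    ‖(inner ℂ w z : ℂ)‖ < 1 := by
  rw [mem_ball_zero_iff] at hw
  refine (norm_inner_le_norm w z).trans_lt ?_
  nlinarith [norm_nonneg w, norm_nonneg z]

/-- The integrand is |F|² with F = (1 - ⟨z, w⟩)^{-(m+1)}. Expanding both factors, orthogonality
leaves the square of a binomial coefficient times `sphereConst`, and one binomial cancels. Bounding
moments by the first and |z|² by ρ sums the series to (1-ρ)^{-(m+1)}, half of the naive exponent. -/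
lemma integral_poisson_le (h : IsWeight η) {ρ : ℝ} (h1 : ρ < 1) {z : Cn m} (hz : ‖z‖ ≤ ρ) :
    ∫ w : Cn m, (‖1 - (inner ℂ w z : ℂ)‖ ^ (2 * (m + 1)))⁻¹ * η ‖w‖ ≤
      sphereMass m * mom η (2 * m + 1) * (1 / (1 - ρ) ^ (m + 1)) := by
  have h0 : 0 ≤ ρ := (norm_nonneg z).trans hz
  have hsymm : ∀ w : Cn m, (inner ℂ z w : ℂ) = conj (inner ℂ w z : ℂ) := fun w =>
    (inner_conj_symm z w).symm
  set f : Cn m → ℂ := fun w => 1 / (1 - (inner ℂ z w : ℂ)) ^ (m + 1) with hf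
  have hnorm : ∀ w ∈ unitBall (m + 1), ‖(inner ℂ z w : ℂ)‖ ≤ ρ := fun w hw => by
    rw [mem_ball_zero_iff] at hw
    refine (norm_inner_le_norm z w).trans ?_
    nlinarith [norm_nonneg w, norm_nonneg z]
  have hs : Summable fun k : ℕ => ‖((k + m).choose m : ℂ)‖ * ‖z‖ ^ k := by
    have := (summable_choose_mul_geometric_of_norm_lt_one m (r := ‖z‖)
      (by rw [norm_norm]; linarith))
    simpa using this
  have hfi : Integrable fun w => f w * (η ‖w‖ : ℂ) := by
    refine h.integrable_mul (C := 1 / (1 - ρ) ^ (m + 1)) ?_ (Filter.Eventually.of_forall ?_)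
    · have hm : Measurable fun w : Cn m => (inner ℂ z w : ℂ) :=
        Continuous.measurable (by fun_prop)
      exact Measurable.aestronglyMeasurable (by fun_prop)
    · intro w hw
      rw [hf, norm_div, norm_one, norm_pow]
      have h2 : 1 - ρ ≤ ‖1 - (inner ℂ z w : ℂ)‖ := by
        have := norm_sub_norm_le (1 : ℂ) (inner ℂ z w)
        rw [norm_one] at this
        linarith [hnorm w hw]
      have : 0 < 1 - ρ := by linarith
      gcongr
  have hmain := hasSum_integral_mul_tsum
    (h := fun k w => ((k + m).choose m : ℂ) * (inner ℂ z w : ℂ) ^ k)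
    (fun k => (isHolHomog_inner_pow z k).const_mul _) (f := f)
    (fun w hw => hasSum_choose_mul_geometric_of_norm_lt_one m ((hnorm w hw).trans_lt h1))
    h.eq_zero_of_one_le hfi hs
  have e1 : ∀ w : Cn m, f w * (∑' k : ℕ, ((k + m).choose m : ℂ) * (inner ℂ w z : ℂ) ^ k) *
      (η ‖w‖ : ℂ) = (((‖1 - (inner ℂ w z : ℂ)‖ ^ (2 * (m + 1)))⁻¹ * η ‖w‖ : ℝ) : ℂ) := by
    intro w
    by_cases hw : w ∈ unitBall (m + 1)
    · rw [tsum_choose_mul_geometric_of_norm_lt_one m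
        (norm_inner_lt_one hw (hz.trans h1.le))]
      have e2 : (1 - (inner ℂ z w : ℂ)) = conj (1 - (inner ℂ w z : ℂ)) := by
        rw [hsymm, map_sub, map_one]
      simp only [hf]
      rw [e2, one_div, one_div, ← mul_inv, ← mul_pow, Complex.conj_mul', ← pow_mul]
      push_cast
      rfl
    · rw [h.eq_zero_of_one_le _ (by simpa using hw)]; simp
  simp only [e1] at hmain
  rw [integral_complex_ofReal] at hmain
  have hb : ∀ k : ℕ, ‖((k + m).choose m : ℂ) * (((sphereConst m k *
      mom η (2 * k + (2 * m + 1)) : ℝ) : ℂ) *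
      (((k + m).choose m : ℂ) * (inner ℂ z z : ℂ) ^ k))‖ ≤
      sphereMass m * mom η (2 * m + 1) * (((k + m).choose m : ℝ) * ρ ^ k) := by
    intro k
    have hc : (0 : ℝ) < ((k + m).choose m : ℝ) := by exact_mod_cast Nat.choose_pos (by omega)
    have hm0 := h.mom_nonneg (2 * k + (2 * m + 1))
    rw [norm_mul, norm_mul, norm_mul, norm_pow, Complex.norm_real, Complex.norm_natCast,
      Real.norm_of_nonneg (mul_nonneg (sphereConst_pos m k).le hm0)]
    have h3 : ‖(inner ℂ z z : ℂ)‖ ≤ ρ :=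
      (norm_inner_le_norm z z).trans (by nlinarith [norm_nonneg z])
    have h4 := h.mom_anti (i := 2 * m + 1) (j := 2 * k + (2 * m + 1)) (by omega)
    have h5 : ((k + m).choose m : ℝ) * sphereConst m k = sphereMass m := by
      rw [sphereConst]; field_simp
    have := sphereMass_pos m
    calc _ = (((k + m).choose m : ℝ) * sphereConst m k) * mom η (2 * k + (2 * m + 1)) *
          (((k + m).choose m : ℝ) * ‖(inner ℂ z z : ℂ)‖ ^ k) := by ring
      _ ≤ _ := by
        have := h.mom_nonneg (2 * m + 1)
        rw [h5]
        gcongr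
  have hsum := (hasSum_choose_mul_geometric_of_norm_lt_one m (r := ρ)
    (by rwa [Real.norm_of_nonneg h0])).mul_left (sphereMass m * mom η (2 * m + 1))
  have hfin := tsum_of_norm_bounded hsum hb
  rw [hmain.tsum_eq, Complex.norm_real] at hfin
  exact (le_abs_self _).trans hfin

/-- The `L¹` estimate for power series in `⟨z, w⟩` with symbol coefficients. -/
theorem lintegral_norm_tsum_le (h : IsRegularWeight m η) {a : ℕ → ℝ}
    (ha : IsSymbol (2 * (m + 1))
      (fun k : ℕ => ((k : ℝ) + 1) ^ (m + 1) / mom η (2 * k + (2 * m + 1))) a) :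
    ∃ C, 0 ≤ C ∧ ∀ z ∈ unitBall (m + 1),
      ∫⁻ w : Cn m, ENNReal.ofReal (‖∑' k, (a k : ℂ) * (inner ℂ w z : ℂ) ^ k‖ * η ‖w‖) ≤
        ENNReal.ofReal (C / (1 - ‖z‖)) := by
  obtain ⟨A, hA, hd⟩ := h.doubling
  set W : ℕ → ℝ := fun k => ((k : ℝ) + 1) ^ (m + 1) / mom η (2 * k + (2 * m + 1)) with hW
  have hW0 : ∀ k, 0 ≤ W k := fun k => by have := h.pos k; positivity
  obtain ⟨C, hC, hpt⟩ := norm_tsum_le_of_isSymbol (2 * (m + 1)) hW0 ha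
    (A := 2 ^ (m + 1) * A) (by positivity) (fun k K hkK hK => by
      have h1 := hd k K (by omega)
      have h2 : ((K : ℝ) + 1) ^ (m + 1) ≤ 2 ^ (m + 1) * ((k : ℝ) + 1) ^ (m + 1) := by
        rw [← mul_pow]
        refine pow_le_pow_left₀ (by positivity) ?_ _
        have : (K : ℝ) ≤ 2 * k := by exact_mod_cast hK
        linarith
      have := h.pos k
      have := h.pos K
      simp only [hW]
      rw [← mul_div_assoc, div_le_div_iff₀ (by positivity) (by positivity)]
      calc _ ≤ 2 ^ (m + 1) * ((k : ℝ) + 1) ^ (m + 1) *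
            (A * mom η (2 * K + (2 * m + 1))) := by gcongr
        _ = _ := by ring)
  refine ⟨C * (A * sphereMass m), by have := sphereMass_pos m; positivity, fun z hz => ?_⟩
  have hz1 : ‖z‖ < 1 := by simpa using hz
  -- Chosen so that 1 - ρ_k = 1/(k+1): at scale 1/(k+1), 1/(k+1) + |1-l| dominates |1 - ρ_k l|, and
  -- the latter has an explicit integral.
  set ρ : ℕ → ℝ := fun k => k / ((k : ℝ) + 1) with hρ
  have hρ0 : ∀ k, 0 ≤ ρ k := fun k => by positivity
  have hρ1 : ∀ k, 1 - ρ k = 1 / ((k : ℝ) + 1) := fun k => by simp only [hρ]; field_simp; ring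
  have hρlt : ∀ k, ρ k < 1 := fun k => by
    have : (0 : ℝ) < 1 / ((k : ℝ) + 1) := by positivity
    linarith [hρ1 k]
  set G : ℕ → Cn m → ℝ := fun k w => W k * ‖z‖ ^ k / ((k : ℝ) + 1) ^ (2 * (m + 1)) *
    ((‖1 - (inner ℂ w ((ρ k : ℂ) • z) : ℂ)‖ ^ (2 * (m + 1)))⁻¹ * (‖w‖ ^ k * η ‖w‖)) with hG
  have hG0 : ∀ k w, 0 ≤ G k w := fun k w => by
    have := hW0 k; have := h.nonneg ‖w‖; positivity
  have hρz : ∀ k, ‖(ρ k : ℂ) • z‖ ≤ ρ k := fun k => by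
    rw [norm_smul, Complex.norm_real, Real.norm_of_nonneg (hρ0 k)]
    exact mul_le_of_le_one_right (hρ0 k) hz1.le
  have hGi : ∀ k, Integrable (G k) := fun k => by
    refine Integrable.const_mul ?_ _
    have hm : Measurable fun w : Cn m => (inner ℂ w ((ρ k : ℂ) • z) : ℂ) :=
      Continuous.measurable (by fun_prop)
    have := (h.pow_mul k).integrable_mul (m := m)
      (f := fun w => (((‖1 - (inner ℂ w ((ρ k : ℂ) • z) : ℂ)‖ ^ (2 * (m + 1)))⁻¹ : ℝ) : ℂ))
      (C := ((1 - ρ k) ^ (2 * (m + 1)))⁻¹) (Measurable.aestronglyMeasurable (by fun_prop))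
      (Filter.Eventually.of_forall fun w hw => by
        rw [Complex.norm_real, Real.norm_of_nonneg (by positivity)]
        have h2 : 1 - ρ k ≤ ‖1 - (inner ℂ w ((ρ k : ℂ) • z) : ℂ)‖ := by
          have h3 := norm_sub_norm_le (1 : ℂ) (inner ℂ w ((ρ k : ℂ) • z))
          rw [norm_one] at h3
          have h4 := norm_inner_le_norm (𝕜 := ℂ) w ((ρ k : ℂ) • z)
          rw [mem_ball_zero_iff] at hw
          nlinarith [hρz k, norm_nonneg w, norm_nonneg ((ρ k : ℂ) • z)]
        have : 0 < 1 - ρ k := sub_pos.2 (hρlt k)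
        gcongr)
    have h' := this.re
    refine h'.congr (Filter.Eventually.of_forall fun w => ?_)
    simp only [← Complex.ofReal_mul]
    rfl
  have hGint : ∀ k, ∫ w, G k w ≤ A * sphereMass m * ‖z‖ ^ k := fun k => by
    simp only [hG]
    rw [integral_const_mul]
    have h1 := integral_poisson_le (m := m) (h.pow_mul k) (hρlt k) (hρz k)
    rw [mom_pow_mul, hρ1] at h1
    -- The factor |w|^k kept in `G` supplies the moment that cancels the denominator of W_k, up to
    -- one doubling; passing to k/2 makes the index even.
    have h2 : mom η (k + (2 * m + 1)) ≤ A * mom η (2 * k + (2 * m + 1)) :=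
      (h.mom_anti (by omega)).trans (hd (k / 2) k (by omega))
    have hpos := h.pos k
    have hsm := sphereMass_pos m
    have hWk := hW0 k
    calc _ ≤ W k * ‖z‖ ^ k / ((k : ℝ) + 1) ^ (2 * (m + 1)) *
          (sphereMass m * (A * mom η (2 * k + (2 * m + 1))) *
            (1 / (1 / ((k : ℝ) + 1)) ^ (m + 1))) := by
          refine mul_le_mul_of_nonneg_left (h1.trans ?_) (by positivity)
          gcongr
      _ = _ := by
          simp only [hW]
          generalize mom η (2 * k + (2 * m + 1)) = u at hpos
          rw [one_div_pow, one_div_one_div]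
          field_simp
          ring
  have hle : ∀ w : Cn m, ENNReal.ofReal (‖∑' k, (a k : ℂ) * (inner ℂ w z : ℂ) ^ k‖ * η ‖w‖) ≤
      ∑' k, ENNReal.ofReal (C * G k w) := by
    intro w
    by_cases hw : w ∈ unitBall (m + 1)
    · set l : ℂ := inner ℂ w z with hl
      have hl1 : ‖l‖ < 1 := norm_inner_lt_one hw hz1.le
      have hlwz : ‖l‖ ≤ ‖w‖ * ‖z‖ := norm_inner_le_norm w z
      have hsl : Summable fun k => W k * ‖l‖ ^ k := h.summable (m + 1) (norm_nonneg l) hl1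
      have hterm : ∀ k : ℕ, W k * ‖l‖ ^ k / (1 + ((k : ℝ) + 1) * ‖1 - l‖) ^ (2 * (m + 1)) *
          η ‖w‖ ≤ G k w := by
        intro k
        have hin : (inner ℂ w ((ρ k : ℂ) • z) : ℂ) = (ρ k : ℂ) * l := inner_smul_right _ _ _
        have hbd : ((k : ℝ) + 1) * ‖1 - (ρ k : ℂ) * l‖ ≤ 1 + ((k : ℝ) + 1) * ‖1 - l‖ := by
          have e : 1 - (ρ k : ℂ) * l = (1 - l) + ((1 - ρ k : ℝ) : ℂ) * l := by
            push_cast; ring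
          have h2 : ‖((1 - ρ k : ℝ) : ℂ) * l‖ ≤ 1 / ((k : ℝ) + 1) := by
            rw [norm_mul, Complex.norm_real, hρ1, Real.norm_of_nonneg (by positivity)]
            exact mul_le_of_le_one_right (by positivity) hl1.le
          have h3 := (norm_add_le (1 - l) (((1 - ρ k : ℝ) : ℂ) * l)).trans
            (add_le_add_right h2 _)
          rw [← e] at h3
          calc _ ≤ ((k : ℝ) + 1) * (‖1 - l‖ + 1 / ((k : ℝ) + 1)) := by gcongr
            _ = _ := by field_simp; ring
        have hpos : 0 < ‖1 - (ρ k : ℂ) * l‖ := by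
          have h3 := norm_sub_norm_le (1 : ℂ) ((ρ k : ℂ) * l)
          rw [norm_one, norm_mul, Complex.norm_real, Real.norm_of_nonneg (hρ0 k)] at h3
          nlinarith [hρlt k, hρ0 k, norm_nonneg l]
        have hηw := h.nonneg ‖w‖
        have hWk := hW0 k
        simp only [hG]
        rw [hin]
        calc _ ≤ W k * (‖w‖ * ‖z‖) ^ k /
              (((k : ℝ) + 1) * ‖1 - (ρ k : ℂ) * l‖) ^ (2 * (m + 1)) * η ‖w‖ := by gcongr
          _ = _ := by rw [mul_pow, mul_pow]; field_simp
      -- For fixed w the crude bound |1 - ρ_k l| ≥ 1 - |z| suffices; uniformity in w plays no role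
      -- here.
      have hGs : Summable fun k => G k w := by
        refine Summable.of_nonneg_of_le (hG0 · w) (fun k => ?_)
          ((h.summable (m + 1) (norm_nonneg z) hz1).mul_right
            (((1 - ‖z‖) ^ (2 * (m + 1)))⁻¹ * η ‖w‖))
        have hlz : ‖l‖ ≤ ‖z‖ := by
          rw [mem_ball_zero_iff] at hw
          nlinarith [norm_nonneg z]
        have h2 : 1 - ‖z‖ ≤ ‖1 - (inner ℂ w ((ρ k : ℂ) • z) : ℂ)‖ := by
          have h3 := norm_sub_norm_le (1 : ℂ) (inner ℂ w ((ρ k : ℂ) • z))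
          rw [inner_smul_right, norm_one, norm_mul, Complex.norm_real,
            Real.norm_of_nonneg (hρ0 k)] at h3
          rw [inner_smul_right]
          nlinarith [hρlt k, hρ0 k, norm_nonneg l]
        have h4 : 0 < 1 - ‖z‖ := by linarith
        have hWk := hW0 k
        have hηw := h.nonneg ‖w‖
        have hk1 : (1 : ℝ) ≤ ((k : ℝ) + 1) ^ (2 * (m + 1)) :=
          one_le_pow₀ (by linarith [(k.cast_nonneg : (0 : ℝ) ≤ k)])
        have hw1 : ‖w‖ ^ k * η ‖w‖ ≤ η ‖w‖ := by
          rw [mem_ball_zero_iff] at hw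
          exact mul_le_of_le_one_left hηw (pow_le_one₀ (norm_nonneg w) hw.le)
        simp only [hG]
        refine mul_le_mul (div_le_self (by positivity) hk1) ?_ (by positivity) (by positivity)
        gcongr
      rw [← ENNReal.ofReal_tsum_of_nonneg (fun k => mul_nonneg hC (hG0 k w)) (hGs.mul_left C)]
      refine ENNReal.ofReal_le_ofReal ?_
      rw [tsum_mul_left]
      refine (mul_le_mul_of_nonneg_right (hpt l hl1 hsl) (h.nonneg _)).trans ?_
      rw [mul_assoc, ← tsum_mul_right]
      refine mul_le_mul_of_nonneg_left ?_ hC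
      refine Summable.tsum_le_tsum hterm (Summable.of_nonneg_of_le (fun k => ?_) hterm hGs) hGs
      have := hW0 k
      have := h.nonneg ‖w‖
      positivity
    · rw [h.eq_zero_of_one_le _ (by simpa using hw)]; simp
  calc _ ≤ ∫⁻ w : Cn m, ∑' k, ENNReal.ofReal (C * G k w) := lintegral_mono hle
    _ = ∑' k, ∫⁻ w : Cn m, ENNReal.ofReal (C * G k w) :=
        lintegral_tsum fun k => ((hGi k).const_mul C).aemeasurable.ennreal_ofReal
    _ = ∑' k, ENNReal.ofReal (∫ w, C * G k w) := by
        congr 1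
        funext k
        rw [ofReal_integral_eq_lintegral_ofReal ((hGi k).const_mul C)
          (Filter.Eventually.of_forall fun w => mul_nonneg hC (hG0 k w))]
    _ ≤ ∑' k, ENNReal.ofReal (C * (A * sphereMass m) * ‖z‖ ^ k) := by
        refine ENNReal.tsum_le_tsum fun k => ENNReal.ofReal_le_ofReal ?_
        rw [integral_const_mul, mul_assoc]
        exact mul_le_mul_of_nonneg_left (hGint k) hC
    _ = _ := by
        have := sphereMass_pos m
        rw [← ENNReal.ofReal_tsum_of_nonneg (fun k => by positivity)
          ((summable_geometric_of_lt_one (norm_nonneg z) hz1).mul_left _), tsum_mul_left,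
          tsum_geometric_of_lt_one (norm_nonneg z) hz1, div_eq_mul_inv]

end

/-! ### The Bergman kernel as a power series in the inner product -/

section

variable {m : ℕ} {ω η : ℝ → ℝ}

/-- The extension by zero of a radial weight. -/
noncomputable def zeroExt (ω : ℝ → ℝ) : ℝ → ℝ := (Ico (0 : ℝ) 1).indicator ω

lemma zeroExt_of_mem {r : ℝ} (hr : r ∈ Ico (0 : ℝ) 1) : zeroExt ω r = ω r :=
  indicator_of_mem hr ω

lemma zeroExt_norm_of_mem {w : Cn m} (hw : w ∈ unitBall (m + 1)) : zeroExt ω ‖w‖ = ω ‖w‖ :=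
  zeroExt_of_mem ⟨norm_nonneg w, by simpa using hw⟩

lemma isWeight_zeroExt (hω : IsRadialWeight ω) : IsWeight (zeroExt ω) where
  nonneg r := indicator_nonneg (fun _ hr => (hω.pos _ hr).le) r
  eq_zero _ hr := indicator_of_notMem hr ω
  integrable := (integrable_indicator_iff measurableSet_Ico).2 hω.integrableOn

lemma tail_zeroExt {r : ℝ} (hr : 0 ≤ r) : tail (zeroExt ω) r = weightTail ω r := by
  rw [tail, zeroExt, setIntegral_indicator measurableSet_Ico, weightTail]
  congr 2
  ext t
  simp only [mem_inter_iff, mem_Ioi, mem_Ico, mem_Ioo]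
  constructor
  · rintro ⟨h1, h2, h3⟩; exact ⟨h1, h3⟩
  · rintro ⟨h1, h2⟩; exact ⟨h1, hr.trans h1.le, h2⟩

lemma exists_tail_le (hd : IsDoubling ω) : ∃ C, 0 ≤ C ∧ ∀ r ∈ Ico (0 : ℝ) 1,
    tail (zeroExt ω) r ≤ C * tail (zeroExt ω) ((1 + r) / 2) := by
  obtain ⟨C, hC, h⟩ := hd
  refine ⟨C, hC.le, fun r hr => ?_⟩
  rw [tail_zeroExt hr.1, tail_zeroExt (by linarith [hr.1])]
  exact (h r hr).le

lemma isRegularWeight_zeroExt (m : ℕ) (hω : IsRadialWeight ω) (hd : IsDoubling ω) :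
    IsRegularWeight m (zeroExt ω) := by
  obtain ⟨C, hC, h⟩ := exists_tail_le hd
  refine isRegularWeight_of_tail_le m (isWeight_zeroExt hω) (fun r hr => ?_) hC h
  rw [zeroExt_of_mem ⟨hr.1.le, hr.2⟩]
  exact hω.pos r ⟨hr.1.le, hr.2⟩

/-- The volume of the unit ball. -/
noncomputable def ballVol (m : ℕ) : ℝ := (volume : Measure (Cn m)).real (ball 0 1)

lemma ballVol_pos (m : ℕ) : 0 < ballVol m := volume_real_ball_pos m

lemma volume_ball_inv_ne_top (m : ℕ) : (volume (unitBall (m + 1)))⁻¹ ≠ ∞ :=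
  ENNReal.inv_ne_top.2 (measure_ball_pos _ _ one_pos).ne'

lemma volume_ball_inv_ne_zero (m : ℕ) : (volume (unitBall (m + 1)))⁻¹ ≠ 0 :=
  ENNReal.inv_ne_zero.2 measure_ball_lt_top.ne

lemma ae_ballVolume_iff {p : Cn m → Prop} :
    (∀ᵐ w ∂ballVolume (m + 1), p w) ↔ ∀ᵐ w, w ∈ unitBall (m + 1) → p w := by
  rw [ballVolume, Measure.ae_ennreal_smul_measure_iff (volume_ball_inv_ne_zero m),
    ae_restrict_iff' measurableSet_ball]

lemma aestronglyMeasurable_ballVolume_iff {f : Cn m → ℂ} :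
    AEStronglyMeasurable f (ballVolume (m + 1)) ↔
      AEStronglyMeasurable f (volume.restrict (unitBall (m + 1))) := by
  refine ⟨fun h => h.mono_ac ?_, fun h => h.smul_measure _⟩
  exact Measure.absolutelyContinuous_smul (volume_ball_inv_ne_zero m)

lemma aemeasurable_weight (hω : IsRadialWeight ω) :
    AEMeasurable (fun w : Cn m => ω ‖w‖) (ballVolume (m + 1)) := by
  refine AEMeasurable.smul_measure (AEMeasurable.congr
    ((isWeight_zeroExt hω).integrable_norm (m := m)).aemeasurable.restrict ?_) _
  filter_upwards [ae_restrict_mem measurableSet_ball] with w hw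
  exact zeroExt_norm_of_mem hw

lemma weightedVolume_ac (m : ℕ) (ω : ℝ → ℝ) :
    weightedVolume (m + 1) ω ≪ volume.restrict (unitBall (m + 1)) :=
  (withDensity_absolutelyContinuous _ _).trans (Measure.smul_absolutelyContinuous)

lemma ae_weightedVolume_iff (hω : IsRadialWeight ω) {p : Cn m → Prop} :
    (∀ᵐ w ∂weightedVolume (m + 1) ω, p w) ↔ ∀ᵐ w, w ∈ unitBall (m + 1) → p w := by
  rw [weightedVolume, ae_withDensity_iff' (aemeasurable_weight hω).ennreal_ofReal,
    ae_ballVolume_iff]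
  refine Filter.eventually_congr (Filter.Eventually.of_forall fun w => ?_)
  refine forall_congr' fun hw => ?_
  have : ENNReal.ofReal (ω ‖w‖) ≠ 0 :=
    (ENNReal.ofReal_pos.2 (hω.pos _ ⟨norm_nonneg w, by simpa using hw⟩)).ne'
  simp [this]

lemma integral_weightedVolume (hω : IsRadialWeight ω) (F : Cn m → ℂ) :
    ∫ w, F w ∂weightedVolume (m + 1) ω =
      (ballVol m : ℂ)⁻¹ * ∫ w, F w * (zeroExt ω ‖w‖ : ℂ) := by
  rw [weightedVolume, integral_withDensity_eq_integral_toReal_smul₀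
    (aemeasurable_weight hω).ennreal_ofReal (by simp), ballVolume, integral_smul_measure,
    ← integral_indicator measurableSet_ball, ENNReal.toReal_inv, Complex.real_smul,
    Complex.ofReal_inv]
  congr 2
  funext w
  by_cases hw : w ∈ unitBall (m + 1)
  · rw [indicator_of_mem hw, zeroExt_norm_of_mem hw, Complex.real_smul, mul_comm,
      ENNReal.toReal_ofReal (hω.pos _ ⟨norm_nonneg w, by simpa using hw⟩).le]
  · rw [indicator_of_notMem hw, (isWeight_zeroExt hω).eq_zero_of_one_le _ (by simpa using hw)]
    simp

lemma integrable_weightedVolume_iff (hω : IsRadialWeight ω) {F : Cn m → ℂ} :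
    Integrable F (weightedVolume (m + 1) ω) ↔
      Integrable fun w => F w * (zeroExt ω ‖w‖ : ℂ) := by
  rw [weightedVolume, integrable_withDensity_iff_integrable_smul₀'
    (aemeasurable_weight hω).ennreal_ofReal (by simp), ballVolume,
    integrable_smul_measure (volume_ball_inv_ne_zero m) (volume_ball_inv_ne_top m),
    ← IntegrableOn, ← integrable_indicator_iff measurableSet_ball]
  refine integrable_congr (Filter.Eventually.of_forall fun w => ?_)
  beta_reduce
  by_cases hw : w ∈ unitBall (m + 1)
  · rw [indicator_of_mem hw, zeroExt_norm_of_mem hw, Complex.real_smul, mul_comm,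
      ENNReal.toReal_ofReal (hω.pos _ ⟨norm_nonneg w, by simpa using hw⟩).le]
  · rw [indicator_of_notMem hw, (isWeight_zeroExt hω).eq_zero_of_one_le _ (by simpa using hw)]
    simp

lemma isFiniteMeasure_weightedVolume (m : ℕ) (hω : IsRadialWeight ω) :
    IsFiniteMeasure (weightedVolume (m + 1) ω) := by
  have h : Integrable (fun _ : Cn m => (1 : ℂ)) (weightedVolume (m + 1) ω) := by
    rw [integrable_weightedVolume_iff hω]
    simpa using (isWeight_zeroExt hω).integrable_ofReal (m := m)
  exact (integrable_const_iff_isFiniteMeasure one_ne_zero).1 h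

/-- The sum of a power series. -/
noncomputable def powerSum (a : ℕ → ℂ) (l : ℂ) : ℂ := ∑' k, a k * l ^ k

section powerSum

variable {a : ℕ → ℂ}

lemma powerSum_norm_le {ρ : ℝ} (hs : Summable fun k => ‖a k‖ * ρ ^ k) {l : ℂ} (hl : ‖l‖ ≤ ρ) :
    ‖powerSum a l‖ ≤ ∑' k, ‖a k‖ * ρ ^ k := by
  refine tsum_of_norm_bounded hs.hasSum fun k => ?_
  rw [norm_mul, norm_pow]
  gcongr

lemma powerSum_aux (ha : ∀ ρ : ℝ, 0 ≤ ρ → ρ < 1 → Summable fun k => ‖a k‖ * ρ ^ k) {l : ℂ}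
    (hl : ‖l‖ < 1) : DifferentiableAt ℂ (powerSum a) l ∧
      l * deriv (powerSum a) l = powerSum (fun k => k * a k) l := by
  set ρ := (1 + ‖l‖) / 2 with hρ
  have hρ0 : 0 ≤ ρ := by positivity
  have hρ1 : ρ < 1 := by linarith
  have hlρ : l ∈ ball (0 : ℂ) ρ := by rw [mem_ball_zero_iff]; linarith
  have hd : ∀ k : ℕ, DifferentiableOn ℂ (fun l => a k * l ^ k) (ball 0 ρ) := fun k => by fun_prop
  have hb : ∀ (k : ℕ), ∀ l ∈ ball (0 : ℂ) ρ, ‖a k * l ^ k‖ ≤ ‖a k‖ * ρ ^ k := fun k l hl => by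
    rw [mem_ball_zero_iff] at hl
    rw [norm_mul, norm_pow]
    gcongr
  refine ⟨(Complex.differentiableOn_tsum_of_summable_norm (ha ρ hρ0 hρ1) hd isOpen_ball
    hb).differentiableAt (isOpen_ball.mem_nhds hlρ), ?_⟩
  have h1 := (Complex.hasSum_deriv_of_summable_norm (ha ρ hρ0 hρ1) hd isOpen_ball hb
    hlρ).mul_left l
  refine h1.tsum_eq.symm.trans (tsum_congr fun k => ?_)
  rw [deriv_const_mul _ (by fun_prop), deriv_pow_field]
  rcases Nat.eq_zero_or_pos k with rfl | hk
  · simp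
  · obtain ⟨j, rfl⟩ : ∃ j, k = j + 1 := ⟨k - 1, by omega⟩
    rw [Nat.add_sub_cancel]; ring

end powerSum

/-- The Taylor coefficients of the Bergman kernel. -/
noncomputable def kernelCoeff (m : ℕ) (η : ℝ → ℝ) (k : ℕ) : ℝ :=
  ballVol m / (sphereConst m k * mom η (2 * k + (2 * m + 1)))

lemma kernelCoeff_eq (m : ℕ) (η : ℝ → ℝ) : kernelCoeff m η = fun k : ℕ =>
    ((k + m).choose m : ℝ) * (mom η (2 * k + (2 * m + 1)))⁻¹ * (ballVol m / sphereMass m) := by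
  funext k
  rw [kernelCoeff, sphereConst]
  have := (sphereMass_pos m).ne'
  have : ((k + m).choose m : ℝ) ≠ 0 := by exact_mod_cast (Nat.choose_pos (by omega)).ne'
  field_simp

lemma IsRegularWeight.kernelCoeff_mul (h : IsRegularWeight m η) (k : ℕ) :
    kernelCoeff m η k * (sphereConst m k * mom η (2 * k + (2 * m + 1))) = ballVol m :=
  div_mul_cancel₀ _ (mul_pos (sphereConst_pos m k) (h.pos k)).ne'

lemma IsRegularWeight.isSymbol_kernelCoeff (h : IsRegularWeight m η) (J : ℕ) :
    IsSymbol J (fun k : ℕ => ((k : ℝ) + 1) ^ m / mom η (2 * k + (2 * m + 1)))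
      (kernelCoeff m η) := by
  rw [kernelCoeff_eq]
  have hi : ∀ k : ℕ, 0 ≤ (mom η (2 * k + (2 * m + 1)))⁻¹ := fun k => (inv_pos.2 (h.pos k)).le
  refine (((IsSymbol.choose_add m).mul (fun k => by positivity) hi (h.isSymbol_mom_inv J)).mul
    (fun k => mul_nonneg (by positivity) (hi k)) (fun _ => zero_le_one)
    (IsSymbol.const _)).mono zero_le_one fun k => ?_
  rw [mul_one, one_mul, div_eq_mul_inv]

lemma IsRegularWeight.isSymbol_mul_kernelCoeff (h : IsRegularWeight m η) (J : ℕ) :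
    IsSymbol J (fun k : ℕ => ((k : ℝ) + 1) ^ (m + 1) / mom η (2 * k + (2 * m + 1)))
      (fun k => k * kernelCoeff m η k) := by
  have h1 := (IsSymbol.natCast_add (J := J) 0).mul (fun k => by positivity)
    (fun k => by have := h.pos k; positivity) (h.isSymbol_kernelCoeff J)
  simp only [add_zero] at h1
  exact h1.mono zero_le_one fun k => le_of_eq (by ring)

lemma IsRegularWeight.summable_of_isSymbol (h : IsRegularWeight m η) {J p : ℕ} {a : ℕ → ℝ}
    (ha : IsSymbol J (fun k : ℕ => ((k : ℝ) + 1) ^ p / mom η (2 * k + (2 * m + 1))) a)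
    (ρ : ℝ) (h0 : 0 ≤ ρ) (h1 : ρ < 1) : Summable fun k => ‖(a k : ℂ)‖ * ρ ^ k := by
  obtain ⟨C, hC, hb⟩ := ha.exists_bound
  refine ((h.summable p h0 h1).mul_left C).of_nonneg_of_le (fun k => by positivity) fun k => ?_
  rw [Complex.norm_real, Real.norm_eq_abs, ← mul_assoc]
  exact mul_le_mul_of_nonneg_right (hb k) (by positivity)

/-- The Bergman kernel as a function of the inner product. -/
noncomputable def kernelSum (m : ℕ) (η : ℝ → ℝ) : ℂ → ℂ :=
  powerSum fun k => (kernelCoeff m η k : ℂ)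

lemma conj_kernelSum (m : ℕ) (η : ℝ → ℝ) (z w : Cn m) :
    conj (kernelSum m η (inner ℂ z w)) = kernelSum m η (inner ℂ w z) := by
  rw [kernelSum, powerSum, powerSum, Complex.conj_tsum]
  refine tsum_congr fun k => ?_
  rw [map_mul, map_pow, Complex.conj_ofReal, inner_conj_symm]

lemma IsRegularWeight.summable_kernelCoeff (h : IsRegularWeight m η) (ρ : ℝ) (h0 : 0 ≤ ρ)
    (h1 : ρ < 1) : Summable fun k => ‖(kernelCoeff m η k : ℂ)‖ * ρ ^ k :=
  h.summable_of_isSymbol (h.isSymbol_kernelCoeff 0) ρ h0 h1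

lemma IsRegularWeight.differentiableAt_kernelSum (h : IsRegularWeight m η) {l : ℂ}
    (hl : ‖l‖ < 1) : DifferentiableAt ℂ (kernelSum m η) l :=
  (powerSum_aux h.summable_kernelCoeff hl).1

lemma IsRegularWeight.differentiableOn_kernelSum_inner (h : IsRegularWeight m η) {z : Cn m}
    (hz : ‖z‖ ≤ 1) :
    DifferentiableOn ℂ (fun w => kernelSum m η (inner ℂ z w)) (unitBall (m + 1)) := by
  intro w hw
  have h1 : ‖(inner ℂ z w : ℂ)‖ < 1 := by
    rw [norm_inner_symm]; exact norm_inner_lt_one hw hz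
  exact ((h.differentiableAt_kernelSum h1).comp w
    (f := fun w => (inner ℂ z w : ℂ)) (innerSL ℂ z).differentiableAt).differentiableWithinAt

lemma IsRegularWeight.continuousOn_kernelSum_inner (h : IsRegularWeight m η) {z : Cn m}
    (hz : ‖z‖ ≤ 1) :
    ContinuousOn (fun w => kernelSum m η (inner ℂ w z)) (unitBall (m + 1)) := by
  refine ((Complex.continuous_conj.comp_continuousOn
    (h.differentiableOn_kernelSum_inner hz).continuousOn)).congr fun w _ => ?_
  exact (conj_kernelSum m η z w).symm

lemma IsRegularWeight.exists_kernelSum_bound (h : IsRegularWeight m η) {ρ : ℝ} (h0 : 0 ≤ ρ)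
    (h1 : ρ < 1) : ∃ D, ∀ z : Cn m, ‖z‖ ≤ ρ → ∀ w ∈ unitBall (m + 1),
      ‖kernelSum m η (inner ℂ w z)‖ ≤ D := by
  refine ⟨_, fun z hz w hw => powerSum_norm_le (h.summable_kernelCoeff ρ h0 h1) ?_⟩
  rw [mem_ball_zero_iff] at hw
  refine (norm_inner_le_norm w z).trans ?_
  nlinarith [norm_nonneg w, norm_nonneg z]

/-- For fixed z the series is bounded on the ball, hence in A². The coefficients are chosen so that
the pairing multiplies every homogeneous component by `ballVol m`, and the normalization of dV
removes this factor. -/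
lemma isBergmanKernel_kernelSum (hω : IsRadialWeight ω) (hd : IsDoubling ω) {z : Cn m}
    (hz : z ∈ unitBall (m + 1)) :
    IsBergmanKernel (m + 1) ω z fun w => kernelSum m (zeroExt ω) (inner ℂ z w) := by
  have h := isRegularWeight_zeroExt m hω hd
  have hz1 : ‖z‖ < 1 := by simpa using hz
  have := isFiniteMeasure_weightedVolume m hω
  have hdiff := h.differentiableOn_kernelSum_inner hz1.le
  obtain ⟨D, hD⟩ := h.exists_kernelSum_bound (norm_nonneg z) hz1
  refine ⟨⟨hdiff, ?_⟩, fun f hf => ?_⟩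
  · refine MemLp.of_bound ?_ D ?_
    · exact (hdiff.continuousOn.aestronglyMeasurable measurableSet_ball).mono_ac
        (weightedVolume_ac m ω)
    · rw [ae_weightedVolume_iff hω]
      refine Filter.Eventually.of_forall fun w hw => ?_
      rw [← Complex.norm_conj, conj_kernelSum]
      exact hD z le_rfl w hw
  · simp only [conj_kernelSum]
    rw [integral_weightedVolume hω]
    have hfi : Integrable f (weightedVolume (m + 1) ω) :=
      hf.memLp.integrable one_le_two
    have hfd := hf.differentiableOn
    have hsum := hasSum_integral_mul_tsum (fun k => isHolHomog_homComp hfd k)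
      (fun w hw => hasSum_homComp_one hfd hw) h.eq_zero_of_one_le
      ((integrable_weightedVolume_iff hω).1 hfi)
      (h.summable_kernelCoeff ‖z‖ (norm_nonneg z) hz1)
    have e : ∀ k, (kernelCoeff m (zeroExt ω) k : ℂ) * (((sphereConst m k *
        mom (zeroExt ω) (2 * k + (2 * m + 1)) : ℝ) : ℂ) * homComp f k z) =
        (ballVol m : ℂ) * homComp f k z := by
      intro k
      rw [← mul_assoc, ← Complex.ofReal_mul, h.kernelCoeff_mul]
    simp only [e] at hsum
    have h2 := hsum.unique ((hasSum_homComp_one hfd hz).mul_left (ballVol m : ℂ))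
    simp only [kernelSum, powerSum]
    rw [h2, inv_mul_cancel_left₀]
    exact_mod_cast (ballVol_pos m).ne'

/-- The difference d of two kernels lies in A² and is orthogonal to itself, so it vanishes almost
everywhere because ω > 0, and everywhere on the ball by continuity. -/
lemma eqOn_of_isBergmanKernel (hω : IsRadialWeight ω) {z : Cn m} {B B' : Cn m → ℂ}
    (hB : IsBergmanKernel (m + 1) ω z B) (hB' : IsBergmanKernel (m + 1) ω z B') :
    EqOn B B' (unitBall (m + 1)) := by
  have hc1 := hB.memBergman
  have hc2 := hB'.memBergman
  set d : Cn m → ℂ := fun w => B w - B' w with hd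
  have hdm : MemBergman (m + 1) ω 2 d :=
    ⟨hc1.differentiableOn.sub hc2.differentiableOn, hc1.memLp.sub hc2.memLp⟩
  have hint : ∀ {f g : Cn m → ℂ}, MemLp f 2 (weightedVolume (m + 1) ω) →
      MemLp g 2 (weightedVolume (m + 1) ω) →
      Integrable (fun w => f w * conj (g w)) (weightedVolume (m + 1) ω) := fun hf hg =>
    hf.integrable_mul hg.star
  have h1 : ∫ w, d w * conj (d w) ∂weightedVolume (m + 1) ω = 0 := by
    have e : ∀ w, d w * conj (d w) = d w * conj (B w) - d w * conj (B' w) := fun w => by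
      simp only [hd, map_sub]; ring
    simp only [e]
    rw [integral_sub (hint hdm.memLp hc1.memLp) (hint hdm.memLp hc2.memLp),
      ← hB.reproducing d hdm, ← hB'.reproducing d hdm, sub_self]
  have e2 : ∀ w, d w * conj (d w) = ((‖d w‖ ^ 2 : ℝ) : ℂ) := fun w => by
    rw [Complex.mul_conj']; push_cast; rfl
  have h3 := hint hdm.memLp hdm.memLp
  simp only [e2] at h1 h3
  have h6 : Integrable (fun w => ‖d w‖ ^ 2) (weightedVolume (m + 1) ω) := h3.re
  rw [integral_complex_ofReal, Complex.ofReal_eq_zero,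
    integral_eq_zero_iff_of_nonneg (fun w => by positivity) h6] at h1
  have h4 := (ae_weightedVolume_iff hω).1 h1
  have h5 : B =ᵐ[volume.restrict (unitBall (m + 1))] B' := by
    rw [Filter.EventuallyEq, ae_restrict_iff' measurableSet_ball]
    filter_upwards [h4] with w hw hwb
    have := hw hwb
    simpa [hd, sub_eq_zero] using this
  exact Measure.eqOn_open_of_ae_eq h5 isOpen_ball hc1.differentiableOn.continuousOn
    hc2.differentiableOn.continuousOn

lemma isBergmanKernel_bergmanKernel (hω : IsRadialWeight ω) (hd : IsDoubling ω) {z : Cn m}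
    (hz : z ∈ unitBall (m + 1)) :
    IsBergmanKernel (m + 1) ω z (bergmanKernel (m + 1) ω z) :=
  Classical.epsilon_spec (p := IsBergmanKernel (m + 1) ω z)
    ⟨_, isBergmanKernel_kernelSum hω hd hz⟩

lemma ae_conj_bergmanKernel_eq (hω : IsRadialWeight ω) (hd : IsDoubling ω) {z : Cn m}
    (hz : z ∈ unitBall (m + 1)) : ∀ᵐ w ∂weightedVolume (m + 1) ω,
      conj (bergmanKernel (m + 1) ω z w) = kernelSum m (zeroExt ω) (inner ℂ w z) := by
  rw [ae_weightedVolume_iff hω]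
  refine Filter.Eventually.of_forall fun w hw => ?_
  rw [← conj_kernelSum, eqOn_of_isBergmanKernel hω (isBergmanKernel_bergmanKernel hω hd hz)
    (isBergmanKernel_kernelSum hω hd hz) hw]

lemma bergmanProjection_eq (hω : IsRadialWeight ω) (hd : IsDoubling ω) (φ : Cn m → ℂ) {z : Cn m}
    (hz : z ∈ unitBall (m + 1)) : bergmanProjection (m + 1) ω φ z =
      (ballVol m : ℂ)⁻¹ *
        ∫ w, φ w * kernelSum m (zeroExt ω) (inner ℂ w z) * (zeroExt ω ‖w‖ : ℂ) := by
  rw [← integral_weightedVolume hω, bergmanProjection]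
  refine integral_congr_ae ?_
  filter_upwards [ae_conj_bergmanKernel_eq hω hd hz] with w hw
  rw [hw]

/-- The essential bound of a function in `L^∞` of the ball. -/
lemma ae_norm_le_of_memLp_top {φ : Cn m → ℂ} (hφ : MemLp φ ∞ (ballVolume (m + 1))) :
    ∀ᵐ w, w ∈ unitBall (m + 1) → ‖φ w‖ ≤ (eLpNorm φ ∞ (ballVolume (m + 1))).toReal := by
  rw [← ae_ballVolume_iff]
  have h1 := hφ.eLpNorm_lt_top.ne
  filter_upwards [ae_le_eLpNormEssSup (f := φ) (μ := ballVolume (m + 1))] with w hw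
  rw [← eLpNorm_exponent_top] at hw
  rw [← toReal_enorm]
  exact ENNReal.toReal_mono h1 hw

lemma IsRegularWeight.integrable_mul_kernelSum (h : IsRegularWeight m η) {φ : Cn m → ℂ}
    (hφ : MemLp φ ∞ (ballVolume (m + 1))) {z : Cn m} (hz : z ∈ unitBall (m + 1)) :
    Integrable fun w => φ w * kernelSum m η (inner ℂ w z) * (η ‖w‖ : ℂ) := by
  have hz1 : ‖z‖ < 1 := by simpa using hz
  obtain ⟨D, hD⟩ := h.exists_kernelSum_bound (norm_nonneg z) hz1
  refine h.integrable_mul (C := (eLpNorm φ ∞ (ballVolume (m + 1))).toReal * D)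
    ((aestronglyMeasurable_ballVolume_iff.1 hφ.aestronglyMeasurable).mul
      ((h.continuousOn_kernelSum_inner hz1.le).aestronglyMeasurable measurableSet_ball)) ?_
  filter_upwards [ae_norm_le_of_memLp_top hφ] with w hw hwb
  rw [norm_mul]
  exact mul_le_mul (hw hwb) (hD z le_rfl w hwb) (norm_nonneg _) ENNReal.toReal_nonneg

end

/-! ### Boundedness of the projection into the Bloch space -/

section

variable {m : ℕ} {ω η : ℝ → ℝ}

lemma radialDeriv_eq_fderiv (g : Cn m → ℂ) (z : Cn m) :
    radialDeriv (m + 1) g z = fderiv ℂ g z z := by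
  have e : z = ∑ k, z k • EuclideanSpace.single k (1 : ℂ) := by
    ext i
    simp [Finset.sum_apply, WithLp.ofLp_sum, Pi.single_apply]
  have h : fderiv ℂ g z (∑ k, z k • EuclideanSpace.single k (1 : ℂ)) = radialDeriv (m + 1) g z := by
    rw [map_sum]
    simp only [map_smul, smul_eq_mul, radialDeriv]
  rw [← h, ← e]

/-- A norm bound for an integral from an `L¹` bound of a majorant. -/
lemma norm_integral_le_of_lintegral_le {ψ : Cn m → ℂ} {G : Cn m → ℝ} {M D : ℝ} (hM : 0 ≤ M)
    (hD : 0 ≤ D) (hG : ∫⁻ w, ENNReal.ofReal (G w) ≤ ENNReal.ofReal D)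
    (hψ : ∀ᵐ w, ‖ψ w‖ ≤ M * G w) : ‖∫ w, ψ w‖ ≤ M * D := by
  refine (norm_integral_le_lintegral_norm ψ).trans ?_
  refine ENNReal.toReal_le_of_le_ofReal (by positivity) ?_
  calc ∫⁻ w, ENNReal.ofReal ‖ψ w‖ ≤ ∫⁻ w, ENNReal.ofReal M * ENNReal.ofReal (G w) := by
        refine lintegral_mono_ae ?_
        filter_upwards [hψ] with w hw
        rw [← ENNReal.ofReal_mul hM]
        exact ENNReal.ofReal_le_ofReal hw
    _ = ENNReal.ofReal M * ∫⁻ w, ENNReal.ofReal (G w) :=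
        lintegral_const_mul' _ _ ENNReal.ofReal_ne_top
    _ ≤ ENNReal.ofReal M * ENNReal.ofReal D := by gcongr
    _ = ENNReal.ofReal (M * D) := (ENNReal.ofReal_mul hM).symm

lemma IsRegularWeight.continuousOn_deriv_kernelSum (h : IsRegularWeight m η) :
    ContinuousOn (deriv (kernelSum m η)) (ball 0 1) := by
  have h1 : DifferentiableOn ℂ (kernelSum m η) (ball 0 1) := fun l hl =>
    (h.differentiableAt_kernelSum (by simpa using hl)).differentiableWithinAt
  exact (h1.deriv isOpen_ball).continuousOn

/-- Differentiation of the Bergman projection under the integral sign. -/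
lemma IsRegularWeight.hasFDerivAt_integral_kernelSum (h : IsRegularWeight m η) {φ : Cn m → ℂ}
    (hφ : MemLp φ ∞ (ballVolume (m + 1))) {z₀ : Cn m} (hz₀ : z₀ ∈ unitBall (m + 1)) :
    ∃ L : Cn m →L[ℂ] ℂ,
      HasFDerivAt (fun z => ∫ w, φ w * kernelSum m η (inner ℂ w z) * (η ‖w‖ : ℂ)) L z₀ ∧
      L z₀ = ∫ w, φ w * powerSum (fun k => k * (kernelCoeff m η k : ℂ)) (inner ℂ w z₀) *
        (η ‖w‖ : ℂ) := by
  have hz1 : ‖z₀‖ < 1 := by simpa using hz₀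
  set M := (eLpNorm φ ∞ (ballVolume (m + 1))).toReal with hM
  set ρ := (1 + ‖z₀‖) / 2 with hρ
  have hρ1 : ρ < 1 := by linarith
  have hρz : ‖z₀‖ < ρ := by linarith
  have hρ0 : 0 ≤ ρ := by positivity
  obtain ⟨D, hD⟩ := (isCompact_closedBall (0 : ℂ) ρ).exists_bound_of_continuousOn
    (h.continuousOn_deriv_kernelSum.mono (closedBall_subset_ball hρ1))
  have hin : ∀ w ∈ unitBall (m + 1), ∀ z : Cn m, ‖z‖ ≤ ρ → ‖(inner ℂ w z : ℂ)‖ ≤ ρ := by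
    intro w hw z hz
    rw [mem_ball_zero_iff] at hw
    refine (norm_inner_le_norm w z).trans ?_
    nlinarith [norm_nonneg w, norm_nonneg z]
  have hzs : ∀ L : Cn m →L[ℂ] ℂ, (0 : ℂ) • L = 0 := fun L => zero_smul ℂ L
  have hη0 : ∀ w : Cn m, w ∉ unitBall (m + 1) → (η ‖w‖ : ℂ) = 0 := fun w hw => by
    rw [h.eq_zero_of_one_le _ (by simpa using hw), Complex.ofReal_zero]
  set F' : Cn m → Cn m → Cn m →L[ℂ] ℂ := fun z w =>
    (φ w * deriv (kernelSum m η) (inner ℂ w z) * (η ‖w‖ : ℂ)) • innerSL ℂ w with hF'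
  have hbound : ∀ᵐ w, ∀ z ∈ ball (0 : Cn m) ρ, ‖F' z w‖ ≤ M * D * η ‖w‖ := by
    filter_upwards [ae_norm_le_of_memLp_top hφ] with w hw z hz
    rw [mem_ball_zero_iff] at hz
    by_cases hwb : w ∈ unitBall (m + 1)
    · have hw1 : ‖w‖ < 1 := by simpa using hwb
      have h1 := hD (inner ℂ w z) (by simpa using hin w hwb z hz.le)
      have h2 := hw hwb
      have h3 := h.nonneg ‖w‖
      have hD0 : 0 ≤ D := (norm_nonneg _).trans h1
      rw [hF', norm_smul, innerSL_apply_norm, norm_mul, norm_mul, Complex.norm_real,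
        Real.norm_of_nonneg h3]
      calc _ ≤ M * D * η ‖w‖ * 1 := by gcongr
        _ = _ := mul_one _
    · have h4 := h.eq_zero_of_one_le ‖w‖ (by simpa using hwb)
      have h5 : F' z w = 0 := by
        simp only [hF', h4, Complex.ofReal_zero, mul_zero]
        exact hzs _
      simp [h5, h4]
  have hmeas : AEStronglyMeasurable (F' z₀) volume := by
    have hc : ContinuousOn (fun w : Cn m => deriv (kernelSum m η) (inner ℂ w z₀))
        (unitBall (m + 1)) :=
      h.continuousOn_deriv_kernelSum.comp (by fun_prop) fun w hw => by
        simpa using (hin w hw z₀ hρz.le).trans_lt hρ1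
    have h1 := h.integrable_mul (m := m)
      (f := fun w => φ w * deriv (kernelSum m η) (inner ℂ w z₀)) (C := M * D)
      ((aestronglyMeasurable_ballVolume_iff.1 hφ.aestronglyMeasurable).mul
        (hc.aestronglyMeasurable measurableSet_ball)) (by
        filter_upwards [ae_norm_le_of_memLp_top hφ] with w hw hwb
        rw [norm_mul]
        exact mul_le_mul (hw hwb) (hD _ (by simpa using hin w hwb z₀ hρz.le)) (norm_nonneg _)
          ENNReal.toReal_nonneg)
    exact h1.aestronglyMeasurable.smul (innerSL ℂ).continuous.aestronglyMeasurable
  have hbi : Integrable (fun w : Cn m => M * D * η ‖w‖) := h.integrable_norm.const_mul _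
  have hz₀ρ : z₀ ∈ ball (0 : Cn m) ρ := by simpa using hρz
  have hmain := hasFDerivAt_integral_of_dominated_of_fderiv_le (𝕜 := ℂ) (μ := volume)
    (F := fun z w => φ w * kernelSum m η (inner ℂ w z) * (η ‖w‖ : ℂ)) (F' := F') (x₀ := z₀)
    (bound := fun w => M * D * η ‖w‖) (s := ball 0 ρ) (isOpen_ball.mem_nhds hz₀ρ)
    (by
      filter_upwards [isOpen_ball.mem_nhds hz₀] with z hz
      exact (h.integrable_mul_kernelSum hφ hz).aestronglyMeasurable)
    (h.integrable_mul_kernelSum hφ hz₀) hmeas hbound hbi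
    (Filter.Eventually.of_forall fun w z hz => by
      rw [mem_ball_zero_iff] at hz
      by_cases hwb : w ∈ unitBall (m + 1)
      · have h1 := (h.differentiableAt_kernelSum
          ((hin w hwb z hz.le).trans_lt hρ1)).hasDerivAt
        have h2 := h1.comp_hasFDerivAt z (innerSL ℂ w).hasFDerivAt
        have h3 := (h2.const_mul (φ w)).mul_const (η ‖w‖ : ℂ)
        refine h3.congr_fderiv ?_
        simp only [hF', smul_smul]
        congr 1
        ring
      · have h5 : F' z w = 0 := by
          simp only [hF', hη0 w hwb, mul_zero]
          exact hzs _
        simp only [h5, hη0 w hwb, mul_zero]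
        exact hasFDerivAt_const _ _)
  refine ⟨_, hmain, ?_⟩
  rw [ContinuousLinearMap.integral_apply (hbi.mono' hmeas (hbound.mono fun w hw => hw z₀ hz₀ρ))]
  refine integral_congr_ae (Filter.Eventually.of_forall fun w => ?_)
  by_cases hwb : w ∈ unitBall (m + 1)
  -- Evaluated in the direction z₀ itself, the derivative becomes l K'(l) at l = ⟨w, z₀⟩, which
  -- multiplies the k-th coefficient by k.
  · have h1 := (powerSum_aux h.summable_kernelCoeff
      ((hin w hwb z₀ hρz.le).trans_lt hρ1)).2
    simp only [hF', ← h1, kernelSum]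
    simp only [smul_apply, innerSL_apply_apply, smul_eq_mul]
    ring
  · simp [hF', hη0 w hwb]

/-- The Bergman projection is bounded from `L^∞` to the Bloch space. -/
theorem exists_blochNorm_bergmanProjection_le (m : ℕ) (hω : IsRadialWeight ω)
    (hd : IsDoubling ω) : ∃ C : ℝ≥0, ∀ φ : Cn m → ℂ, MemLp φ ∞ (ballVolume (m + 1)) →
      DifferentiableOn ℂ (bergmanProjection (m + 1) ω φ) (unitBall (m + 1)) ∧
      blochNorm (m + 1) (bergmanProjection (m + 1) ω φ) ≤
        C * eLpNorm φ ∞ (ballVolume (m + 1)) := by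
  have h := isRegularWeight_zeroExt m hω hd
  set η := zeroExt ω with hη
  have hV := ballVol_pos m
  obtain ⟨C₀, hC₀, hL1⟩ := lintegral_norm_tsum_le h (h.isSymbol_mul_kernelCoeff _)
  obtain ⟨D, hD⟩ := h.exists_kernelSum_bound le_rfl zero_lt_one
  have hD0 : 0 ≤ D := (norm_nonneg _).trans (hD 0 (by simp) 0 (by simp))
  set I₀ : ℝ := ∫ w : Cn m, η ‖w‖ with hI₀
  have hI₀' : 0 ≤ I₀ := integral_nonneg fun w => h.nonneg _
  -- The first summand controls the value at 0, with D a bound for the kernel at z = 0. The second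
  -- controls the radial derivative, its 2 coming from 1-|z|² ≤ 2(1-|z|).
  refine ⟨Real.toNNReal ((ballVol m)⁻¹ * (D * I₀) + 2 * ((ballVol m)⁻¹ * C₀)), fun φ hφ => ?_⟩
  set M := (eLpNorm φ ∞ (ballVolume (m + 1))).toReal with hM
  have hM0 : 0 ≤ M := ENNReal.toReal_nonneg
  have hloc : ∀ z ∈ unitBall (m + 1), ∃ L : Cn m →L[ℂ] ℂ,
      HasFDerivAt (bergmanProjection (m + 1) ω φ) L z ∧ L z = (ballVol m : ℂ)⁻¹ *
        ∫ w, φ w * powerSum (fun k => k * (kernelCoeff m η k : ℂ)) (inner ℂ w z) *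
          (η ‖w‖ : ℂ) := by
    intro z hz
    obtain ⟨L, hL, hLz⟩ := h.hasFDerivAt_integral_kernelSum hφ hz
    refine ⟨(ballVol m : ℂ)⁻¹ • L, (hL.const_mul _).congr_of_eventuallyEq ?_, ?_⟩
    · filter_upwards [isOpen_ball.mem_nhds hz] with z' hz'
      exact bergmanProjection_eq hω hd φ hz'
    · rw [smul_apply, hLz, smul_eq_mul]
  refine ⟨fun z hz => ?_, ?_⟩
  · obtain ⟨L, hL, -⟩ := hloc z hz
    exact hL.differentiableAt.differentiableWithinAt
  have h0 : ‖bergmanProjection (m + 1) ω φ 0‖ ≤ (ballVol m)⁻¹ * (D * I₀) * M := by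
    rw [bergmanProjection_eq hω hd φ (by simp), norm_mul, norm_inv, Complex.norm_real,
      Real.norm_of_nonneg hV.le, mul_assoc]
    refine mul_le_mul_of_nonneg_left ?_ (by positivity)
    have e : D * I₀ * M = ∫ w : Cn m, D * M * η ‖w‖ := by
      rw [integral_const_mul]; ring
    rw [e]
    refine norm_integral_le_of_norm_le (h.integrable_norm.const_mul _) ?_
    filter_upwards [ae_norm_le_of_memLp_top hφ] with w hw
    by_cases hwb : w ∈ unitBall (m + 1)
    · rw [norm_mul, norm_mul, Complex.norm_real, Real.norm_of_nonneg (h.nonneg _), mul_comm D]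
      have h1 := h.nonneg ‖w‖
      have h2 := hD 0 (by simp) w hwb
      have h3 := hw hwb
      gcongr
    · have h1 : η ‖w‖ = 0 := h.eq_zero_of_one_le _ (by simpa using hwb)
      simp [← hη, h1]
  have hrad : ∀ z ∈ unitBall (m + 1),
      (1 - ‖z‖ ^ 2) * ‖radialDeriv (m + 1) (bergmanProjection (m + 1) ω φ) z‖ ≤
        2 * ((ballVol m)⁻¹ * C₀) * M := by
    intro z hz
    have hz1 : ‖z‖ < 1 := by simpa using hz
    obtain ⟨L, hL, hLz⟩ := hloc z hz
    rw [radialDeriv_eq_fderiv, hL.fderiv, hLz, norm_mul, norm_inv, Complex.norm_real,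
      Real.norm_of_nonneg hV.le]
    have h1 := norm_integral_le_of_lintegral_le (ψ := fun w => φ w *
      powerSum (fun k => k * (kernelCoeff m η k : ℂ)) (inner ℂ w z) * (η ‖w‖ : ℂ)) hM0
      (div_nonneg hC₀ (by linarith)) (hL1 z hz) (by
        filter_upwards [ae_norm_le_of_memLp_top hφ] with w hw
        have h1 := h.nonneg ‖w‖
        by_cases hwb : w ∈ unitBall (m + 1)
        · have h3 := hw hwb
          rw [norm_mul, norm_mul, Complex.norm_real, Real.norm_of_nonneg h1, mul_assoc, powerSum]
          push_cast
          gcongr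
        · have h1 : η ‖w‖ = 0 := h.eq_zero_of_one_le _ (by simpa using hwb)
          simp [h1])
    have h2 : (1 - ‖z‖ ^ 2) * (M * (C₀ / (1 - ‖z‖))) ≤ 2 * C₀ * M := by
      have e : (1 - ‖z‖ ^ 2) * (M * (C₀ / (1 - ‖z‖))) = (1 + ‖z‖) * (M * C₀) := by
        have : 1 - ‖z‖ ≠ 0 := by linarith
        field_simp
        ring
      rw [e]
      nlinarith [mul_nonneg hM0 hC₀]
    have h3 : 0 ≤ 1 - ‖z‖ ^ 2 := by nlinarith [norm_nonneg z]
    calc _ = (ballVol m)⁻¹ * ((1 - ‖z‖ ^ 2) * _) := by rw [mul_left_comm]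
      _ ≤ (ballVol m)⁻¹ * (2 * C₀ * M) :=
          mul_le_mul_of_nonneg_left ((mul_le_mul_of_nonneg_left h1 h3).trans h2) (by positivity)
      _ = _ := by ring
  have hfin : eLpNorm φ ∞ (ballVolume (m + 1)) = ENNReal.ofReal M :=
    (ENNReal.ofReal_toReal hφ.eLpNorm_lt_top.ne).symm
  rw [hfin, ← ENNReal.ofReal.eq_1, ← ENNReal.ofReal_mul (by positivity), add_mul,
    ENNReal.ofReal_add (by positivity) (by positivity), blochNorm]
  refine add_le_add ?_ (iSup₂_le fun z hz => ?_)
  · rw [← ofReal_norm]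
    exact ENNReal.ofReal_le_ofReal h0
  · have hz1 : ‖z‖ < 1 := by simpa using hz
    rw [← ofReal_norm, ← ENNReal.ofReal_mul (by nlinarith [norm_nonneg z])]
    exact ENNReal.ofReal_le_ofReal (hrad z hz)

end

/-! ### Reverse doubling and surjectivity -/

section

variable {m : ℕ} {ω η : ℝ → ℝ}

/-- Regular weights whose moments have the relative decay of a reverse doubling weight. -/
structure IsGapWeight (m : ℕ) (η : ℝ → ℝ) : Prop extends IsRegularWeight m η where
  gap : ∃ c, 0 < c ∧ ∀ k : ℕ, c * (mom η (2 * k + (2 * m + 1)) / ((k : ℝ) + 1)) ≤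
    mom η (2 * k + (2 * m + 1)) - mom η (2 * (k + 1) + (2 * m + 1))

lemma isGapWeight_zeroExt (m : ℕ) (hω : IsRadialWeight ω) (hd : IsDoubling ω)
    (hr : IsReverseDoubling ω) : IsGapWeight m (zeroExt ω) := by
  obtain ⟨C, hC, h⟩ := exists_tail_le hd
  obtain ⟨K, hK, L, hL, h'⟩ := hr
  refine { toIsRegularWeight := isRegularWeight_zeroExt m hω hd, gap := ?_ }
  refine exists_le_mom_sub m (isWeight_zeroExt hω) hC h hK hL fun t ht => ?_
  have h1 : (1 - t) / K ≤ 1 := by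
    rw [div_le_one (by linarith)]
    linarith [ht.1]
  rw [tail_zeroExt ht.1.le, tail_zeroExt (by linarith)]
  exact h' t ht

/-- The multiplier `u k / (u k - u (k + 1))`, where `u` is the sequence of odd moments. -/
noncomputable def gapRatio (m : ℕ) (η : ℝ → ℝ) (k : ℕ) : ℝ :=
  mom η (2 * k + (2 * m + 1)) /
    (mom η (2 * k + (2 * m + 1)) - mom η (2 * (k + 1) + (2 * m + 1)))

lemma IsRegularWeight.mom_one_sub_sq_mul (h : IsRegularWeight m η) (k : ℕ) :
    mom (fun r => (1 - r ^ 2) ^ 1 * η r) (2 * k + (2 * m + 1)) =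
      mom η (2 * k + (2 * m + 1)) - mom η (2 * (k + 1) + (2 * m + 1)) := by
  have h1 := congrFun (h.diffSeq_mom 0) k
  simp only [diffSeq, pow_zero, one_mul, zero_add] at h1
  linarith

namespace IsGapWeight

lemma sub_pos (h : IsGapWeight m η) (k : ℕ) :
    0 < mom η (2 * k + (2 * m + 1)) - mom η (2 * (k + 1) + (2 * m + 1)) := by
  obtain ⟨c, hc, hg⟩ := h.gap
  have := h.pos k
  exact lt_of_lt_of_le (by positivity) (hg k)

lemma gapRatio_mul (h : IsGapWeight m η) (k : ℕ) :
    gapRatio m η k * (mom η (2 * k + (2 * m + 1)) - mom η (2 * (k + 1) + (2 * m + 1))) =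
      mom η (2 * k + (2 * m + 1)) :=
  div_mul_cancel₀ _ (h.sub_pos k).ne'

/-- The denominator is -Δu, a symbol of size u_k/(k+1) with one order lost, hence J + 1 for u. The
gap condition is the lower bound that allows inversion. -/
lemma isSymbol_gapRatio (h : IsGapWeight m η) (J : ℕ) :
    IsSymbol J (fun k => (k : ℝ) + 1) (gapRatio m η) := by
  obtain ⟨c, hc, hg⟩ := h.gap
  obtain ⟨A, hA, hd⟩ := h.doubling
  have h1 := (h.isSymbol_mom (J + 1)).2.neg
  have h2 : IsSymbol J (fun k : ℕ => mom η (2 * k + (2 * m + 1)) / ((k : ℝ) + 1))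
      (fun k => mom η (2 * k + (2 * m + 1)) - mom η (2 * (k + 1) + (2 * m + 1))) := by
    simpa only [diffSeq, neg_sub] using h1
  have h3 := h2.inv hc (mul_nonneg zero_le_two hA)
    (fun k => by have := h.pos k; positivity) (fun k => ?_) hg
  · have h4 := (h.isSymbol_mom J).mul (fun k => (h.pos k).le)
      (fun k => by have := h.pos k; positivity) h3
    refine IsSymbol.mono (V := fun k : ℕ => (k : ℝ) + 1) h4 zero_le_one fun k => le_of_eq ?_
    have := (h.pos k).ne'
    field_simp
  · have h5 := hd k (k + 1) (by omega)
    have h6 := h.pos (k + 1)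
    have h7 : (0 : ℝ) < (k : ℝ) + 1 := by positivity
    have h8 : (0 : ℝ) < ((k + 1 : ℕ) : ℝ) + 1 := by positivity
    rw [mul_div_assoc', div_le_div_iff₀ h7 h8]
    push_cast at *
    have h9 : ((k : ℝ) + 1 + 1) ≤ 2 * (k + 1) := by linarith
    calc _ ≤ A * mom η (2 * (k + 1) + (2 * m + 1)) * (2 * (k + 1)) :=
          mul_le_mul h5 h9 (by positivity) (by positivity)
      _ = _ := by ring

/-- The coefficients of the kernel that recovers `∑ t k * g k` from the radial derivative. -/
lemma isSymbol_inverseCoeff (h : IsGapWeight m η) (J : ℕ) :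
    IsSymbol J (fun k : ℕ => ((k : ℝ) + 1) ^ (m + 1) / mom η (2 * k + (2 * m + 1)))
      (fun k => gapRatio m η (k + 1) ^ 2 * kernelCoeff m η (k + 1) * ((k : ℝ) + 1)⁻¹ *
        (ballVol m)⁻¹) := by
  obtain ⟨A, hA, hd⟩ := h.doubling
  have hp : ∀ k : ℕ, (0 : ℝ) ≤ (k : ℝ) + 1 := fun k => by positivity
  have hq : ∀ k : ℕ, 0 ≤ ((k : ℝ) + 1) ^ m / mom η (2 * k + (2 * m + 1)) := fun k => by
    have := h.pos k; positivity
  have hu : ∀ k : ℕ, 0 ≤ ((k : ℝ) + 1) * ((k : ℝ) + 1) *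
      (((k : ℝ) + 1) ^ m / mom η (2 * k + (2 * m + 1))) := fun k =>
    mul_nonneg (mul_nonneg (hp k) (hp k)) (hq k)
  -- Size count: (k+1)² from the squared ratio, (k+1)^m / u_k from the kernel, and a division by
  -- k+1, hence (k+1)^{m+1} / u_k. The shift from k+1 to k is harmless by doubling.
  have h1 := (((h.isSymbol_gapRatio J).mul hp hp (h.isSymbol_gapRatio J)).mul
    (fun k => mul_nonneg (hp k) (hp k)) hq (h.isSymbol_kernelCoeff J)).shift
    (C := 2 ^ (m + 2) * A) hu (by positivity) (fun k => by
      have h5 := hd k (k + 1) (by omega)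
      have h6 := h.pos (k + 1)
      have h7 := h.pos k
      have h9 : ((k : ℝ) + 1 + 1) ≤ 2 * (k + 1) := by
        have : (0 : ℝ) ≤ k := k.cast_nonneg
        linarith
      push_cast
      rw [mul_div_assoc', mul_div_assoc', mul_div_assoc', div_le_div_iff₀ h6 h7]
      calc ((k : ℝ) + 1 + 1) * (k + 1 + 1) * (k + 1 + 1) ^ m * mom η (2 * k + (2 * m + 1))
          ≤ (2 * (k + 1)) * (2 * (k + 1)) * (2 * (k + 1)) ^ m *
            (A * mom η (2 * (k + 1) + (2 * m + 1))) := by gcongr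
        _ = _ := by rw [mul_pow]; ring)
  have h2 := (IsSymbol.natCast_add (J := J) 1).inv one_pos zero_le_one
    (fun k => by positivity) (fun k => by push_cast; linarith) (fun k => by simp)
  have h3 := (h1.mul hu (fun k => by positivity) h2).mul
    (fun k => mul_nonneg (hu k) (by positivity)) (fun _ => zero_le_one)
    (IsSymbol.const (J := J) (ballVol m)⁻¹)
  have e : (fun k => gapRatio m η (k + 1) ^ 2 * kernelCoeff m η (k + 1) * ((k : ℝ) + 1)⁻¹ *
        (ballVol m)⁻¹) = fun k => gapRatio m η (k + 1) * gapRatio m η (k + 1) *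
        kernelCoeff m η (k + 1) * ((k : ℝ) + 1)⁻¹ * (ballVol m)⁻¹ := by
    funext k; ring
  rw [e]
  refine h3.mono (C := 1) zero_le_one fun k => le_of_eq ?_
  have := (h.pos k).ne'
  field_simp
  ring

end IsGapWeight

/-! ### Radial derivatives and the multiplier on homogeneous components -/

section radial

variable {g : Cn m → ℂ}

lemma homComp_zero (g : Cn m → ℂ) (w : Cn m) : homComp g 0 w = g 0 := by
  simp [homComp]

/-- The radial derivative at w is the derivative at l = 1 of the slice l ↦ g(l w), which is
holomorphic on a disc of radius greater than 1; its Taylor series is differentiated there. -/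
lemma hasSum_radialDeriv (hg : DifferentiableOn ℂ g (unitBall (m + 1))) {w : Cn m}
    (hw : w ∈ unitBall (m + 1)) :
    HasSum (fun k : ℕ => (k : ℂ) * homComp g k w) (radialDeriv (m + 1) g w) := by
  obtain ⟨R, hR, hRw⟩ := exists_radius w (l := 1) (by simpa using hw)
  rw [norm_one] at hR
  set s : ℂ → ℂ := fun l => g (l • w) with hs
  have h1 := Complex.hasSum_taylorSeries_on_ball
    ((differentiableOn_slice hg w hRw).deriv isOpen_ball) (z := 1) (by simpa using hR)
  have h2 : deriv s 1 = radialDeriv (m + 1) g w := by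
    rw [radialDeriv_eq_fderiv]
    have h3 : HasFDerivAt g (fderiv ℂ g w) ((1 : ℂ) • w) := by
      rw [one_smul]
      exact (hg.differentiableAt (isOpen_ball.mem_nhds hw)).hasFDerivAt
    have h4 : HasDerivAt (fun l : ℂ => l • w) w 1 := by
      simpa using (hasDerivAt_id (1 : ℂ)).smul_const w
    exact (h3.comp_hasDerivAt 1 h4).deriv
  rw [h2] at h1
  have h5 : HasSum (fun k : ℕ => ((k + 1 : ℕ) : ℂ) * homComp g (k + 1) w)
      (radialDeriv (m + 1) g w) := by
    refine h1.congr_fun fun k => ?_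
    rw [← iteratedDeriv_succ', homComp, Nat.factorial_succ]
    have : ((k : ℂ) + 1) ≠ 0 := by exact_mod_cast k.succ_ne_zero
    push_cast
    simp only [sub_zero, one_pow, smul_eq_mul, mul_inv]
    field_simp
  simpa using (hasSum_nat_add_iff (f := fun k : ℕ => (k : ℂ) * homComp g k w) 1).1 h5

/-- The expansion still converges at w/ρ for some ρ < 1, so the components at w decay like ρ^k and a
linearly growing multiplier is harmless. -/
lemma summable_mul_homComp (hg : DifferentiableOn ℂ g (unitBall (m + 1))) {t : ℕ → ℝ}
    (ht : ∃ C, 0 ≤ C ∧ ∀ k, |t k| ≤ C * ((k : ℝ) + 1)) {w : Cn m} (hw : w ∈ unitBall (m + 1)) :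
    Summable fun k => (t k : ℂ) * homComp g k w := by
  obtain ⟨C, hC, ht⟩ := ht
  have hw1 : ‖w‖ < 1 := by simpa using hw
  set ρ : ℝ := (1 + ‖w‖) / 2 with hρ
  have hρ0 : 0 < ρ := by positivity
  have hρ1 : ρ < 1 := by linarith
  have h1 := (hasSum_homComp hg w (l := ((ρ⁻¹ : ℝ) : ℂ)) (by
    rw [Complex.norm_real, Real.norm_of_nonneg (by positivity), inv_mul_lt_one₀ hρ0]
    linarith)).summable.norm
  set D := ∑' k, ‖homComp g k w * ((ρ⁻¹ : ℝ) : ℂ) ^ k‖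
  have hD : ∀ k, ‖homComp g k w‖ ≤ D * ρ ^ k := fun k => by
    have h2 := h1.le_tsum k fun _ _ => norm_nonneg _
    rw [norm_mul, norm_pow, Complex.norm_real, Real.norm_of_nonneg (by positivity), inv_pow,
      ← div_eq_mul_inv, div_le_iff₀ (by positivity)] at h2
    exact h2
  refine Summable.of_norm_bounded
    ((summable_add_one_pow_mul_geometric 1 hρ0.le hρ1).mul_left (C * D)) fun k => ?_
  rw [norm_mul, Complex.norm_real, Real.norm_eq_abs]
  calc |t k| * ‖homComp g k w‖ ≤ (C * ((k : ℝ) + 1)) * (D * ρ ^ k) :=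
        mul_le_mul (ht k) (hD k) (norm_nonneg _) (by positivity)
    _ = _ := by ring

/-- The function `∑ t k * g k` for the multiplier `gapRatio`. -/
noncomputable def gapSum (m : ℕ) (η : ℝ → ℝ) (g : Cn m → ℂ) (w : Cn m) : ℂ :=
  ∑' k, (gapRatio m η k : ℂ) * homComp g k w

lemma IsGapWeight.hasSum_gapSum (h : IsGapWeight m η)
    (hg : DifferentiableOn ℂ g (unitBall (m + 1))) {w : Cn m} (hw : w ∈ unitBall (m + 1)) :
    HasSum (fun k => (gapRatio m η k : ℂ) * homComp g k w) (gapSum m η g w) :=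
  (summable_mul_homComp hg (h.isSymbol_gapRatio 0).exists_bound hw).hasSum

lemma IsGapWeight.aestronglyMeasurable_gapSum (h : IsGapWeight m η)
    (hg : DifferentiableOn ℂ g (unitBall (m + 1))) :
    AEStronglyMeasurable (gapSum m η g) (volume.restrict (unitBall (m + 1))) := by
  refine aestronglyMeasurable_of_tendsto_ae Filter.atTop
    (f := fun N w => ∑ k ∈ Finset.range N, (gapRatio m η k : ℂ) * homComp g k w) (fun N => ?_) ?_
  · refine Continuous.aestronglyMeasurable (continuous_finsetSum _ fun k _ => ?_)
    exact continuous_const.mul (continuous_homComp hg k)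
  · filter_upwards [ae_restrict_mem measurableSet_ball] with w hw
    exact (h.hasSum_gapSum hg hw).tendsto_sum_nat

lemma norm_radialDeriv_le (hg : MemBloch (m + 1) g) {w : Cn m} (hw : w ∈ unitBall (m + 1)) :
    (1 - ‖w‖ ^ 2) * ‖radialDeriv (m + 1) g w‖ ≤ (blochNorm (m + 1) g).toReal := by
  have hw1 : ‖w‖ < 1 := by simpa using hw
  have h0 : 0 ≤ 1 - ‖w‖ ^ 2 := by nlinarith [norm_nonneg w]
  rw [← ENNReal.ofReal_le_iff_le_toReal hg.blochNorm_lt_top.ne, ENNReal.ofReal_mul h0,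
    ofReal_norm, blochNorm]
  exact (le_iSup₂ (f := fun (z : Cn m) (_ : z ∈ unitBall (m + 1)) =>
    ENNReal.ofReal (1 - ‖z‖ ^ 2) * ‖radialDeriv (m + 1) g z‖ₑ) w hw).trans le_add_self

lemma measurable_radialDeriv (g : Cn m → ℂ) : Measurable (radialDeriv (m + 1) g) := by
  unfold radialDeriv
  refine Finset.measurable_sum _ fun k _ => Measurable.mul (by fun_prop) ?_
  exact measurable_fderiv_apply_const ℂ g _

/-- The growth of `gapSum` for Bloch functions. -/
lemma IsGapWeight.exists_norm_gapSum_le (h : IsGapWeight m η) (hg : MemBloch (m + 1) g) :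
    ∃ C D, 0 ≤ C ∧ 0 ≤ D ∧ ∀ z ∈ unitBall (m + 1), ‖gapSum m η g z‖ ≤ C + D / (1 - ‖z‖) := by
  have hgd := hg.differentiableOn
  set M := (blochNorm (m + 1) g).toReal with hM
  have hM0 : 0 ≤ M := ENNReal.toReal_nonneg
  have hsym := h.isSymbol_inverseCoeff (2 * (m + 1))
  obtain ⟨C₀, hC₀, hL1⟩ := lintegral_norm_tsum_le h.toIsRegularWeight hsym
  set a : ℕ → ℝ := fun k => gapRatio m η (k + 1) ^ 2 * kernelCoeff m η (k + 1) *
    ((k : ℝ) + 1)⁻¹ * (ballVol m)⁻¹ with ha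
  refine ⟨‖(gapRatio m η 0 : ℂ) * g 0‖, M * C₀, norm_nonneg _, by positivity, fun z hz => ?_⟩
  have hz1 : ‖z‖ < 1 := by simpa using hz
  -- The radial derivative has no constant term, so degree 0 is handled apart and the coefficients
  -- are shifted by one.
  set b : ℕ → ℂ := fun k => Nat.casesOn k 0 fun j => (a j : ℂ) with hb
  have hb0 : b 0 = 0 := rfl
  have hb1 : ∀ k, b (k + 1) = a k := fun k => rfl
  have hsa := h.summable_of_isSymbol hsym ‖z‖ (norm_nonneg z) hz1
  have hsb : Summable fun k => ‖b k‖ * ‖z‖ ^ k := by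
    rw [← summable_nat_add_iff 1]
    refine (hsa.mul_right ‖z‖).congr fun k => ?_
    rw [hb1, pow_succ, mul_assoc]
  have hint : Integrable fun w : Cn m => radialDeriv (m + 1) g w *
      (((1 - ‖w‖ ^ 2) ^ 1 * η ‖w‖ : ℝ) : ℂ) := by
    have h1 := h.integrable_mul (f := fun w : Cn m => radialDeriv (m + 1) g w *
      ((1 - ‖w‖ ^ 2 : ℝ) : ℂ)) (C := M)
      (((measurable_radialDeriv g).mul (by fun_prop)).aestronglyMeasurable)
      (Filter.Eventually.of_forall fun w hw => by
        have hw1 : ‖w‖ < 1 := by simpa using hw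
        rw [norm_mul, Complex.norm_real, Real.norm_of_nonneg (by nlinarith [norm_nonneg w]),
          mul_comm]
        exact norm_radialDeriv_le hg hw)
    refine h1.congr (Filter.Eventually.of_forall fun w => ?_)
    simp only [pow_one]
    push_cast
    ring
  have hS := hasSum_integral_mul_tsum (h := fun k w => (k : ℂ) * homComp g k w)
    (fun k => (isHolHomog_homComp hgd k).const_mul _) (f := radialDeriv (m + 1) g)
    (fun w hw => hasSum_radialDeriv hgd hw) (η := fun r => (1 - r ^ 2) ^ 1 * η r)
    (fun r hr => by simp [h.eq_zero_of_one_le r hr]) hint hsb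
  set I := ∫ w, radialDeriv (m + 1) g w * (∑' k, b k * (inner ℂ w z : ℂ) ^ k) *
    (((1 - ‖w‖ ^ 2) ^ 1 * η ‖w‖ : ℝ) : ℂ) with hI
  -- In degree k + 1 the pairing of ℜg with the kernel, against (1-r²)η, produces a_k times
  -- `sphereConst`, the moment gap and k + 1. The definition of a_k makes this product equal to the
  -- multiplier.
  have hT : gapSum m η g z = (gapRatio m η 0 : ℂ) * g 0 + I := by
    have h1 := (hasSum_nat_add_iff' 1).2 (h.hasSum_gapSum hgd hz)
    have h2 := (hasSum_nat_add_iff' 1).2 hS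
    rw [Finset.sum_range_one, homComp_zero] at h1
    rw [Finset.sum_range_one] at h2
    have h3 := h1.unique (h2.congr_fun fun k => ?_)
    · rw [hb0, zero_mul, sub_zero] at h3
      rw [← h3]; ring
    · have h4 := h.gapRatio_mul (k + 1)
      have h5 := h.kernelCoeff_mul (k + 1)
      have h6 := (ballVol_pos m).ne'
      have h7 : ((k : ℝ) + 1) ≠ 0 := by positivity
      rw [h.mom_one_sub_sq_mul]
      have h8 : gapRatio m η (k + 1) = a k * (sphereConst m (k + 1) *
          (mom η (2 * (k + 1) + (2 * m + 1)) - mom η (2 * (k + 1 + 1) + (2 * m + 1)))) *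
          ((k : ℝ) + 1) := by
        calc gapRatio m η (k + 1) = gapRatio m η (k + 1) * (kernelCoeff m η (k + 1) *
              (sphereConst m (k + 1) * mom η (2 * (k + 1) + (2 * m + 1)))) * (ballVol m)⁻¹ := by
              rw [h5, mul_assoc, mul_inv_cancel₀ h6, mul_one]
          _ = gapRatio m η (k + 1) * (kernelCoeff m η (k + 1) *
              (sphereConst m (k + 1) * (gapRatio m η (k + 1) *
                (mom η (2 * (k + 1) + (2 * m + 1)) -
                  mom η (2 * (k + 1 + 1) + (2 * m + 1)))))) * (ballVol m)⁻¹ := by rw [h4]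
          _ = _ := by
            simp only [ha]
            field_simp
      rw [h8]
      rw [hb1]
      push_cast
      ring
  have hIb : ‖I‖ ≤ M * (C₀ / (1 - ‖z‖)) := by
    refine norm_integral_le_of_lintegral_le hM0 (div_nonneg hC₀ (by linarith)) (hL1 z hz)
      (Filter.Eventually.of_forall fun w => ?_)
    by_cases hwb : w ∈ unitBall (m + 1)
    · have hw1 : ‖w‖ < 1 := by simpa using hwb
      have hl := norm_inner_lt_one hwb hz1.le
      have hlz : ‖(inner ℂ w z : ℂ)‖ ≤ ‖z‖ := by
        refine (norm_inner_le_norm w z).trans ?_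
        nlinarith [norm_nonneg z]
      -- The shift amounts to a factor ⟨w, z⟩ of modulus less than 1, so the L¹ bound for the series
      -- with coefficients a_k applies.
      have e : ∑' k, b k * (inner ℂ w z : ℂ) ^ k =
          inner ℂ w z * ∑' k, (a k : ℂ) * (inner ℂ w z : ℂ) ^ k := by
        rw [Summable.tsum_eq_zero_add (Summable.of_norm_bounded hsb fun k => by
          rw [norm_mul, norm_pow]; gcongr), ← tsum_mul_left]
        rw [hb0, zero_mul, zero_add]
        exact tsum_congr fun k => by rw [hb1]; ring
      have h0 : 0 ≤ 1 - ‖w‖ ^ 2 := by nlinarith [norm_nonneg w]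
      have h1 := norm_radialDeriv_le hg hwb
      have h2 := h.nonneg ‖w‖
      rw [e, norm_mul, norm_mul, norm_mul, Complex.norm_real, pow_one,
        Real.norm_of_nonneg (mul_nonneg h0 h2)]
      set X := ‖∑' k, (a k : ℂ) * (inner ℂ w z : ℂ) ^ k‖
      calc _ = ((1 - ‖w‖ ^ 2) * ‖radialDeriv (m + 1) g w‖) * (‖(inner ℂ w z : ℂ)‖ * (X * η ‖w‖)) :=
            by ring
        _ ≤ M * (1 * (X * η ‖w‖)) := by
            have hX : 0 ≤ X := norm_nonneg _
            gcongr
        _ = _ := by ring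
    · have h1 : η ‖w‖ = 0 := h.eq_zero_of_one_le _ (by simpa using hwb)
      simp [h1]
  rw [hT, mul_div_assoc]
  exact (norm_add_le _ _).trans (by gcongr)

end radial

/-- The Bergman projection maps `L^∞` onto the Bloch space for reverse doubling weights. -/
theorem exists_bergmanProjection_eqOn (hω : IsRadialWeight ω) (hd : IsDoubling ω)
    (hr : IsReverseDoubling ω) {g : Cn m → ℂ} (hg : MemBloch (m + 1) g) :
    ∃ φ : Cn m → ℂ, MemLp φ ∞ (ballVolume (m + 1)) ∧
      EqOn (bergmanProjection (m + 1) ω φ) g (unitBall (m + 1)) := by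
  have h := isGapWeight_zeroExt m hω hd hr
  set η := zeroExt ω with hη
  have hgd := hg.differentiableOn
  obtain ⟨C, D, hC, hD, hb⟩ := h.exists_norm_gapSum_le hg
  set φ : Cn m → ℂ := fun w => ((1 - ‖w‖ ^ 2 : ℝ) : ℂ) * gapSum m η g w with hφ
  have hmeas : AEStronglyMeasurable φ (volume.restrict (unitBall (m + 1))) :=
    (Continuous.aestronglyMeasurable (by fun_prop)).mul (h.aestronglyMeasurable_gapSum hgd)
  have hbound : ∀ w ∈ unitBall (m + 1), ‖φ w‖ ≤ C + 2 * D := by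
    intro w hw
    have hw1 : ‖w‖ < 1 := by simpa using hw
    have hw0 := norm_nonneg w
    have h0 : 0 ≤ 1 - ‖w‖ ^ 2 := by nlinarith
    rw [hφ, norm_mul, Complex.norm_real, Real.norm_of_nonneg h0]
    have e : (1 - ‖w‖ ^ 2) * (C + D / (1 - ‖w‖)) = (1 - ‖w‖ ^ 2) * C + (1 + ‖w‖) * D := by
      have : 1 - ‖w‖ ≠ 0 := by linarith
      field_simp
      ring
    refine (mul_le_mul_of_nonneg_left (hb w hw) h0).trans (e.le.trans ?_)
    have : (1 - ‖w‖ ^ 2) * C ≤ 1 * C := mul_le_mul_of_nonneg_right (by nlinarith) hC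
    nlinarith
  have hLp : MemLp φ ∞ (ballVolume (m + 1)) :=
    memLp_top_of_bound (aestronglyMeasurable_ballVolume_iff.2 hmeas) (C + 2 * D)
      (ae_ballVolume_iff.2 (Filter.Eventually.of_forall hbound))
  refine ⟨φ, hLp, fun z hz => ?_⟩
  have hz1 : ‖z‖ < 1 := by simpa using hz
  have hint : Integrable fun w : Cn m => gapSum m η g w *
      (((1 - ‖w‖ ^ 2) ^ 1 * η ‖w‖ : ℝ) : ℂ) := by
    refine (h.integrable_mul hmeas (Filter.Eventually.of_forall hbound)).congr
      (Filter.Eventually.of_forall fun w => ?_)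
    simp only [hφ, pow_one]
    push_cast
    ring
  have hS := hasSum_integral_mul_tsum (h := fun k w => (gapRatio m η k : ℂ) * homComp g k w)
    (fun k => (isHolHomog_homComp hgd k).const_mul _) (f := gapSum m η g)
    (fun w hw => h.hasSum_gapSum hgd hw) (η := fun r => (1 - r ^ 2) ^ 1 * η r)
    (fun r hr => by simp [h.eq_zero_of_one_le r hr]) hint
    (h.summable_kernelCoeff ‖z‖ (norm_nonneg z) hz1)
  have hS' := ((hasSum_homComp_one hgd hz).mul_left (ballVol m : ℂ)).unique
    (hS.congr_fun fun k => ?_)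
  · have hV : (ballVol m : ℂ) ≠ 0 := by exact_mod_cast (ballVol_pos m).ne'
    rw [bergmanProjection_eq hω hd φ hz, inv_mul_eq_iff_eq_mul₀ hV, hS']
    refine integral_congr_ae (Filter.Eventually.of_forall fun w => ?_)
    simp only [hφ, pow_one, kernelSum, powerSum]
    push_cast
    ring
  -- The factor 1-|w|² of φ turns u_k into u_k - u_{k+1}, and the multiplier turns it back into u_k,
  -- so each component of g is reproduced.
  · have e : ballVol m = kernelCoeff m η k * (sphereConst m k * (gapRatio m η k *
        (mom η (2 * k + (2 * m + 1)) - mom η (2 * (k + 1) + (2 * m + 1))))) := by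
      rw [h.gapRatio_mul, h.kernelCoeff_mul]
    rw [h.mom_one_sub_sq_mul, e]
    push_cast
    ring

end

end RadialBergman

theorem theorem4p1 (n : ℕ) (hn : 1 ≤ n) (ω : ℝ → ℝ) (hω : IsRadialWeight ω)
    (hdoubling : IsDoubling ω) :
    -- the reproducing kernel exists and is unique as a function on the ball
    (∀ z ∈ unitBall n, IsBergmanKernel n ω z (bergmanKernel n ω z) ∧
      ∀ B : EuclideanSpace ℂ (Fin n) → ℂ, IsBergmanKernel n ω z B →
        EqOn B (bergmanKernel n ω z) (unitBall n)) ∧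
    -- the integral that defines the projection converges on `L^∞`
    (∀ φ : EuclideanSpace ℂ (Fin n) → ℂ, MemLp φ ∞ (ballVolume n) → ∀ z ∈ unitBall n,
      Integrable (fun ξ => φ ξ * conj (bergmanKernel n ω z ξ)) (weightedVolume n ω)) ∧
    -- the projection is bounded from `L^∞` to the Bloch space
    (∃ C : ℝ≥0, ∀ φ : EuclideanSpace ℂ (Fin n) → ℂ, MemLp φ ∞ (ballVolume n) →
      MemBloch n (bergmanProjection n ω φ) ∧
      blochNorm n (bergmanProjection n ω φ) ≤ C * eLpNorm φ ∞ (ballVolume n)) ∧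
    -- for weights that are also reverse doubling, it is onto
    (IsReverseDoubling ω → ∀ g : EuclideanSpace ℂ (Fin n) → ℂ, MemBloch n g →
      ∃ φ : EuclideanSpace ℂ (Fin n) → ℂ, MemLp φ ∞ (ballVolume n) ∧
        EqOn (bergmanProjection n ω φ) g (unitBall n)) := by

  obtain ⟨m, rfl⟩ : ∃ m, n = m + 1 := ⟨n - 1, by omega⟩
  refine ⟨fun z hz => ⟨RadialBergman.isBergmanKernel_bergmanKernel hω hdoubling hz, fun B hB =>
    RadialBergman.eqOn_of_isBergmanKernel hω hB
      (RadialBergman.isBergmanKernel_bergmanKernel hω hdoubling hz)⟩,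
    fun φ hφ z hz => ?_, ?_, fun hr g hg =>
      RadialBergman.exists_bergmanProjection_eqOn hω hdoubling hr hg⟩
  · refine ((RadialBergman.integrable_weightedVolume_iff hω).2
      ((RadialBergman.isRegularWeight_zeroExt m hω hdoubling).integrable_mul_kernelSum
        hφ hz)).congr ?_
    filter_upwards [RadialBergman.ae_conj_bergmanKernel_eq hω hdoubling hz] with w hw
    rw [hw]
  · obtain ⟨C, hC⟩ := RadialBergman.exists_blochNorm_bergmanProjection_le m hω hdoubling
    exact ⟨C, fun φ hφ => ⟨⟨(hC φ hφ).1, (hC φ hφ).2.trans_lt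
      (ENNReal.mul_lt_top ENNReal.coe_lt_top hφ.eLpNorm_lt_top)⟩, (hC φ hφ).2⟩⟩
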